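/- **Setting.** Let $T\ge 0$, let $m\ge 4$ be an integer, $K\in\mathbb R$, and let $\nu$ be a Lévy measure on $\mathbb R$, i.e. a Borel measure with $\nu(\{0\})=0$ and $\int_{\mathbb R}1\wedge z^2\,\nu(dz)<\infty$. Put $\mu_0=\nu(\{|z|>1\})$ and $\mu_2=\int_{|z|\le1}z^2\,\nu(dz)$. $H^l$ is the Sobolev space of functions in $L_2(\mathbb R)$ with distributional derivatives up to order $l$ in $L_2(\mathbb R)$, with $\|g\|_{H^l}^2=\sum_{j=0}^l\|\partial_x^jg\|_{L_2}^2$; $(\cdot,\cdot)$ is the $L_2(\mathbb R)$ inner product. Let $a,b,c:[0,T]\times\mathbb R\to\mathbb R$ be measurable, such that $a,b,c$ together with their spatial derivatives up to order $m$ are continuous in $x$ and bounded in magnitude by $K$, uniformly in $t\in[0,T]$, and $a\ge 0$. Let $\psi\in H^m$ and let $f:[0,T]\to H^m$ be measurable with $$\mathcal K_m^2:=\|\psi\|_{H^m}^2+\int_0^T\|f_t\|_{H^m}^2\,dt<\infty .$$ **The equation.** Let $u$ be the solution of $du_t=[(L_t+J)u_t+f_t]\,dt$, $u_0=\psi$,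 where $L_t\phi=a_t\partial_x^2\phi+b_t\partial_x\phi+c_t\phi$ and $J\phi(x)=\int_{\mathbb R}(\phi(x+z)-\phi(x)-I_{|z|\le1}z\,\partial_x\phi(x))\,\nu(dz)$. That is, $(u_t)_{t\in[0,T]}$ is an $H^1$-valued weakly continuous function such that for all $\phi\in C_c^\infty(\mathbb R)$ and $t\in[0,T]$ $$\begin{aligned}(u_t,\phi)={}&(\psi,\phi)+\int_0^t\Big[(\partial_xu_s,-\phi\,\partial_xa_s-a_s\partial_x\phi+b_s\phi)+(c_su_s,\phi)+(f_s,\phi)\Big]ds\\&-\int_0^t\int_{|z|\le1}\int_0^1(1-\theta)z^2(\partial_xu_s(\cdot+\theta z),\partial_x\phi)\,d\theta\,\nu(dz)\,ds+\int_0^t\int_{|z|>1}(u_s(\cdot+z)-u_s,\phi)\,\nu(dz)\,ds.\end{aligned}$$ **The spatial discretization.** For $h\in\mathfrak N:=\{1/n:n\in\mathbb N,\ n\ge1\}$ and $\lambda\ne0$ let $\delta_\lambda\phi(x)=(\phi(x+\lambda)-\phi(x))/\lambda$, $\delta^\lambda=\tfrac12(\delta_\lambda+\delta_{-\lambda})$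 and $L^h_t\phi=a_t\delta^h\delta^h\phi+b_t\delta^h\phi+c_t\phi$. Let $B^h_k=((k-1)h,kh]$ for integers $k\ge1$ and $B^h_k=[kh,(k+1)h)$ for integers $k\le-1$, let $\mathbb A_h=\{k\in\mathbb Z:k\ne0,\ |k|\le1/h\}$, $\mathbb B_h=\mathbb Z\setminus(\mathbb A_h\cup\{0\})$, and $J^h=J^h_1+J^h_2$ with $$J_1^h\phi(x)=\sum_{k\in\mathbb A_h}\zeta^h_k\sum_{l=0}^{|k|-1}\theta_k^l\,\delta_{-h}\delta_h\phi(x+s_klh),\qquad J_2^h\phi(x)=\sum_{k\in\mathbb B_h}(\phi(x+hk)-\phi(x))\,\nu(B^h_k),$$ where $s_k=k/|k|$, $\zeta^h_k=\int_{B^h_k}z^2\,\nu(dz)$, $\theta_k^l=\int_{l/|k|}^{(l+1)/|k|}(1-\theta)\,d\theta$. Let $u^h$ be the solution in $L_2(\mathbb R)$ of the semi-discrete equation, i.e. the continuous function $u^h:[0,T]\to L_2(\mathbb R)$ with $$u^h_t=\psi+\int_0^t\big[(L^h_s+J^h)u^h_s+f_s\big]\,ds\quad\text{in }L_2(\mathbb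 R),\qquad t\in[0,T].$$ **Theorem.** There is a constant $N$, depending only on $m$, $T$, $K$, $\mu_0$ and $\mu_2$, such that for every $h\in\mathfrak N$ one has $u_t-u^h_t\in H^{m-3}$ for all $t\in[0,T]$ and $$\sup_{t\le T}\|u_t-u^h_t\|_{H^{m-3}}^2\le N\,\mathcal K_m^2\,h .$$ -/

import Mathlib

open MeasureTheory Set
open scoped ContDiff NNReal ENNReal

namespace LevyPIDE

noncomputable section

/-! ### The spaces `L₂(ℝ)` and `H^l` -/

/-- The real Hilbert space `L₂(ℝ)`. -/
abbrev L2 : Type := Lp ℝ 2 (volume : Measure ℝ)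

/-- `φ ∈ C_c^∞`. -/
def IsTest (φ : ℝ → ℝ) : Prop := ContDiff ℝ ∞ φ ∧ HasCompactSupport φ

/-- `v` is the `j`-th distributional derivative of `u`. -/
def IsWeakDeriv (j : ℕ) (u v : L2) : Prop :=
  ∀ φ : ℝ → ℝ, IsTest φ →
    ∫ x, u x * iteratedDeriv j φ x = (-1) ^ j * ∫ x, v x * φ x

theorem IsTest.memLp_iteratedDeriv {φ : ℝ → ℝ} (hφ : IsTest φ) (j : ℕ) :
    MemLp (iteratedDeriv j φ) 2 (volume : Measure ℝ) := by
  have hc : Continuous (iteratedDeriv j φ) :=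
    hφ.1.continuous_iteratedDeriv j (by exact_mod_cast le_top)
  have hs : HasCompactSupport (iteratedDeriv j φ) := by
    induction j with
    | zero => simpa using hφ.2
    | succ j ih =>
      rw [iteratedDeriv_succ]
      exact (ih (hφ.1.continuous_iteratedDeriv j (by exact_mod_cast le_top))).deriv
  exact hc.memLp_of_hasCompactSupport hs

theorem IsTest.integrable_mul {φ : ℝ → ℝ} (hφ : IsTest φ) (j : ℕ) (u : L2) :
    Integrable (fun x => u x * iteratedDeriv j φ x) :=
  (Lp.memLp u).integrable_mul (hφ.memLp_iteratedDeriv j)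

theorem IsTest.integral_add {φ : ℝ → ℝ} (hφ : IsTest φ) (j : ℕ) (u v : L2) :
    ∫ x, (u + v : L2) x * iteratedDeriv j φ x =
      (∫ x, u x * iteratedDeriv j φ x) + ∫ x, v x * iteratedDeriv j φ x := by
  rw [← MeasureTheory.integral_add (hφ.integrable_mul j u) (hφ.integrable_mul j v)]
  refine integral_congr_ae ?_
  filter_upwards [Lp.coeFn_add u v] with x hx
  rw [hx, Pi.add_apply, add_mul]

theorem IsTest.integral_smul {φ : ℝ → ℝ} (j : ℕ) (r : ℝ) (u : L2) :
    ∫ x, (r • u : L2) x * iteratedDeriv j φ x = r * ∫ x, u x * iteratedDeriv j φ x := by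
  rw [← integral_const_mul]
  refine integral_congr_ae ?_
  filter_upwards [Lp.coeFn_smul r u] with x hx
  rw [hx, Pi.smul_apply, smul_eq_mul, mul_assoc]

theorem IsWeakDeriv.add {j : ℕ} {u v u' v' : L2} (h : IsWeakDeriv j u v)
    (h' : IsWeakDeriv j u' v') : IsWeakDeriv j (u + u') (v + v') := by
  intro φ hφ
  have e := hφ.integral_add 0 v v'
  simp only [iteratedDeriv_zero] at e
  rw [hφ.integral_add, h φ hφ, h' φ hφ, e, mul_add]

theorem IsWeakDeriv.smul {j : ℕ} {u v : L2} (r : ℝ) (h : IsWeakDeriv j u v) :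
    IsWeakDeriv j (r • u) (r • v) := by
  intro φ hφ
  have e := IsTest.integral_smul (φ := φ) 0 r v
  simp only [iteratedDeriv_zero] at e
  rw [IsTest.integral_smul, h φ hφ, e, mul_left_comm]

/-- The Sobolev space `H^l`. An element is a function `u ∈ L₂(ℝ)` listed together with its
distributional derivatives `(u, D u, …, D^l u)`, all in `L₂(ℝ)` (these are determined by `u`).
The norm inherited from the Hilbert sum of `l + 1` copies of `L₂(ℝ)` is the one of
`(f, g)_l = ∑_{j ≤ l} (D^j f, D^j g)`. -/
def SobolevH (l : ℕ) : Submodule ℝ (PiLp 2 (fun _ : Fin (l + 1) => L2)) where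
  carrier := {w | ∀ j : Fin (l + 1), IsWeakDeriv j (w 0) (w j)}
  add_mem' := fun h h' j => (h j).add (h' j)
  zero_mem' := by
    intro j φ _
    simp
  smul_mem' := fun r _ h j => (h j).smul r

/-- `H^l` carries its Borel `σ`-algebra. -/
instance (l : ℕ) : MeasurableSpace (SobolevH l) := borel _

instance (l : ℕ) : BorelSpace (SobolevH l) := ⟨rfl⟩

/-- The element of `L₂(ℝ)` underlying `u ∈ H^l`. -/
def toL2 {l : ℕ} (u : SobolevH l) : L2 := u.1 0

/-- The first distributional derivative of `u ∈ H^1`. -/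
def dx (u : SobolevH 1) : L2 := u.1 1

/-! ### The data -/

/-- `ν` is a Lévy measure on `ℝ`. -/
def IsLevyMeasure (ν : Measure ℝ) : Prop :=
  ν {0} = 0 ∧ (∫⁻ z, ENNReal.ofReal (min 1 (z ^ 2)) ∂ν) < ⊤

/-- `g : [0,T] × ℝ → ℝ` is measurable, and its spatial derivatives up to order `r` exist, are
continuous in `x`, and are bounded in magnitude by `K`, uniformly in `t ∈ [0,T]`. -/
def RegularCoeff (T K : ℝ) (r : ℕ) (g : ℝ → ℝ → ℝ) : Prop :=
  Measurable (fun p : Icc (0 : ℝ) T × ℝ => g p.1 p.2) ∧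
  ∀ t ∈ Icc (0 : ℝ) T, ContDiff ℝ r (g t) ∧
    ∀ j ≤ r, ∀ x, |iteratedDeriv j (g t) x| ≤ K

/-- `f : [0,T] → H^m` is measurable and `∫_0^T ‖f_t‖²_{H^m} dt < ∞`. -/
def FreeTerm (T : ℝ) {m : ℕ} (f : ℝ → SobolevH m) : Prop :=
  Measurable (fun t : Icc (0 : ℝ) T => f t) ∧
  IntegrableOn (fun t => ‖f t‖ ^ 2) (Icc 0 T)

/-- `𝒦_m² = ‖ψ‖²_{H^m} + ∫_0^T ‖f_t‖²_{H^m} dt`. -/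
def dataNormSq (T : ℝ) {m : ℕ} (ψ : SobolevH m) (f : ℝ → SobolevH m) : ℝ :=
  ‖ψ‖ ^ 2 + ∫ t in (0 : ℝ)..T, ‖f t‖ ^ 2

/-! ### The integro-differential equation -/

/-- `(u_t)_{t ∈ [0,T]}` is an `H^1`-valued weakly continuous solution of
`du_t = [(L_t + J) u_t + f_t] dt`, `u_0 = ψ`. -/
def IsSolution (T : ℝ) (ν : Measure ℝ) (a b c : ℝ → ℝ → ℝ) {m : ℕ}
    (ψ : SobolevH m) (f : ℝ → SobolevH m) (u : ℝ → SobolevH 1) : Prop :=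
  (∀ v : SobolevH 1, ContinuousOn (fun t => inner ℝ (u t) v) (Icc 0 T)) ∧
  ∀ φ : ℝ → ℝ, IsTest φ → ∀ t ∈ Icc (0 : ℝ) T,
    ∫ x, toL2 (u t) x * φ x =
      (∫ x, toL2 ψ x * φ x)
      + (∫ s in (0 : ℝ)..t,
          ((∫ x, dx (u s) x * (-(φ x * deriv (a s) x) - a s x * deriv φ x + b s x * φ x))
            + ∫ x, c s x * toL2 (u s) x * φ x))
      - (∫ s in (0 : ℝ)..t, ∫ z in {z : ℝ | |z| ≤ 1},
          (∫ θ in (0 : ℝ)..1, (1 - θ) * z ^ 2 * (∫ x, dx (u s) (x + θ * z) * deriv φ x)) ∂ν)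
      + (∫ s in (0 : ℝ)..t, ∫ z in {z : ℝ | 1 < |z|},
          (∫ x, (toL2 (u s) (x + z) - toL2 (u s) x) * φ x) ∂ν)
      + ∫ s in (0 : ℝ)..t, ∫ x, toL2 (f s) x * φ x

/-! ### The finite difference operators on `L₂(ℝ)` -/

/-- The translation `u ↦ u(· + y)`. -/
def shift (y : ℝ) (u : L2) : L2 :=
  Lp.compMeasurePreserving (fun x => x + y) (measurePreserving_add_right volume y) u

/-- `δ_λ u = (u(· + λ) - u) / λ`. -/
def diffQ (lam : ℝ) (u : L2) : L2 := lam⁻¹ • (shift lam u - u)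

/-- `δ^λ u = (δ_λ u + δ_{-λ} u) / 2`. -/
def symDiffQ (lam : ℝ) (u : L2) : L2 := (2 : ℝ)⁻¹ • (diffQ lam u + diffQ (-lam) u)

open Classical in
/-- The product `g u` of a function `g` and `u ∈ L₂(ℝ)`. It always lies in `L₂(ℝ)` when `g` is
measurable and bounded, the only case of interest; otherwise the value may be `0` by convention. -/
def mulL2 (g : ℝ → ℝ) (u : L2) : L2 :=
  if h : MemLp (fun x => g x * u x) 2 (volume : Measure ℝ) then h.toLp _ else 0

/-- `L^h_t u = a_t δ^h δ^h u + b_t δ^h u + c_t u`; here `a`, `b`, `c` are the coefficients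
at a fixed time. -/
def opLh (h : ℝ) (a b c : ℝ → ℝ) (u : L2) : L2 :=
  mulL2 a (symDiffQ h (symDiffQ h u)) + mulL2 b (symDiffQ h u) + mulL2 c u

/-- The cell `B^h_k`: `((k-1)h, kh]` for `k ≥ 1` and `[kh, (k+1)h)` for `k ≤ -1`
(unused for `k = 0`). -/
def cell (h : ℝ) (k : ℤ) : Set ℝ :=
  if 0 < k then Ioc ((k - 1) * h) (k * h)
  else if k < 0 then Ico (k * h) ((k + 1) * h)
  else ∅

/-- `𝔸_h = {k ∈ ℤ : |k| ≤ 1/h, k ≠ 0}`. -/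
def indexA (h : ℝ) : Finset ℤ := (Finset.Icc (-⌊1 / h⌋) ⌊1 / h⌋).erase 0

theorem mem_indexA (h : ℝ) (k : ℤ) : k ∈ indexA h ↔ |(k : ℝ)| ≤ 1 / h ∧ k ≠ 0 := by
  rw [indexA, Finset.mem_erase, Finset.mem_Icc, ← abs_le, Int.le_floor, Int.cast_abs, and_comm]

/-- `𝔹_h = ℤ \ (𝔸_h ∪ {0})`. -/
def indexB (h : ℝ) : Set ℤ := {k | k ∉ indexA h ∧ k ≠ 0}

/-- `ζ^h_k = ∫_{B^h_k} z² ν(dz)`. -/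
def zeta (ν : Measure ℝ) (h : ℝ) (k : ℤ) : ℝ := ∫ z in cell h k, z ^ 2 ∂ν

/-- `θ_k^l = ∫_{l/|k|}^{(l+1)/|k|} (1 - θ) dθ`. -/
def theta (k : ℤ) (l : ℕ) : ℝ :=
  ∫ θ in ((l : ℝ) / |(k : ℝ)|)..(((l : ℝ) + 1) / |(k : ℝ)|), (1 - θ)

/-- `J_1^h u = ∑_{k ∈ 𝔸_h} ζ^h_k ∑_{l=0}^{|k|-1} θ_k^l δ_{-h} δ_h u(· + s_k l h)`, where
`s_k = k / |k|`. -/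
def opJ1h (ν : Measure ℝ) (h : ℝ) (u : L2) : L2 :=
  ∑ k ∈ indexA h, zeta ν h k • ∑ l ∈ Finset.range k.natAbs,
    theta k l • shift ((k / |(k : ℝ)|) * l * h) (diffQ (-h) (diffQ h u))

/-- `J_2^h u = ∑_{k ∈ 𝔹_h} (u(· + hk) - u) ν(B^h_k)`; the series converges absolutely in
`L₂(ℝ)` because `∑_{k ∈ 𝔹_h} ν(B^h_k) = ν(ℝ \ [-1,1]) < ∞` for a Lévy measure and `h = 1/n`. -/
def opJ2h (ν : Measure ℝ) (h : ℝ) (u : L2) : L2 :=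
  ∑' k : indexB h, ν.real (cell h k) • (shift (h * ((k : ℤ) : ℝ)) u - u)

/-- `J^h = J_1^h + J_2^h`. -/
def opJh (ν : Measure ℝ) (h : ℝ) (u : L2) : L2 := opJ1h ν h u + opJ2h ν h u

/-- `(u^h_t)_{t ∈ [0,T]}` is a continuous `L₂(ℝ)`-valued solution of
`du^h_t = [(L^h_t + J^h) u^h_t + f_t] dt`, `u^h_0 = ψ` (Bochner integral in `L₂(ℝ)`). -/
def IsSemidiscreteSolution (T : ℝ) (ν : Measure ℝ) (a b c : ℝ → ℝ → ℝ) {m : ℕ}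
    (ψ : SobolevH m) (f : ℝ → SobolevH m) (h : ℝ) (uh : ℝ → L2) : Prop :=
  ContinuousOn uh (Icc 0 T) ∧
  ∀ t ∈ Icc (0 : ℝ) T,
    uh t = toL2 ψ + ∫ s in (0 : ℝ)..t,
      (opLh h (a s) (b s) (c s) (uh s) + opJh ν h (uh s) + toL2 (f s))

end

end LevyPIDE

/-! The argument compares semi-discrete solutions on different meshes with each other and identifies
their limit with `u` only in `L₂`; no regularity of `u` beyond `H^1` is needed.

Stability. All derivatives of a scheme solution up to order `l ≤ m` are estimated together
(`inner_schemeOp_le`, `energy_bound`), with constants independent of the mesh although `a` may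
degenerate. In the leading term the sign of `a` replaces ellipticity (`inner_mulL2_lap_le`). The
Leibniz term carrying exactly one derivative of `a` seems to lose a derivative, but self-adjointness
of the second difference turns it into a commutator (`inner_mulL2_lap_deriv_le`). The operator `J^h`
is dissipative (`inner_opJh_nonpos`): the weights `θ_k^l` are linear in `l`, so summation by parts
leaves nonnegative multiples of translates minus the matching multiple of the identity, and
translations are isometries.

Consistency. On functions with three extra derivatives, the scheme differs from `L + J` by `O(h)`
(`norm_schemeOp_sub_limitOp_le`). For the jumps this holds because every node of the discretization
is within `h` of the true jump.

Rate. For a fixed mesh all operators are bounded, so the scheme is solvable in `H^m` by Picard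
iteration (`exists_scheme_solution`), and stability bounds the solution uniformly in the mesh. The
difference of the solutions for meshes `h` and `h'` solves the scheme for `h'` with a free term of
size `O(h + h')` in `H^{m-3}`, hence is itself `O(h + h')` there
(`IsSchemeSolution.sum_norm_sub_sq_le`). Thus the solutions are Cauchy in `H^{m-3}`, and `h' → 0`
bounds the distance from the `h`-solution to the limit. The squared error is in fact `O(h²)`, which
is at most `O(h)` since `h ≤ 1`.

Identification. `L₂` stability shows that `u^h` is the bottom component of the `H^m`-valued scheme
solution (`IsSchemeSolution.eq_comp_zero`). To see that the limit is `u`, an energy estimate is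
applied to `u` minus a scheme solution; since `u` satisfies only a weak equation, the energy
identity is obtained for Steklov averages and passed to the limit (`weak_energy_identity`,
`inner_weak_le`).

Throughout, derivatives are strong derivatives along the translation group (`HasD`). They agree with
distributional ones and commute with every bounded translation invariant operator, so difference and
jump operators can be differentiated freely. -/

namespace LevyPIDE

open Filter Topology

noncomputable section

/-! ### Translations of `L₂(ℝ)` -/

/-- The translation as a linear isometry. -/
def shiftL (y : ℝ) : L2 →ₗᵢ[ℝ] L2 :=
  Lp.compMeasurePreservingₗᵢ ℝ (fun x => x + y) (measurePreserving_add_right volume y)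

theorem shiftL_apply (y : ℝ) (u : L2) : shiftL y u = shift y u := rfl

@[simp] theorem norm_shift (y : ℝ) (u : L2) : ‖shift y u‖ = ‖u‖ := (shiftL y).norm_map u

theorem shift_add (y : ℝ) (u v : L2) : shift y (u + v) = shift y u + shift y v :=
  (shiftL y).map_add u v

theorem shift_sub (y : ℝ) (u v : L2) : shift y (u - v) = shift y u - shift y v :=
  (shiftL y).map_sub u v

theorem shift_smul (y r : ℝ) (u : L2) : shift y (r • u) = r • shift y u :=
  (shiftL y).map_smul r u

theorem coeFn_shift (y : ℝ) (u : L2) : shift y u =ᵐ[volume] fun x => u (x + y) :=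
  Lp.coeFn_compMeasurePreserving u _

theorem shift_shift (y z : ℝ) (u : L2) : shift y (shift z u) = shift (y + z) u := by
  apply Lp.ext
  have h1 := (measurePreserving_add_right (volume : Measure ℝ) y).quasiMeasurePreserving.ae_eq_comp
    (coeFn_shift z u)
  filter_upwards [coeFn_shift y (shift z u), coeFn_shift (y + z) u, h1] with x h2 h3 h4
  rw [h2, h3]
  simp only [Function.comp] at h4
  rw [h4, add_assoc]

@[simp] theorem shift_zero (u : L2) : shift 0 u = u := by
  apply Lp.ext
  filter_upwards [coeFn_shift 0 u] with x hx
  rw [hx, add_zero]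

theorem inner_eq_integral (u v : L2) : inner ℝ u v = ∫ x, u x * v x := by
  rw [L2.inner_def]
  refine integral_congr_ae (ae_of_all _ fun x => ?_)
  simp [mul_comm]

theorem inner_shift_shift (y : ℝ) (u v : L2) : inner ℝ (shift y u) (shift y v) = inner ℝ u v :=
  (shiftL y).inner_map_map u v

theorem inner_shift_left (y : ℝ) (u v : L2) :
    inner ℝ (shift y u) v = inner ℝ u (shift (-y) v) := by
  conv_lhs => rw [← shift_zero v, ← add_neg_cancel y, ← shift_shift, inner_shift_shift]

theorem inner_shift_right (y : ℝ) (u v : L2) :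
    inner ℝ u (shift y v) = inner ℝ (shift (-y) u) v := by
  rw [inner_shift_left, neg_neg]

/-- Joint continuity allows the translation and its argument to converge together, as happens in the
product rule `HasD.mulL2`. -/
theorem continuous_shift_prod : Continuous fun p : ℝ × L2 => shift p.1 p.2 := by
  let g : ℝ × L2 → C(ℝ, ℝ) := fun p => ⟨fun x => x + p.1, by fun_prop⟩
  have hg : Continuous g := ContinuousMap.continuous_of_continuous_uncurry _ (by
    simp only [Function.uncurry_def, g, ContinuousMap.coe_mk]; fun_prop)
  exact Continuous.compMeasurePreservingLp continuous_snd hg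
    (fun p => measurePreserving_add_right volume p.1) (by simp)

theorem continuous_shift (u : L2) : Continuous fun y => shift y u :=
  continuous_shift_prod.comp (by fun_prop : Continuous fun y : ℝ => (y, u))

/-! ### Test functions -/

/-- A test function as an element of `L₂(ℝ)`. -/
def testLp {φ : ℝ → ℝ} (hφ : IsTest φ) : L2 :=
  MemLp.toLp φ (by simpa using hφ.memLp_iteratedDeriv 0)

theorem coeFn_testLp {φ : ℝ → ℝ} (hφ : IsTest φ) : testLp hφ =ᵐ[volume] φ :=
  MemLp.coeFn_toLp _

theorem inner_testLp {φ : ℝ → ℝ} (hφ : IsTest φ) (u : L2) :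
    inner ℝ u (testLp hφ) = ∫ x, u x * φ x := by
  rw [inner_eq_integral]
  refine integral_congr_ae ?_
  filter_upwards [coeFn_testLp hφ] with x hx
  rw [hx]

theorem IsTest.deriv {φ : ℝ → ℝ} (hφ : IsTest φ) : IsTest (deriv φ) :=
  ⟨(contDiff_infty_iff_deriv.1 hφ.1).2, hφ.2.deriv⟩

theorem IsTest.iteratedDeriv {φ : ℝ → ℝ} (hφ : IsTest φ) (j : ℕ) : IsTest (iteratedDeriv j φ) := by
  induction j with
  | zero => simpa using hφ
  | succ j ih => rw [iteratedDeriv_succ]; exact ih.deriv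

theorem IsTest.comp_add {φ : ℝ → ℝ} (hφ : IsTest φ) (y : ℝ) : IsTest (fun x => φ (x + y)) :=
  ⟨hφ.1.comp (contDiff_id.add contDiff_const),
    hφ.2.comp_homeomorph (Homeomorph.addRight y)⟩

theorem testLp_comp_add {φ : ℝ → ℝ} (hφ : IsTest φ) (y : ℝ) :
    testLp (hφ.comp_add y) = shift y (testLp hφ) := by
  apply Lp.ext
  have h1 := (measurePreserving_add_right (volume : Measure ℝ) y).quasiMeasurePreserving.ae_eq_comp
    (coeFn_testLp hφ)
  filter_upwards [coeFn_testLp (hφ.comp_add y), coeFn_shift y (testLp hφ), h1] with x h2 h3 h4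
  rw [h2, h3]
  exact h4.symm

theorem eq_zero_of_forall_test {u : L2} (h : ∀ φ (hφ : IsTest φ), inner ℝ u (testLp hφ) = 0) :
    u = 0 := by
  have hu : (u : ℝ → ℝ) =ᵐ[volume] 0 := by
    refine ae_eq_zero_of_integral_contDiff_smul_eq_zero
      ((Lp.memLp u).locallyIntegrable (by norm_num)) ?_
    intro φ h1 h2
    have hφ : IsTest φ := ⟨h1, h2⟩
    have := h φ hφ
    rw [inner_testLp] at this
    simpa [mul_comm] using this
  exact (Lp.eq_zero_iff_ae_eq_zero).2 hu

theorem eq_of_forall_test {u v : L2}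
    (h : ∀ φ (hφ : IsTest φ), inner ℝ u (testLp hφ) = inner ℝ v (testLp hφ)) : u = v := by
  rw [← sub_eq_zero]
  refine eq_zero_of_forall_test fun φ hφ => ?_
  rw [inner_sub_left, h φ hφ, sub_self]

/-- The antiderivative-difference `x ↦ ∫_0^y φ(x - s) ds`. -/
def steklovTest (y : ℝ) (φ : ℝ → ℝ) (x : ℝ) : ℝ := ∫ s in (0 : ℝ)..y, φ (x - s)

theorem steklovTest_eq (y : ℝ) (φ : ℝ → ℝ) (x : ℝ) :
    steklovTest y φ x = ∫ s in (x - y)..x, φ s := by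
  rw [steklovTest, intervalIntegral.integral_comp_sub_left (fun s => φ s), sub_zero]

theorem hasDerivAt_steklovTest (y : ℝ) {φ : ℝ → ℝ} (hφ : Continuous φ) (x : ℝ) :
    HasDerivAt (steklovTest y φ) (φ x - φ (x - y)) x := by
  have e : steklovTest y φ = fun x => (∫ s in (0 : ℝ)..x, φ s) - ∫ s in (0 : ℝ)..(x - y), φ s := by
    funext x
    rw [steklovTest_eq, intervalIntegral.integral_interval_sub_left
      (hφ.intervalIntegrable _ _) (hφ.intervalIntegrable _ _)]
  have h1 : ∀ x, HasDerivAt (fun x => ∫ s in (0 : ℝ)..x, φ s) (φ x) x := fun x =>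
    (hφ.integral_hasStrictDerivAt 0 x).hasDerivAt
  rw [e]
  refine (h1 x).sub ?_
  exact (h1 (x - y)).comp_sub_const x y

theorem deriv_steklovTest (y : ℝ) {φ : ℝ → ℝ} (hφ : Continuous φ) :
    deriv (steklovTest y φ) = fun x => φ x - φ (x - y) :=
  funext fun x => (hasDerivAt_steklovTest y hφ x).deriv

/-- The derivative of this function is an increment of `φ`, so testing a distributional derivative
against it produces an identity for translation increments. -/
theorem IsTest.steklovTest {φ : ℝ → ℝ} (hφ : IsTest φ) (y : ℝ) : IsTest (steklovTest y φ) := by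
  have hc := hφ.1.continuous
  refine ⟨contDiff_infty_iff_deriv.2
    ⟨fun x => (hasDerivAt_steklovTest y hc x).differentiableAt, ?_⟩, ?_⟩
  · rw [deriv_steklovTest y hc]
    exact hφ.1.sub (hφ.1.comp (contDiff_id.sub contDiff_const))
  · obtain ⟨R, hR⟩ := hφ.2.isCompact.isBounded.subset_closedBall 0
    refine HasCompactSupport.intro (isCompact_closedBall (0 : ℝ) (R + |y|)) fun x hx => ?_
    have hz : ∀ s ∈ uIcc 0 y, φ (x - s) = 0 := by
      intro s hs
      by_contra h
      have h1 := hR (subset_tsupport φ h)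
      rw [mem_closedBall_zero_iff, Real.norm_eq_abs] at h1 hx
      have h2 : |s| ≤ |y| := by
        simpa using abs_sub_left_of_mem_uIcc hs
      have : |x| ≤ |x - s| + |s| := by simpa using abs_add_le (x - s) s
      linarith
    rw [LevyPIDE.steklovTest, intervalIntegral.integral_congr (g := fun _ => 0) hz]
    simp

theorem inner_steklovTest {φ : ℝ → ℝ} (hφ : IsTest φ) (y : ℝ) (v : L2) :
    inner ℝ v (testLp (hφ.steklovTest y)) =
      ∫ s in (0 : ℝ)..y, inner ℝ (shift s v) (testLp hφ) := by
  refine Eq.trans (b := inner ℝ v (∫ s in (0 : ℝ)..y, shift (-s) (testLp hφ))) ?_ ?_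
  -- The pointwise average is identified with the Bochner integral of translates by pairing both
  -- with an arbitrary `χ` and applying Fubini.
  · congr 1
    refine eq_of_forall_test fun χ hχ => ?_
    have hi : IntervalIntegrable (fun s => shift (-s) (testLp hφ)) volume 0 y :=
      ((continuous_shift _).comp continuous_neg).intervalIntegrable _ _
    have e1 : inner ℝ (∫ s in (0 : ℝ)..y, shift (-s) (testLp hφ)) (testLp hχ) =
        ∫ s in (0 : ℝ)..y, inner ℝ (testLp hχ) (shift (-s) (testLp hφ)) := by
      rw [real_inner_comm]
      exact ((innerSL ℝ (testLp hχ)).intervalIntegral_comp_comm hi).symm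
    have e2 : ∀ s, inner ℝ (testLp hχ) (shift (-s) (testLp hφ)) = ∫ x, χ x * φ (x - s) := by
      intro s
      rw [← testLp_comp_add, inner_testLp]
      refine integral_congr_ae ?_
      filter_upwards [coeFn_testLp hχ] with x hx
      rw [hx, sub_eq_add_neg]
    have e3 : inner ℝ (testLp (hφ.steklovTest y)) (testLp hχ) =
        ∫ x, ∫ s in (0 : ℝ)..y, χ x * φ (x - s) := by
      rw [real_inner_comm, inner_testLp]
      refine integral_congr_ae ?_
      filter_upwards [coeFn_testLp hχ] with x hx
      rw [hx, LevyPIDE.steklovTest, intervalIntegral.integral_const_mul]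
    rw [e3, e1]
    simp_rw [e2]
    refine (intervalIntegral_integral_swap ?_).symm
    obtain ⟨C, hC⟩ := hφ.2.exists_bound_of_continuous hφ.1.continuous
    have hχi : Integrable χ := hχ.1.continuous.integrable_of_hasCompactSupport hχ.2
    have hcst : IntegrableOn (fun _ : ℝ => C) (uIoc 0 y) :=
      integrableOn_const (by simp)
    refine Integrable.mono ((hcst.integrable).mul_prod hχi) ?_ ?_
    · refine Continuous.aestronglyMeasurable ?_
      exact (hχ.1.continuous.comp continuous_snd).mul
        (hφ.1.continuous.comp (continuous_snd.sub continuous_fst))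
    · refine ae_of_all _ fun p => ?_
      simp only [Function.uncurry, norm_mul]
      rw [mul_comm]
      exact mul_le_mul_of_nonneg_right ((hC _).trans (le_abs_self _)) (norm_nonneg _)
  · have hi : IntervalIntegrable (fun s => shift (-s) (testLp hφ)) volume 0 y :=
      ((continuous_shift _).comp continuous_neg).intervalIntegrable _ _
    refine ((innerSL ℝ v).intervalIntegral_comp_comm hi).symm.trans ?_
    refine intervalIntegral.integral_congr fun s _ => ?_
    simp only [innerSL_apply_apply, inner_shift_left]

/-! ### The generator of the translation group -/

/-- `v` is the strong derivative of `u` in `L₂(ℝ)`. -/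
def HasD (u v : L2) : Prop := HasDerivAt (fun y => shift y u) v 0

/-- The group law transports differentiability of the orbit from `0` to every point. -/
theorem HasD.hasDerivAt {u v : L2} (h : HasD u v) (y : ℝ) :
    HasDerivAt (fun y => shift y u) (shift y v) y := by
  have h0 : HasDerivAt (fun y => shift y u) v (y - y) := by rw [sub_self]; exact h
  have h1 : HasDerivAt (fun z => shift (z - y) u) v y := by
    exact h0.comp_sub_const y y
  have h2 := (shiftL y).toContinuousLinearMap.hasFDerivAt.comp_hasDerivAt y h1
  refine h2.congr_of_eventuallyEq (Eventually.of_forall fun z => ?_)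
  simp [shiftL_apply, shift_shift]

theorem HasD.shift_sub_eq {u v : L2} (h : HasD u v) (y : ℝ) :
    shift y u - u = ∫ s in (0 : ℝ)..y, shift s v := by
  have := intervalIntegral.integral_eq_sub_of_hasDerivAt (a := 0) (b := y)
    (fun s _ => h.hasDerivAt s) ((continuous_shift v).intervalIntegrable _ _)
  rw [this, shift_zero]

theorem hasD_of_shift_sub_eq {u v : L2}
    (h : ∀ y, shift y u - u = ∫ s in (0 : ℝ)..y, shift s v) : HasD u v := by
  have h1 := ((continuous_shift v).integral_hasStrictDerivAt 0 0).hasDerivAt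
  have h2 := h1.add_const u
  rw [shift_zero] at h2
  refine h2.congr_of_eventuallyEq (Eventually.of_forall fun y => ?_)
  change shift y u = (∫ s in (0 : ℝ)..y, shift s v) + u
  rw [← h y, sub_add_cancel]

theorem HasD.tendsto {u v : L2} (h : HasD u v) :
    Tendsto (fun r => diffQ r u) (𝓝[≠] 0) (𝓝 v) := by
  have := hasDerivAt_iff_tendsto_slope_zero.1 h
  simpa [diffQ] using this

theorem hasD_of_tendsto {u v : L2} (h : Tendsto (fun r => diffQ r u) (𝓝[≠] 0) (𝓝 v)) :
    HasD u v := by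
  refine hasDerivAt_iff_tendsto_slope_zero.2 ?_
  simpa [diffQ] using h

theorem HasD.add {u v u' v' : L2} (h : HasD u v) (h' : HasD u' v') : HasD (u + u') (v + v') := by
  have := HasDerivAt.add h h'
  refine this.congr_of_eventuallyEq (Eventually.of_forall fun y => ?_)
  exact shift_add y u u'

/-- This is how derivatives pass through all difference and jump operators: `B` sends the orbit of
`u` to the orbit of `B u`. Multiplications do not commute with translations and need `HasD.mulL2`.
-/
theorem HasD.map {u v : L2} (h : HasD u v) (B : L2 →L[ℝ] L2)
    (hB : ∀ y w, B (shift y w) = shift y (B w)) : HasD (B u) (B v) := by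
  have := B.hasFDerivAt.comp_hasDerivAt 0 h
  refine this.congr_of_eventuallyEq (Eventually.of_forall fun y => ?_)
  exact (hB y u).symm

theorem HasD.smul {u v : L2} (r : ℝ) (h : HasD u v) : HasD (r • u) (r • v) :=
  h.map (r • ContinuousLinearMap.id ℝ L2) fun y w => (shift_smul y r w).symm

theorem hasD_zero : HasD 0 0 := by
  refine hasD_of_shift_sub_eq fun y => ?_
  have : ∀ s, shift s (0 : L2) = 0 := fun s => (shiftL s).map_zero
  simp [this]

theorem HasD.sub {u v u' v' : L2} (h : HasD u v) (h' : HasD u' v') : HasD (u - u') (v - v') := by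
  have := h.add (h'.smul (-1))
  simpa [sub_eq_add_neg] using this

theorem HasD.sum {ι : Type*} {s : Finset ι} {u v : ι → L2} (h : ∀ i ∈ s, HasD (u i) (v i)) :
    HasD (∑ i ∈ s, u i) (∑ i ∈ s, v i) := by
  classical
  induction s using Finset.induction_on with
  | empty => simpa using hasD_zero
  | insert i s hi ih =>
    rw [Finset.sum_insert hi, Finset.sum_insert hi]
    exact (h i (by simp)).add (ih fun j hj => h j (by simp [hj]))

theorem HasD.norm_shift_sub_le {u v : L2} (h : HasD u v) (y : ℝ) :
    ‖shift y u - u‖ ≤ |y| * ‖v‖ := by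
  rw [h.shift_sub_eq]
  have := intervalIntegral.norm_integral_le_of_norm_le_const (a := 0) (b := y) (C := ‖v‖)
    (f := fun s => shift s v) (fun s _ => (norm_shift s v).le)
  simpa [mul_comm] using this

theorem HasD.norm_diffQ_le {u v : L2} (h : HasD u v) (r : ℝ) : ‖diffQ r u‖ ≤ ‖v‖ := by
  rcases eq_or_ne r 0 with rfl | hr
  · simp [diffQ]
  · rw [diffQ, norm_smul, norm_inv, Real.norm_eq_abs, inv_mul_le_iff₀ (abs_pos.2 hr)]
    exact h.norm_shift_sub_le r

/-- The error is the mean of `shift s v - v` for `s` between `0` and `r`, and each such increment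
costs at most `|s| ‖w‖`. -/
theorem HasD.norm_diffQ_sub_le {u v w : L2} (h : HasD u v) (h' : HasD v w) {r : ℝ} (hr : r ≠ 0) :
    ‖diffQ r u - v‖ ≤ |r| * ‖w‖ := by
  have e : diffQ r u - v = r⁻¹ • ∫ s in (0 : ℝ)..r, (shift s v - v) := by
    rw [intervalIntegral.integral_sub ((continuous_shift v).intervalIntegrable _ _)
      intervalIntegrable_const, ← h.shift_sub_eq, intervalIntegral.integral_const, smul_sub,
      sub_zero, inv_smul_smul₀ hr, diffQ]
  rw [e, norm_smul, norm_inv, Real.norm_eq_abs, inv_mul_le_iff₀ (abs_pos.2 hr)]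
  have := intervalIntegral.norm_integral_le_of_norm_le_const (a := 0) (b := r) (C := |r| * ‖w‖)
    (f := fun s => shift s v - v) (fun s hs => by
      refine (h'.norm_shift_sub_le s).trans ?_
      have : |s| ≤ |r| := by
        simpa using abs_sub_left_of_mem_uIcc (uIoc_subset_uIcc hs)
      gcongr)
  simpa [mul_comm] using this

theorem inner_diffQ_left (r : ℝ) (u v : L2) :
    inner ℝ (diffQ r u) v = - inner ℝ u (diffQ (-r) v) := by
  simp only [diffQ, inner_smul_left, inner_smul_right, inner_sub_left, inner_sub_right,
    inner_shift_left, inv_neg]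
  simp

/-- Summation by parts for difference quotients, in the limit of vanishing step. -/
theorem HasD.inner_left {u u' v v' : L2} (hu : HasD u u') (hv : HasD v v') :
    inner ℝ u' v = - inner ℝ u v' := by
  have h1 : Tendsto (fun r => inner ℝ (diffQ r u) v) (𝓝[≠] 0) (𝓝 (inner ℝ u' v)) :=
    hu.tendsto.inner tendsto_const_nhds
  have hn : Tendsto (fun r : ℝ => -r) (𝓝[≠] 0) (𝓝[≠] 0) := by
    refine tendsto_nhdsWithin_iff.2 ⟨?_, ?_⟩
    · have : Tendsto (fun r : ℝ => -r) (𝓝 0) (𝓝 0) := by simpa using (continuous_neg.tendsto (0:ℝ))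
      exact this.mono_left nhdsWithin_le_nhds
    · filter_upwards [self_mem_nhdsWithin] with r hr
      simpa using hr
  have h2 : Tendsto (fun r => - inner ℝ u (diffQ (-r) v)) (𝓝[≠] 0) (𝓝 (- inner ℝ u v')) :=
    (Tendsto.inner tendsto_const_nhds (hv.tendsto.comp hn)).neg
  simp_rw [inner_diffQ_left] at h1
  exact tendsto_nhds_unique h1 h2

theorem diffQ_comm_shift (r y : ℝ) (u : L2) : diffQ r (shift y u) = shift y (diffQ r u) := by
  simp only [diffQ, shift_smul, shift_sub, shift_shift, add_comm]

/-! ### Strong derivatives and distributional derivatives coincide -/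

theorem IsWeakDeriv.hasD {u v : L2} (h : IsWeakDeriv 1 u v) : HasD u v := by
  refine hasD_of_shift_sub_eq fun y => eq_of_forall_test fun φ hφ => ?_
  have hc := hφ.1.continuous
  -- With this test function the left side becomes the pairing of `u` with `φ - φ(· - y)`, and the
  -- right side the integral of translates of `v` paired with `φ`.
  have h1 := h _ (hφ.steklovTest y)
  rw [iteratedDeriv_one, deriv_steklovTest y hc, pow_one, ← inner_testLp (hφ.steklovTest y),
    inner_steklovTest hφ] at h1
  have hi : IntervalIntegrable (fun s => shift s v) volume 0 y :=
    (continuous_shift v).intervalIntegrable _ _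
  have e1 : inner ℝ (∫ s in (0 : ℝ)..y, shift s v) (testLp hφ) =
      ∫ s in (0 : ℝ)..y, inner ℝ (shift s v) (testLp hφ) := by
    rw [real_inner_comm]
    refine ((innerSL ℝ (testLp hφ)).intervalIntegral_comp_comm hi).symm.trans ?_
    simp only [innerSL_apply_apply, real_inner_comm]
  have e2 : inner ℝ (shift y u - u) (testLp hφ) = - ∫ x, u x * (φ x - φ (x - y)) := by
    rw [inner_sub_left, inner_shift_left, ← testLp_comp_add, inner_testLp, inner_testLp,
      ← integral_sub, ← integral_neg]
    · refine integral_congr_ae (ae_of_all _ fun x => ?_)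
      simp only [← sub_eq_add_neg]
      ring
    · simpa using (hφ.comp_add (-y)).integrable_mul 0 u
    · simpa using hφ.integrable_mul 0 u
  rw [e1, e2, h1]
  ring

theorem hasD_testLp {φ : ℝ → ℝ} (hφ : IsTest φ) : HasD (testLp hφ) (testLp hφ.deriv) := by
  refine IsWeakDeriv.hasD fun χ hχ => ?_
  have e1 : ∫ x, testLp hφ x * iteratedDeriv 1 χ x = ∫ x, φ x * deriv χ x := by
    refine integral_congr_ae ?_
    filter_upwards [coeFn_testLp hφ] with x hx
    rw [hx, iteratedDeriv_one]
  have e2 : ∫ x, testLp hφ.deriv x * χ x = ∫ x, deriv φ x * χ x := by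
    refine integral_congr_ae ?_
    filter_upwards [coeFn_testLp hφ.deriv] with x hx
    rw [hx]
  have hd : ∀ {φ : ℝ → ℝ}, IsTest φ → ∀ x, HasDerivAt φ (deriv φ x) x := fun h x =>
    ((h.1.differentiable (by simp)) x).hasDerivAt
  have hint : ∀ {φ χ : ℝ → ℝ}, Continuous φ → Continuous χ → HasCompactSupport φ →
      Integrable (φ * χ) := fun h1 h2 h3 =>
    (h1.mul h2).integrable_of_hasCompactSupport h3.mul_right
  rw [e1, e2, integral_mul_deriv_eq_deriv_mul_of_integrable (fun x _ => hd hφ x) (fun x _ => hd hχ x)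
    (hint hφ.1.continuous hχ.deriv.1.continuous hφ.2)
    (hint hφ.deriv.1.continuous hχ.1.continuous hφ.deriv.2)
    (hint hφ.1.continuous hχ.1.continuous hφ.2)]
  ring

theorem HasD.isWeakDeriv {u v : L2} (h : HasD u v) : IsWeakDeriv 1 u v := by
  intro φ hφ
  have := h.inner_left (hasD_testLp hφ)
  rw [inner_testLp, inner_testLp] at this
  rw [iteratedDeriv_one, this]
  ring

theorem isWeakDeriv_zero (u : L2) : IsWeakDeriv 0 u u := by
  intro φ _
  simp

theorem IsWeakDeriv.succ {j : ℕ} {u v w : L2} (h : IsWeakDeriv j u v) (hv : HasD v w) :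
    IsWeakDeriv (j + 1) u w := by
  intro φ hφ
  have h1 := h _ hφ.deriv
  have h2 := hv.isWeakDeriv φ hφ
  rw [iteratedDeriv_succ', h1, ← iteratedDeriv_one, h2, pow_succ]
  ring

/-- Testing the order `j` relation with `φ'` and comparing with order `j + 1` shows that consecutive
entries of an element of `H^l` are linked by `HasD`. -/
theorem IsWeakDeriv.hasD_of_succ {j : ℕ} {u v w : L2} (h : IsWeakDeriv j u v)
    (h' : IsWeakDeriv (j + 1) u w) : HasD v w := by
  refine IsWeakDeriv.hasD fun φ hφ => ?_
  have h1 := h _ hφ.deriv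
  have h2 := h' _ hφ
  rw [iteratedDeriv_succ', h1, pow_succ] at h2
  rw [iteratedDeriv_one]
  have : ((-1 : ℝ) ^ j) ≠ 0 := by positivity
  apply mul_left_cancel₀ this
  rw [h2]
  ring

theorem isWeakDeriv_iff_inner {j : ℕ} {u v : L2} :
    IsWeakDeriv j u v ↔ ∀ φ (hφ : IsTest φ),
      inner ℝ u (testLp (hφ.iteratedDeriv j)) = (-1) ^ j * inner ℝ v (testLp hφ) := by
  simp only [IsWeakDeriv, inner_testLp]

/-- For each fixed test function both sides of the defining relation are continuous on `L₂`.
Completeness of `H^l` rests on this. -/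
theorem isClosed_isWeakDeriv (j : ℕ) : IsClosed {p : L2 × L2 | IsWeakDeriv j p.1 p.2} := by
  simp only [isWeakDeriv_iff_inner, Set.ofPred_forall]
  refine isClosed_iInter fun φ => isClosed_iInter fun hφ => isClosed_eq ?_ ?_ <;> fun_prop

/-! ### Multiplication by bounded functions -/

/-- `g` is measurable and bounded by `K`. -/
def IsMul (K : ℝ) (g : ℝ → ℝ) : Prop := Measurable g ∧ ∀ x, |g x| ≤ K

theorem IsMul.nonneg {K : ℝ} {g : ℝ → ℝ} (hg : IsMul K g) : 0 ≤ K :=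
  (abs_nonneg _).trans (hg.2 0)

theorem IsMul.comp_add {K : ℝ} {g : ℝ → ℝ} (hg : IsMul K g) (y : ℝ) :
    IsMul K (fun x => g (x + y)) :=
  ⟨hg.1.comp (measurable_id.add_const y), fun x => hg.2 (x + y)⟩

theorem IsMul.memLp {K : ℝ} {g : ℝ → ℝ} (hg : IsMul K g) (u : L2) :
    MemLp (fun x => g x * u x) 2 (volume : Measure ℝ) := by
  refine MemLp.of_le_mul (c := K) (Lp.memLp u)
    (hg.1.aestronglyMeasurable.mul (Lp.aestronglyMeasurable u)) (ae_of_all _ fun x => ?_)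
  rw [norm_mul]
  exact mul_le_mul_of_nonneg_right (hg.2 x) (norm_nonneg _)

theorem coeFn_mulL2 {K : ℝ} {g : ℝ → ℝ} (hg : IsMul K g) (u : L2) :
    mulL2 g u =ᵐ[volume] fun x => g x * u x := by
  rw [mulL2, dif_pos (hg.memLp u)]
  exact MemLp.coeFn_toLp _

theorem norm_mulL2_le {K : ℝ} {g : ℝ → ℝ} (hg : IsMul K g) (u : L2) :
    ‖mulL2 g u‖ ≤ K * ‖u‖ := by
  refine Lp.norm_le_mul_norm_of_ae_le_mul ?_
  filter_upwards [coeFn_mulL2 hg u] with x hx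
  rw [hx, norm_mul]
  exact mul_le_mul_of_nonneg_right (hg.2 x) (norm_nonneg _)

theorem mulL2_add {K : ℝ} {g : ℝ → ℝ} (hg : IsMul K g) (u v : L2) :
    mulL2 g (u + v) = mulL2 g u + mulL2 g v := by
  apply Lp.ext
  filter_upwards [coeFn_mulL2 hg u, coeFn_mulL2 hg v, coeFn_mulL2 hg (u + v),
    Lp.coeFn_add u v, Lp.coeFn_add (mulL2 g u) (mulL2 g v)] with x h1 h2 h3 h4 h5
  rw [h3, h4, h5, Pi.add_apply, Pi.add_apply, h1, h2, mul_add]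

theorem mulL2_smul {K : ℝ} {g : ℝ → ℝ} (hg : IsMul K g) (r : ℝ) (u : L2) :
    mulL2 g (r • u) = r • mulL2 g u := by
  apply Lp.ext
  filter_upwards [coeFn_mulL2 hg u, coeFn_mulL2 hg (r • u),
    Lp.coeFn_smul r u, Lp.coeFn_smul r (mulL2 g u)] with x h1 h2 h3 h4
  rw [h2, h3, h4, Pi.smul_apply, Pi.smul_apply, h1, smul_eq_mul, smul_eq_mul, mul_left_comm]

theorem mulL2_sub {K : ℝ} {g : ℝ → ℝ} (hg : IsMul K g) (u v : L2) :
    mulL2 g (u - v) = mulL2 g u - mulL2 g v := by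
  rw [sub_eq_add_neg, ← neg_one_smul ℝ v, mulL2_add hg, mulL2_smul hg, neg_one_smul,
    ← sub_eq_add_neg]

theorem mulL2_fun_add {K K' : ℝ} {g g' : ℝ → ℝ} (hg : IsMul K g) (hg' : IsMul K' g') (u : L2) :
    mulL2 (fun x => g x + g' x) u = mulL2 g u + mulL2 g' u := by
  have h : IsMul (K + K') (fun x => g x + g' x) :=
    ⟨hg.1.add hg'.1, fun x => (abs_add_le _ _).trans (add_le_add (hg.2 x) (hg'.2 x))⟩
  apply Lp.ext
  filter_upwards [coeFn_mulL2 hg u, coeFn_mulL2 hg' u, coeFn_mulL2 h u,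
    Lp.coeFn_add (mulL2 g u) (mulL2 g' u)] with x h1 h2 h3 h4
  rw [h3, h4, Pi.add_apply, h1, h2, add_mul]

theorem mulL2_fun_smul {K : ℝ} {g : ℝ → ℝ} (hg : IsMul K g) (r : ℝ) (u : L2) :
    mulL2 (fun x => r * g x) u = r • mulL2 g u := by
  have h : IsMul (|r| * K) (fun x => r * g x) :=
    ⟨hg.1.const_mul r, fun x => by
      rw [abs_mul]; exact mul_le_mul_of_nonneg_left (hg.2 x) (abs_nonneg _)⟩
  apply Lp.ext
  filter_upwards [coeFn_mulL2 hg u, coeFn_mulL2 h u,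
    Lp.coeFn_smul r (mulL2 g u)] with x h1 h2 h3
  rw [h2, h3, Pi.smul_apply, h1, smul_eq_mul, mul_assoc]

theorem IsMul.sub {K K' : ℝ} {g g' : ℝ → ℝ} (hg : IsMul K g) (hg' : IsMul K' g') :
    IsMul (K + K') (fun x => g x - g' x) :=
  ⟨hg.1.sub hg'.1, fun x => (abs_sub _ _).trans (add_le_add (hg.2 x) (hg'.2 x))⟩

theorem mulL2_fun_sub {K K' : ℝ} {g g' : ℝ → ℝ} (hg : IsMul K g) (hg' : IsMul K' g') (u : L2) :
    mulL2 (fun x => g x - g' x) u = mulL2 g u - mulL2 g' u := by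
  rw [eq_sub_iff_add_eq, ← mulL2_fun_add (hg.sub hg') hg']
  simp

theorem inner_mulL2_eq_integral {K : ℝ} {g : ℝ → ℝ} (hg : IsMul K g) (u v : L2) :
    inner ℝ (mulL2 g u) v = ∫ x, g x * u x * v x := by
  rw [inner_eq_integral]
  refine integral_congr_ae ?_
  filter_upwards [coeFn_mulL2 hg u] with x hx
  rw [hx]

theorem inner_mulL2_left {K : ℝ} {g : ℝ → ℝ} (hg : IsMul K g) (u v : L2) :
    inner ℝ (mulL2 g u) v = inner ℝ u (mulL2 g v) := by
  rw [real_inner_comm (mulL2 g v), inner_mulL2_eq_integral hg, inner_mulL2_eq_integral hg]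
  congr 1 with x
  ring

theorem inner_mulL2_self_nonneg {K : ℝ} {g : ℝ → ℝ} (hg : IsMul K g) (h0 : ∀ x, 0 ≤ g x) (u : L2) :
    0 ≤ inner ℝ (mulL2 g u) u := by
  rw [inner_mulL2_eq_integral hg]
  refine integral_nonneg fun x => ?_
  simp only [mul_assoc]
  exact mul_nonneg (h0 x) (mul_self_nonneg _)

theorem shift_mulL2 {K : ℝ} {g : ℝ → ℝ} (hg : IsMul K g) (y : ℝ) (u : L2) :
    shift y (mulL2 g u) = mulL2 (fun x => g (x + y)) (shift y u) := by
  apply Lp.ext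
  have h1 := (measurePreserving_add_right (volume : Measure ℝ) y).quasiMeasurePreserving.ae_eq_comp
    (coeFn_mulL2 hg u)
  filter_upwards [coeFn_shift y (mulL2 g u), coeFn_mulL2 (hg.comp_add y) (shift y u),
    coeFn_shift y u, h1] with x h2 h3 h4 h5
  rw [h2, h3, h4]
  exact h5

/-- Dominated convergence for `∫ (g i - g₀)² u²`: uniformly bounded multipliers need only converge
pointwise to converge strongly as operators. -/
theorem tendsto_mulL2 {ι : Type*} {l : Filter ι} [l.IsCountablyGenerated] {K : ℝ}
    {g : ι → ℝ → ℝ} {g₀ : ℝ → ℝ} (hg : ∀ᶠ i in l, IsMul K (g i)) (hg₀ : IsMul K g₀)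
    (h : ∀ x, Tendsto (fun i => g i x) l (𝓝 (g₀ x))) (u : L2) :
    Tendsto (fun i => mulL2 (g i) u) l (𝓝 (mulL2 g₀ u)) := by
  rw [tendsto_iff_norm_sub_tendsto_zero]
  have h2 : Tendsto (fun i => ∫ x, (g i x - g₀ x) ^ 2 * u x ^ 2) l (𝓝 (∫ x : ℝ, (0 : ℝ))) := by
    refine tendsto_integral_filter_of_dominated_convergence (fun x => (2 * K) ^ 2 * u x ^ 2) ?_ ?_
      ?_ ?_
    · filter_upwards [hg] with i hi
      exact (((hi.1.sub hg₀.1).pow_const 2).aestronglyMeasurable).mul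
        ((Lp.aestronglyMeasurable u).pow 2)
    · filter_upwards [hg] with i hi
      refine ae_of_all _ fun x => ?_
      rw [norm_mul, Real.norm_eq_abs, Real.norm_eq_abs, abs_of_nonneg (sq_nonneg _),
        abs_of_nonneg (sq_nonneg _)]
      refine mul_le_mul_of_nonneg_right ?_ (sq_nonneg _)
      rw [← sq_abs]
      have := (hi.sub hg₀).2 x
      exact pow_le_pow_left₀ (abs_nonneg _) (by linarith) 2
    · exact ((Lp.memLp u).integrable_sq).const_mul _
    · refine ae_of_all _ fun x => ?_
      have := (((h x).sub_const (g₀ x)).pow 2).mul_const (u x ^ 2)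
      simpa using this
  have h3 : ∀ᶠ i in l, ∫ x, (g i x - g₀ x) ^ 2 * u x ^ 2 = ‖mulL2 (g i) u - mulL2 g₀ u‖ ^ 2 := by
    filter_upwards [hg] with i hi
    rw [← mulL2_fun_sub hi hg₀, ← real_inner_self_eq_norm_sq, inner_eq_integral]
    refine integral_congr_ae ?_
    filter_upwards [coeFn_mulL2 (hi.sub hg₀) u] with x hx
    rw [hx]
    ring
  have h4 := (Tendsto.congr' h3 h2).sqrt
  simpa using h4

theorem abs_sub_le_of_deriv_bound {K : ℝ} {g g' : ℝ → ℝ} (hd : ∀ x, HasDerivAt g (g' x) x)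
    (hg' : ∀ x, |g' x| ≤ K) (x y : ℝ) : |g (x + y) - g x| ≤ K * |y| := by
  have := Convex.norm_image_sub_le_of_norm_hasDerivWithin_le (s := univ) (x := x) (y := x + y)
    (fun z _ => (hd z).hasDerivWithinAt) (fun z _ => hg' z) convex_univ (mem_univ _) (mem_univ _)
  simpa using this

theorem isMul_difference_quotient {K : ℝ} {g g' : ℝ → ℝ} (hg : Measurable g)
    (hd : ∀ x, HasDerivAt g (g' x) x) (hg' : ∀ x, |g' x| ≤ K) {r : ℝ} (hr : r ≠ 0) :
    IsMul K (fun x => r⁻¹ * (g (x + r) - g x)) := by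
  refine ⟨((hg.comp (measurable_id.add_const r)).sub hg).const_mul _, fun x => ?_⟩
  rw [abs_mul, abs_inv, inv_mul_le_iff₀ (abs_pos.2 hr), mul_comm]
  exact abs_sub_le_of_deriv_bound hd hg' x r

/-- The discrete product rule. The factor `g(· + r)` is hidden inside two opposite translations so
that the first term contains the fixed operator `mulL2 g`; as `r → 0` its continuity suffices,
without any convergence of `g(· + r)`. -/
theorem diffQ_mulL2 {K : ℝ} {g : ℝ → ℝ} (hg : IsMul K g) (r : ℝ) (u : L2) :
    diffQ r (mulL2 g u) =
      shift r (mulL2 g (shift (-r) (diffQ r u))) +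
        mulL2 (fun x => r⁻¹ * (g (x + r) - g x)) u := by
  rw [mulL2_fun_smul ((hg.comp_add r).sub hg), mulL2_fun_sub (hg.comp_add r) hg,
    shift_mulL2 hg, shift_shift, add_neg_cancel, shift_zero, diffQ, diffQ, shift_mulL2 hg,
    mulL2_smul (hg.comp_add r), mulL2_sub (hg.comp_add r), ← smul_add]
  congr 1
  abel

theorem HasD.mulL2 {K : ℝ} {g g' : ℝ → ℝ} (hg : IsMul K g) (hg' : IsMul K g')
    (hd : ∀ x, HasDerivAt g (g' x) x) {u v : L2} (h : HasD u v) :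
    HasD (mulL2 g u) (mulL2 g' u + mulL2 g v) := by
  refine hasD_of_tendsto ?_
  simp_rw [diffQ_mulL2 hg, add_comm (LevyPIDE.mulL2 g' u)]
  refine Tendsto.add ?_ ?_
  · have hc : Continuous (LevyPIDE.mulL2 g) := by
      refine (LipschitzWith.of_dist_le_mul (K := K.toNNReal) fun x y => ?_).continuous
      rw [dist_eq_norm, dist_eq_norm, ← mulL2_sub hg, Real.coe_toNNReal _ hg.nonneg]
      exact norm_mulL2_le hg _
    have hid : Tendsto (fun r : ℝ => r) (𝓝[≠] 0) (𝓝 0) := tendsto_id.mono_left nhdsWithin_le_nhds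
    have hnid : Tendsto (fun r : ℝ => -r) (𝓝[≠] 0) (𝓝 0) := by simpa using hid.neg
    have h1 : Tendsto (fun r => shift (-r) (diffQ r u)) (𝓝[≠] 0) (𝓝 v) := by
      have := (continuous_shift_prod.tendsto ((0 : ℝ), v)).comp (hnid.prodMk_nhds h.tendsto)
      simpa [Function.comp_def] using this
    have := (continuous_shift_prod.tendsto ((0 : ℝ), LevyPIDE.mulL2 g v)).comp
      (hid.prodMk_nhds ((hc.tendsto v).comp h1))
    simpa [Function.comp_def] using this
  · refine tendsto_mulL2 (K := K) ?_ hg' (fun x => ?_) u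
    · filter_upwards [self_mem_nhdsWithin] with r hr
      exact isMul_difference_quotient hg.1 hd hg'.2 hr
    · have := hasDerivAt_iff_tendsto_slope_zero.1 (hd x)
      simpa using this

/-! ### The Leibniz formula -/

/-- `g` is of class `C^r` and its derivatives up to order `r` are bounded by `K`. -/
def BddDeriv (K : ℝ) (r : ℕ) (g : ℝ → ℝ) : Prop :=
  ContDiff ℝ r g ∧ ∀ j ≤ r, ∀ x, |iteratedDeriv j g x| ≤ K

theorem BddDeriv.isMul {K : ℝ} {r : ℕ} {g : ℝ → ℝ} (hg : BddDeriv K r g) {j : ℕ} (hj : j ≤ r) :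
    IsMul K (iteratedDeriv j g) :=
  ⟨(hg.1.continuous_iteratedDeriv j (by exact_mod_cast hj)).measurable, hg.2 j hj⟩

theorem BddDeriv.isMul_zero {K : ℝ} {r : ℕ} {g : ℝ → ℝ} (hg : BddDeriv K r g) : IsMul K g := by
  simpa using hg.isMul (Nat.zero_le r)

theorem BddDeriv.hasDerivAt {K : ℝ} {r : ℕ} {g : ℝ → ℝ} (hg : BddDeriv K r g) {j : ℕ}
    (hj : j < r) (x : ℝ) : HasDerivAt (iteratedDeriv j g) (iteratedDeriv (j + 1) g x) x := by
  rw [iteratedDeriv_succ]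
  exact ((hg.1.differentiable_iteratedDeriv j (by exact_mod_cast hj)) x).hasDerivAt

/-- The `j`-th derivative of the product of `g` and a function with derivatives `w 0, w 1, …`. -/
def leib (g : ℝ → ℝ) (w : ℕ → L2) (j : ℕ) : L2 :=
  ∑ p ∈ Finset.HasAntidiagonal.antidiagonal j, j.choose p.1 • mulL2 (iteratedDeriv p.1 g) (w p.2)

@[simp] theorem leib_zero (g : ℝ → ℝ) (w : ℕ → L2) : leib g w 0 = mulL2 g (w 0) := by
  simp [leib]

/-- Each product differentiates into two, and Pascal's rule regroups them into the next Leibniz sum.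
-/
theorem hasD_leib {K : ℝ} {r : ℕ} {g : ℝ → ℝ} (hg : BddDeriv K r g) {w : ℕ → L2} {j : ℕ}
    (hj : j < r) (hw : ∀ i ≤ j, HasD (w i) (w (i + 1))) :
    HasD (leib g w j) (leib g w (j + 1)) := by
  have e : leib g w (j + 1) = ∑ p ∈ Finset.HasAntidiagonal.antidiagonal j,
      j.choose p.1 • (mulL2 (iteratedDeriv (p.1 + 1) g) (w p.2) +
        mulL2 (iteratedDeriv p.1 g) (w (p.2 + 1))) := by
    rw [leib, Finset.sum_antidiagonal_choose_succ_nsmul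
      (fun i k => mulL2 (iteratedDeriv i g) (w k)) j, add_comm, ← Finset.sum_add_distrib]
    refine Finset.sum_congr rfl fun p hp => ?_
    rw [smul_add, Nat.choose_symm_of_eq_add (Finset.HasAntidiagonal.mem_antidiagonal.1 hp).symm]
  rw [e]
  refine HasD.sum fun p hp => ?_
  have hp' := Finset.HasAntidiagonal.mem_antidiagonal.1 hp
  have h1 : HasD _ _ := (hw p.2 (by omega)).mulL2 (hg.isMul (j := p.1) (by omega))
    (hg.isMul (j := p.1 + 1) (by omega)) (fun x => hg.hasDerivAt (by omega) x)
  simpa only [Nat.cast_smul_eq_nsmul] using h1.smul (j.choose p.1 : ℝ)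

theorem leib_sub {K : ℝ} {r : ℕ} {g : ℝ → ℝ} (hg : BddDeriv K r g) (w w' : ℕ → L2) {j : ℕ}
    (hj : j ≤ r) : leib g (fun i => w i - w' i) j = leib g w j - leib g w' j := by
  simp only [leib, ← Finset.sum_sub_distrib]
  refine Finset.sum_congr rfl fun p hp => ?_
  have hp' := Finset.HasAntidiagonal.mem_antidiagonal.1 hp
  rw [mulL2_sub (hg.isMul (by omega)), smul_sub]

theorem norm_leib_le {K : ℝ} {r : ℕ} {g : ℝ → ℝ} (hg : BddDeriv K r g) (w : ℕ → L2) {j : ℕ}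
    (hj : j ≤ r) {M : ℝ} (hw : ∀ i ≤ j, ‖w i‖ ≤ M) : ‖leib g w j‖ ≤ 2 ^ j * (K * M) := by
  have h2 : (2 : ℝ) ^ j = ∑ p ∈ Finset.HasAntidiagonal.antidiagonal j, (j.choose p.1 : ℝ) := by
    rw [Finset.Nat.sum_antidiagonal_eq_sum_range_succ_mk]
    exact_mod_cast (Nat.sum_range_choose j).symm
  rw [h2, Finset.sum_mul]
  refine norm_sum_le_of_le _ fun p hp => ?_
  have hp' := Finset.HasAntidiagonal.mem_antidiagonal.1 hp
  have hm := hg.isMul (j := p.1) (by omega)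
  rw [← Nat.cast_smul_eq_nsmul ℝ, norm_smul, Real.norm_natCast]
  gcongr
  exact (norm_mulL2_le hm _).trans (mul_le_mul_of_nonneg_left (hw _ (by omega)) hm.nonneg)

/-! ### Difference operators -/

/-- The difference quotient as a continuous linear map. -/
def diffQL (r : ℝ) : L2 →L[ℝ] L2 :=
  r⁻¹ • ((shiftL r).toContinuousLinearMap - ContinuousLinearMap.id ℝ L2)

theorem diffQ_sub (r : ℝ) (u v : L2) : diffQ r (u - v) = diffQ r u - diffQ r v :=
  (diffQL r).map_sub u v

theorem HasD.diffQ {u v : L2} (h : HasD u v) (r : ℝ) : HasD (diffQ r u) (diffQ r v) :=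
  h.map (diffQL r) fun y w => diffQ_comm_shift r y w

/-- The symmetric second difference quotient. -/
def lap (r : ℝ) (u : L2) : L2 := diffQ (-r) (diffQ r u)

theorem lap_eq (r : ℝ) (u : L2) :
    lap r u = (r⁻¹ * r⁻¹) • (shift r u - (2 : ℝ) • u + shift (-r) u) := by
  simp only [lap, diffQ, shift_smul, shift_sub, shift_shift, neg_add_cancel, shift_zero, inv_neg]
  module

theorem lap_sub (r : ℝ) (u v : L2) : lap r (u - v) = lap r u - lap r v := by
  simp only [lap, diffQ_sub]

theorem HasD.lap {u v : L2} (h : HasD u v) (r : ℝ) : HasD (lap r u) (lap r v) :=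
  (h.diffQ r).diffQ (-r)

theorem symDiffQ_eq (h : ℝ) (u : L2) :
    symDiffQ h u = (2 * h)⁻¹ • (shift h u - shift (-h) u) := by
  simp only [symDiffQ, diffQ, inv_neg, mul_inv]
  module

/-- Local and jump parts of the scheme thus involve the same operator `lap`, with steps `2h` and
`h`. -/
theorem symDiffQ_symDiffQ (h : ℝ) (u : L2) : symDiffQ h (symDiffQ h u) = lap (2 * h) u := by
  rw [lap_eq, symDiffQ_eq, symDiffQ_eq]
  simp only [shift_smul, shift_sub, shift_shift, neg_add_cancel, add_neg_cancel, shift_zero,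
    ← two_mul, mul_neg, smul_sub, smul_add, smul_smul]
  module

theorem HasD.symDiffQ {u v : L2} (h : HasD u v) (r : ℝ) : HasD (symDiffQ r u) (symDiffQ r v) :=
  ((h.diffQ r).add (h.diffQ (-r))).smul _

theorem symDiffQ_sub (r : ℝ) (u v : L2) : symDiffQ r (u - v) = symDiffQ r u - symDiffQ r v := by
  simp only [symDiffQ, diffQ_sub]
  module

theorem inner_lap_left (r : ℝ) (u v : L2) : inner ℝ (lap r u) v = inner ℝ u (lap r v) := by
  simp only [lap_eq, inner_smul_left, inner_smul_right, inner_add_left, inner_sub_left,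
    inner_add_right, inner_sub_right, inner_shift_left, neg_neg, conj_trivial]
  ring

theorem HasD.norm_lap_le {u v w : L2} (h : HasD u v) (h' : HasD v w) (r : ℝ) :
    ‖LevyPIDE.lap r u‖ ≤ ‖w‖ :=
  ((h.diffQ r).norm_diffQ_le (-r)).trans (h'.norm_diffQ_le r)

/-- First replace the inner quotient by the derivative, then the outer one; each replacement costs
one first order error `|r| ‖z‖`. -/
theorem HasD.norm_lap_sub_le {u v w z : L2} (h : HasD u v) (h' : HasD v w) (h'' : HasD w z)
    {r : ℝ} (hr : r ≠ 0) : ‖LevyPIDE.lap r u - w‖ ≤ 2 * |r| * ‖z‖ := by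
  have e : LevyPIDE.lap r u - w =
      LevyPIDE.diffQ (-r) (LevyPIDE.diffQ r u - v) + (LevyPIDE.diffQ (-r) v - w) := by
    rw [diffQ_sub, LevyPIDE.lap]; abel
  rw [e]
  have h1 := (((h.diffQ r).sub h').norm_diffQ_le (-r)).trans (h'.norm_diffQ_sub_le h'' hr)
  have h2 := h'.norm_diffQ_sub_le h'' (neg_ne_zero.2 hr)
  rw [abs_neg] at h2
  calc _ ≤ _ := norm_add_le _ _
    _ ≤ |r| * ‖z‖ + |r| * ‖z‖ := add_le_add h1 h2
    _ = _ := by ring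

theorem HasD.norm_symDiffQ_le {u v : L2} (h : HasD u v) (r : ℝ) :
    ‖LevyPIDE.symDiffQ r u‖ ≤ ‖v‖ := by
  rw [LevyPIDE.symDiffQ, norm_smul]
  have := (norm_add_le _ _).trans (add_le_add (h.norm_diffQ_le r) (h.norm_diffQ_le (-r)))
  norm_num
  linarith

theorem HasD.norm_symDiffQ_sub_le {u v w : L2} (h : HasD u v) (h' : HasD v w) {r : ℝ}
    (hr : r ≠ 0) : ‖LevyPIDE.symDiffQ r u - v‖ ≤ |r| * ‖w‖ := by
  have e : LevyPIDE.symDiffQ r u - v =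
      (2 : ℝ)⁻¹ • ((LevyPIDE.diffQ r u - v) + (LevyPIDE.diffQ (-r) u - v)) := by
    rw [LevyPIDE.symDiffQ]; module
  have h1 := h.norm_diffQ_sub_le h' hr
  have h2 := h.norm_diffQ_sub_le h' (neg_ne_zero.2 hr)
  rw [abs_neg] at h2
  have := (norm_add_le _ _).trans (add_le_add h1 h2)
  rw [e, norm_smul]
  norm_num
  linarith

/-! ### Energy estimates for the local part -/

/-- The function `s ↦ g (x + s) + g (x - s)` has derivative `g' (x + s) - g' (x - s)`, which is at
most `2 K |r|` between `0` and `r`; the mean value inequality then applies. -/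
theorem abs_second_difference_le {K : ℝ} {g g' g'' : ℝ → ℝ} (hd : ∀ x, HasDerivAt g (g' x) x)
    (hd' : ∀ x, HasDerivAt g' (g'' x) x) (hg : ∀ x, |g'' x| ≤ K) (x r : ℝ) :
    |g (x + r) + g (x - r) - 2 * g x| ≤ 2 * K * r ^ 2 := by
  have h1 : ∀ s : ℝ, HasDerivAt (fun s => g (x + s) + g (x - s)) (g' (x + s) - g' (x - s)) s := by
    intro s
    have ha := (hd (x + s)).comp_const_add x s
    have hb := (hd (x - s)).comp_const_sub x s
    have := ha.add hb
    rw [← sub_eq_add_neg] at this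
    exact this
  have h2 : ∀ s ∈ uIcc 0 r, ‖g' (x + s) - g' (x - s)‖ ≤ 2 * K * |r| := by
    intro s hs
    have := abs_sub_le_of_deriv_bound hd' hg (x - s) (2 * s)
    rw [show x - s + 2 * s = x + s by ring, abs_mul, abs_two] at this
    have hs' : |s| ≤ |r| := by simpa using abs_sub_left_of_mem_uIcc hs
    have hK : 0 ≤ K := (abs_nonneg _).trans (hg 0)
    calc _ ≤ K * (2 * |s|) := this
      _ ≤ K * (2 * |r|) := by gcongr
      _ = _ := by ring
  have := Convex.norm_image_sub_le_of_norm_hasDerivWithin_le (s := uIcc 0 r) (x := 0) (y := r)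
    (fun z _ => (h1 z).hasDerivWithinAt) h2 (convex_uIcc 0 r) left_mem_uIcc right_mem_uIcc
  simp only [add_zero, sub_zero, Real.norm_eq_abs] at this
  rw [show g (x + r) + g (x - r) - 2 * g x = g (x + r) + g (x - r) - (g x + g x) by ring]
  calc _ ≤ _ := this
    _ = 2 * K * |r| ^ 2 := by ring
    _ = _ := by rw [sq_abs]

theorem isMul_second_difference {K : ℝ} {g g' g'' : ℝ → ℝ} (hm : Measurable g)
    (hd : ∀ x, HasDerivAt g (g' x) x)
    (hd' : ∀ x, HasDerivAt g' (g'' x) x) (hg : ∀ x, |g'' x| ≤ K) (r : ℝ) :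
    IsMul (2 * K * r ^ 2) (fun x => g (x + r) + g (x - r) - 2 * g x) :=
  ⟨((hm.comp (measurable_id.add_const r)).add (hm.comp (measurable_id.sub_const r))).sub
    (hm.const_mul 2), fun x => abs_second_difference_le hd hd' hg x r⟩

theorem mulL2_second_difference {K : ℝ} {g : ℝ → ℝ} (hg : IsMul K g) (r : ℝ) (u : L2) :
    mulL2 (fun x => g (x + r) + g (x - r) - 2 * g x) u =
      mulL2 (fun x => g (x + r)) u + mulL2 (fun x => g (x - r)) u - (2 : ℝ) • mulL2 g u := by
  have h1 := hg.comp_add r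
  have h2 : IsMul K (fun x => g (x - r)) := by simpa [sub_eq_add_neg] using hg.comp_add (-r)
  have h12 : IsMul (K + K) (fun x => g (x + r) + g (x - r)) :=
    ⟨h1.1.add h2.1, fun x => (abs_add_le _ _).trans (add_le_add (h1.2 x) (h2.2 x))⟩
  have h3 : IsMul (2 * K) (fun x => 2 * g x) :=
    ⟨hg.1.const_mul 2, fun x => by rw [abs_mul, abs_two]; linarith [hg.2 x]⟩
  rw [mulL2_fun_sub h12 h3, mulL2_fun_add h1 h2, mulL2_fun_smul hg]

/-- Young's inequality with weight `g`: expand the nonnegative form of `g` at `shift r u - u`. -/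
theorem inner_mulL2_shift_le {K : ℝ} {g : ℝ → ℝ} (hg : IsMul K g) (h0 : ∀ x, 0 ≤ g x) (r : ℝ)
    (u : L2) : inner ℝ (mulL2 g (shift r u)) u ≤
      (inner ℝ (mulL2 (fun x => g (x - r)) u) u + inner ℝ (mulL2 g u) u) / 2 := by
  have h1 := inner_mulL2_self_nonneg hg h0 (shift r u - u)
  have h2 : inner ℝ (mulL2 g (shift r u)) (shift r u) =
      inner ℝ (mulL2 (fun x => g (x - r)) u) u := by
    rw [inner_shift_right r, shift_mulL2 hg, shift_shift, neg_add_cancel, shift_zero]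
    simp only [sub_eq_add_neg]
  rw [mulL2_sub hg, inner_sub_left, inner_sub_right, inner_sub_right, h2,
    inner_mulL2_left hg u (shift r u), real_inner_comm (mulL2 g (shift r u)) u] at h1
  linarith

/-- Applying the weighted Young inequality to both translates leaves only half the second difference
of `g`, divided by `r²`, tested against `u²`. Nonnegativity of `g` is all that is required, so
degeneracy does no harm. -/
theorem inner_mulL2_lap_le {K K₀ : ℝ} {g g' g'' : ℝ → ℝ} (hm : IsMul K₀ g) (h0 : ∀ x, 0 ≤ g x)
    (hd : ∀ x, HasDerivAt g (g' x) x) (hd' : ∀ x, HasDerivAt g' (g'' x) x)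
    (hg : ∀ x, |g'' x| ≤ K) {r : ℝ} (hr : r ≠ 0) (u : L2) :
    inner ℝ (mulL2 g (lap r u)) u ≤ K * ‖u‖ ^ 2 := by
  have h1 := inner_mulL2_shift_le hm h0 r u
  have h2 := inner_mulL2_shift_le hm h0 (-r) u
  simp only [sub_neg_eq_add] at h2
  have h3 : inner ℝ (mulL2 (fun x => g (x + r) + g (x - r) - 2 * g x) u) u ≤
      2 * K * r ^ 2 * ‖u‖ * ‖u‖ :=
    (real_inner_le_norm _ _).trans (mul_le_mul_of_nonneg_right
      (norm_mulL2_le (isMul_second_difference hm.1 hd hd' hg r) u) (norm_nonneg _))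
  rw [mulL2_second_difference hm, inner_sub_left, inner_add_left, inner_smul_left] at h3
  rw [lap_eq, mulL2_smul hm, mulL2_add hm, mulL2_sub hm, mulL2_smul hm, inner_smul_left,
    inner_add_left, inner_sub_left, inner_smul_left]
  simp only [conj_trivial] at h3 ⊢
  have h4 : 0 ≤ r⁻¹ * r⁻¹ := mul_self_nonneg _
  calc _ ≤ (r⁻¹ * r⁻¹) * (K * r ^ 2 * ‖u‖ * ‖u‖) := by
        refine mul_le_mul_of_nonneg_left ?_ h4
        linarith
    _ = _ := by field_simp

/-- The symmetric quotient is skew-adjoint, so only its failure to commute with `g` contributes, and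
that is a difference quotient of `g`. -/
theorem inner_mulL2_symDiffQ_le {K K₀ : ℝ} {g g' : ℝ → ℝ} (hm : IsMul K₀ g)
    (hd : ∀ x, HasDerivAt g (g' x) x) (hg : ∀ x, |g' x| ≤ K) {r : ℝ} (hr : r ≠ 0) (u : L2) :
    inner ℝ (mulL2 g (symDiffQ r u)) u ≤ K * ‖u‖ ^ 2 := by
  have hK : 0 ≤ K := (abs_nonneg _).trans (hg 0)
  have hq := isMul_difference_quotient hm.1 hd hg hr
  have e : inner ℝ (mulL2 g (symDiffQ r u)) u =
      -(1 / 2) * inner ℝ (mulL2 (fun x => r⁻¹ * (g (x + r) - g x)) (shift r u)) u := by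
    have h1 : inner ℝ (mulL2 g (shift (-r) u)) u =
        inner ℝ (mulL2 (fun x => g (x + r)) (shift r u)) u := by
      rw [inner_mulL2_left hm, inner_shift_left, neg_neg, shift_mulL2 hm, real_inner_comm]
    rw [symDiffQ_eq, mulL2_smul hm, mulL2_sub hm, inner_smul_left, inner_sub_left, h1,
      mulL2_fun_smul ((hm.comp_add r).sub hm), mulL2_fun_sub (hm.comp_add r) hm, inner_smul_left,
      inner_sub_left]
    simp only [conj_trivial, mul_inv]
    ring
  have h2 : |inner ℝ (mulL2 (fun x => r⁻¹ * (g (x + r) - g x)) (shift r u)) u| ≤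
      K * ‖u‖ * ‖u‖ := by
    refine (abs_real_inner_le_norm _ _).trans (mul_le_mul_of_nonneg_right ?_ (norm_nonneg _))
    simpa using norm_mulL2_le hq (shift r u)
  rw [e]
  have h3 := (abs_le.1 h2).1
  have h4 : 0 ≤ K * ‖u‖ * ‖u‖ := by positivity
  calc _ ≤ K * ‖u‖ * ‖u‖ := by linarith
    _ = _ := by ring

/-- In the commutator the second differences of `u` cancel. What remains is first differences of `g`
times first differences of `u`, and the second difference of `g` times `u`. -/
theorem norm_lap_mulL2_sub_le {K K₀ : ℝ} {g g' g'' : ℝ → ℝ} (hm : IsMul K₀ g)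
    (hd : ∀ x, HasDerivAt g (g' x) x) (hd' : ∀ x, HasDerivAt g' (g'' x) x)
    (hg' : ∀ x, |g' x| ≤ K) (hg : ∀ x, |g'' x| ≤ K) {r : ℝ} (hr : r ≠ 0) {u v : L2}
    (huv : HasD u v) :
    ‖lap r (mulL2 g u) - mulL2 g (lap r u)‖ ≤ 2 * K * (‖u‖ + ‖v‖) := by
  have hp := isMul_difference_quotient hm.1 hd hg' hr
  have hn := isMul_difference_quotient hm.1 hd hg' (neg_ne_zero.2 hr)
  have hs := isMul_second_difference hm.1 hd hd' hg r
  have hms : IsMul K₀ (fun x => g (x - r)) := by simpa [sub_eq_add_neg] using hm.comp_add (-r)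
  have hK := hp.nonneg
  have e : lap r (mulL2 g u) - mulL2 g (lap r u) =
      mulL2 (fun x => r⁻¹ * (g (x + r) - g x)) (diffQ r u) +
      mulL2 (fun x => (-r)⁻¹ * (g (x + -r) - g x)) (diffQ (-r) u) +
      (r⁻¹ * r⁻¹) • mulL2 (fun x => g (x + r) + g (x - r) - 2 * g x) u := by
    rw [mulL2_second_difference hm, mulL2_fun_smul ((hm.comp_add r).sub hm),
      mulL2_fun_smul ((hm.comp_add (-r)).sub hm), mulL2_fun_sub (hm.comp_add r) hm,
      mulL2_fun_sub (hm.comp_add (-r)) hm, lap_eq, lap_eq, mulL2_smul hm, mulL2_add hm,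
      mulL2_sub hm, mulL2_smul hm, diffQ, diffQ, shift_mulL2 hm, shift_mulL2 hm,
      mulL2_smul hm, mulL2_smul (hm.comp_add _), mulL2_smul hm, mulL2_smul (hm.comp_add _),
      mulL2_sub hm, mulL2_sub hm, mulL2_sub (hm.comp_add _), mulL2_sub (hm.comp_add _), inv_neg]
    simp only [← sub_eq_add_neg]
    module
  have h1 : ‖mulL2 (fun x => r⁻¹ * (g (x + r) - g x)) (diffQ r u)‖ ≤ K * ‖v‖ :=
    (norm_mulL2_le hp _).trans (mul_le_mul_of_nonneg_left (huv.norm_diffQ_le _) hK)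
  have h2 : ‖mulL2 (fun x => (-r)⁻¹ * (g (x + -r) - g x)) (diffQ (-r) u)‖ ≤ K * ‖v‖ :=
    (norm_mulL2_le hn _).trans (mul_le_mul_of_nonneg_left (huv.norm_diffQ_le _) hK)
  have h3 : ‖(r⁻¹ * r⁻¹) • mulL2 (fun x => g (x + r) + g (x - r) - 2 * g x) u‖ ≤
      2 * K * ‖u‖ := by
    rw [norm_smul, Real.norm_of_nonneg (mul_self_nonneg _)]
    calc _ ≤ (r⁻¹ * r⁻¹) * (2 * K * r ^ 2 * ‖u‖) :=
          mul_le_mul_of_nonneg_left (norm_mulL2_le hs u) (mul_self_nonneg _)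
      _ = _ := by field_simp
  rw [e]
  refine (norm_add₃_le).trans ?_
  linarith

/-- Integration by parts moves the derivative from `v` onto `g (lap r u)`, and self-adjointness of
`lap r` brings the resulting `(g (lap r v), u)` back to the original pairing up to a commutator. The
pairing therefore equals minus itself plus terms with at most one derivative of `u`, although it
formally involves two. It is applied with `g = a'`. -/
theorem inner_mulL2_lap_deriv_le {K : ℝ} {g : ℝ → ℝ} (hg : BddDeriv K 2 g) {r : ℝ} (hr : r ≠ 0)
    {u v : L2} (huv : HasD u v) :
    |inner ℝ (mulL2 g (lap r u)) v| ≤ 2 * K * (‖u‖ + ‖v‖) ^ 2 := by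
  have m0 : IsMul K g := hg.isMul_zero
  have m1 := hg.isMul (j := 1) (by norm_num)
  have m2 := hg.isMul (j := 2) le_rfl
  have d0 : ∀ x, HasDerivAt g (iteratedDeriv 1 g x) x := by
    simpa using fun x => hg.hasDerivAt (j := 0) (by norm_num) x
  have d1 : ∀ x, HasDerivAt (iteratedDeriv 1 g) (iteratedDeriv 2 g x) x :=
    fun x => hg.hasDerivAt (j := 1) (by norm_num) x
  have hK := m0.nonneg
  have e1 : inner ℝ (mulL2 g (lap r u)) v = - inner ℝ (mulL2 (iteratedDeriv 1 g) (lap r u)) u -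
      inner ℝ (mulL2 g (lap r v)) u := by
    have := (HasD.mulL2 m0 m1 d0 (huv.lap r)).inner_left huv
    rw [inner_add_left] at this
    linarith
  have e2 : inner ℝ (mulL2 g (lap r v)) u = inner ℝ (mulL2 g (lap r u)) v +
      inner ℝ v (lap r (mulL2 g u) - mulL2 g (lap r u)) := by
    rw [inner_mulL2_left m0, inner_lap_left, inner_sub_right,
      real_inner_comm (mulL2 g (lap r u)) v]
    ring
  have b1 : |inner ℝ (mulL2 (iteratedDeriv 1 g) (lap r u)) u| ≤ ‖v‖ * (K * (‖u‖ + ‖v‖)) := by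
    rw [inner_mulL2_left m1, lap, inner_diffQ_left, neg_neg, abs_neg]
    refine (abs_real_inner_le_norm _ _).trans (mul_le_mul (huv.norm_diffQ_le r) ?_
      (norm_nonneg _) (norm_nonneg _))
    refine ((HasD.mulL2 m1 m2 d1 huv).norm_diffQ_le r).trans ((norm_add_le _ _).trans ?_)
    have := norm_mulL2_le m1 v
    have := norm_mulL2_le m2 u
    linarith
  have b2 : |inner ℝ v (lap r (mulL2 g u) - mulL2 g (lap r u))| ≤
      ‖v‖ * (2 * K * (‖u‖ + ‖v‖)) :=
    (abs_real_inner_le_norm _ _).trans (mul_le_mul_of_nonneg_left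
      (norm_lap_mulL2_sub_le m0 d0 d1 m1.2 m2.2 hr huv) (norm_nonneg _))
  have b3 : ‖v‖ * (K * (‖u‖ + ‖v‖)) ≤ K * (‖u‖ + ‖v‖) ^ 2 := by
    have : 0 ≤ ‖u‖ * (K * (‖u‖ + ‖v‖)) := by positivity
    nlinarith
  rw [abs_le] at b1 b2 ⊢
  constructor <;> nlinarith [b1.1, b1.2, b2.1, b2.2]

/-! ### Translation invariant bounded operators -/

/-- `B` is linear, bounded by `C` and commutes with translations. -/
structure TransOp (C : ℝ) (B : L2 → L2) : Prop where
  map_add : ∀ u v, B (u + v) = B u + B v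
  map_smul : ∀ (r : ℝ) u, B (r • u) = r • B u
  norm_le : ∀ u, ‖B u‖ ≤ C * ‖u‖
  comm : ∀ y u, B (shift y u) = shift y (B u)

namespace TransOp

variable {C C' : ℝ} {B B' : L2 → L2}

theorem toCLM (h : TransOp C B) : ∃ L : L2 →L[ℝ] L2, ∀ u, L u = B u :=
  ⟨LinearMap.mkContinuous ⟨⟨B, h.map_add⟩, h.map_smul⟩ C h.norm_le, fun _ => rfl⟩

theorem continuous (h : TransOp C B) : Continuous B := by
  obtain ⟨L, hL⟩ := h.toCLM
  exact L.continuous.congr hL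

theorem map_sub (h : TransOp C B) (u v : L2) : B (u - v) = B u - B v := by
  obtain ⟨L, hL⟩ := h.toCLM
  rw [← hL, ← hL, ← hL, L.map_sub]

theorem hasD (h : TransOp C B) {u v : L2} (huv : HasD u v) : HasD (B u) (B v) := by
  obtain ⟨L, hL⟩ := h.toCLM
  rw [← hL, ← hL]
  exact huv.map L fun y w => by rw [hL, hL, h.comm]

theorem mono (h : TransOp C B) (hC : C ≤ C') : TransOp C' B :=
  { h with norm_le := fun u => (h.norm_le u).trans (by gcongr) }

theorem add (h : TransOp C B) (h' : TransOp C' B') : TransOp (C + C') (fun u => B u + B' u) where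
  map_add u v := by rw [h.map_add, h'.map_add]; abel
  map_smul r u := by rw [h.map_smul, h'.map_smul, smul_add]
  norm_le u := (norm_add_le _ _).trans (by linarith [h.norm_le u, h'.norm_le u])
  comm y u := by rw [h.comm, h'.comm, shift_add]

theorem smul (h : TransOp C B) (r : ℝ) : TransOp (|r| * C) (fun u => r • B u) where
  map_add u v := by rw [h.map_add, smul_add]
  map_smul s u := by rw [h.map_smul, smul_comm]
  norm_le u := by
    rw [norm_smul, mul_assoc]
    exact mul_le_mul_of_nonneg_left (h.norm_le u) (norm_nonneg _)
  comm y u := by rw [h.comm, shift_smul]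

theorem comp (h : TransOp C B) (h' : TransOp C' B') (hC : 0 ≤ C) :
    TransOp (C * C') (fun u => B (B' u)) where
  map_add u v := by rw [h'.map_add, h.map_add]
  map_smul r u := by rw [h'.map_smul, h.map_smul]
  norm_le u := (h.norm_le _).trans (by
    rw [mul_assoc]; exact mul_le_mul_of_nonneg_left (h'.norm_le u) hC)
  comm y u := by rw [h'.comm, h.comm]

theorem id : TransOp 1 (fun u => u) :=
  ⟨fun _ _ => rfl, fun _ _ => rfl, fun u => by rw [one_mul], fun _ _ => rfl⟩

theorem shift (y : ℝ) : TransOp 1 (shift y) where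
  map_add := shift_add y
  map_smul := shift_smul y
  norm_le u := by simp
  comm z u := by rw [shift_shift, shift_shift, add_comm]

theorem sum {ι : Type*} {s : Finset ι} {C : ι → ℝ} {B : ι → L2 → L2}
    (h : ∀ i ∈ s, TransOp (C i) (B i)) : TransOp (∑ i ∈ s, C i) (fun u => ∑ i ∈ s, B i u) where
  map_add u v := by
    rw [← Finset.sum_add_distrib]
    exact Finset.sum_congr rfl fun i hi => (h i hi).map_add u v
  map_smul r u := by
    rw [Finset.smul_sum]
    exact Finset.sum_congr rfl fun i hi => (h i hi).map_smul r u
  norm_le u := by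
    rw [Finset.sum_mul]
    exact norm_sum_le_of_le _ fun i hi => (h i hi).norm_le u
  comm y u := by
    rw [← shiftL_apply y (∑ i ∈ s, B i u), map_sum]
    exact Finset.sum_congr rfl fun i hi => (h i hi).comm y u

theorem integral {ρ : Measure ℝ} {C : ℝ → ℝ} {B : ℝ → L2 → L2} (h : ∀ z, TransOp (C z) (B z))
    (hC : Integrable C ρ) (hB : ∀ u, AEStronglyMeasurable (fun z => B z u) ρ) :
    TransOp (∫ z, C z ∂ρ) (fun u => ∫ z, B z u ∂ρ) := by
  have hi : ∀ u, Integrable (fun z => B z u) ρ := fun u =>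
    (hC.mul_const ‖u‖).mono' (hB u) (ae_of_all _ fun z => (h z).norm_le u)
  refine ⟨fun u v => ?_, fun r u => ?_, fun u => ?_, fun y u => ?_⟩
  · rw [← integral_add (hi u) (hi v)]
    simp only [(h _).map_add]
  · rw [← integral_smul]
    simp only [(h _).map_smul]
  · rw [← integral_mul_const]
    exact norm_integral_le_of_norm_le (hC.mul_const _) (ae_of_all _ fun z => (h z).norm_le u)
  · rw [← shiftL_apply y (∫ z, B z u ∂ρ)]
    refine Eq.trans ?_ ((shiftL y).toContinuousLinearMap.integral_comp_comm (hi u))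
    exact integral_congr_ae (ae_of_all _ fun z => (h z).comm y u)

end TransOp

/-! ### The cells -/

/-- The index of the cell containing `z`. -/
def cellIdx (h z : ℝ) : ℤ := if 0 < z then ⌈z / h⌉ else ⌊z / h⌋

theorem mem_cell_iff {h : ℝ} (hh : 0 < h) {k : ℤ} {z : ℝ} :
    z ∈ cell h k ↔ z ≠ 0 ∧ cellIdx h z = k := by
  rcases lt_trichotomy k 0 with hk | rfl | hk
  · rw [cell, if_neg hk.not_gt, if_pos hk, mem_Ico]
    have hk' : ((k : ℝ) + 1) ≤ 0 := by exact_mod_cast hk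
    constructor
    · rintro ⟨h1, h2⟩
      have hz : z < 0 := h2.trans_le (mul_nonpos_of_nonpos_of_nonneg hk' hh.le)
      refine ⟨hz.ne, ?_⟩
      rw [cellIdx, if_neg hz.not_gt, Int.floor_eq_iff, le_div_iff₀ hh, div_lt_iff₀ hh]
      exact ⟨h1, h2⟩
    · rintro ⟨h1, h2⟩
      rw [cellIdx] at h2
      split_ifs at h2 with hz
      · have : 0 ≤ ⌈z / h⌉ := Int.ceil_nonneg (by positivity)
        omega
      · rwa [Int.floor_eq_iff, le_div_iff₀ hh, div_lt_iff₀ hh] at h2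
  · simp only [cell, lt_irrefl, if_false, mem_empty_iff_false, false_iff, not_and]
    intro hz h0
    rw [cellIdx] at h0
    split_ifs at h0 with h1
    · have : 0 < ⌈z / h⌉ := Int.ceil_pos.2 (by positivity)
      omega
    · have h2 : z < 0 := lt_of_le_of_ne (not_lt.1 h1) hz
      have : ⌊z / h⌋ < 0 := Int.floor_lt.2 (by simpa using div_neg_of_neg_of_pos h2 hh)
      omega
  · rw [cell, if_pos hk, mem_Ioc]
    have hk' : 0 ≤ (k : ℝ) - 1 := by
      have : (1 : ℝ) ≤ k := by exact_mod_cast hk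
      linarith
    constructor
    · rintro ⟨h1, h2⟩
      have hz : 0 < z := (mul_nonneg hk' hh.le).trans_lt h1
      refine ⟨hz.ne', ?_⟩
      rw [cellIdx, if_pos hz, Int.ceil_eq_iff, lt_div_iff₀ hh, div_le_iff₀ hh]
      exact ⟨h1, h2⟩
    · rintro ⟨h1, h2⟩
      rw [cellIdx] at h2
      split_ifs at h2 with hz
      · rwa [Int.ceil_eq_iff, lt_div_iff₀ hh, div_le_iff₀ hh] at h2
      · have : ⌊z / h⌋ ≤ 0 := by
          have : z / h ≤ 0 := div_nonpos_of_nonpos_of_nonneg (not_lt.1 hz) hh.le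
          have := (Int.floor_le (z / h)).trans this
          exact_mod_cast this
        omega

theorem measurableSet_cell (h : ℝ) (k : ℤ) : MeasurableSet (cell h k) := by
  unfold cell
  split_ifs <;> simp

theorem measurable_cellIdx (h : ℝ) : Measurable (cellIdx h) := by
  unfold cellIdx
  refine Measurable.ite measurableSet_Ioi ?_ ?_
  · exact Int.measurable_ceil.comp (measurable_id.div_const h)
  · exact Int.measurable_floor.comp (measurable_id.div_const h)

theorem disjoint_cell {h : ℝ} (hh : 0 < h) {k l : ℤ} (hkl : k ≠ l) :
    Disjoint (cell h k) (cell h l) := by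
  rw [Set.disjoint_left]
  intro z hz hz'
  rw [mem_cell_iff hh] at hz hz'
  exact hkl (hz.2.symm.trans hz'.2)

theorem cellIdx_ne_zero {h : ℝ} (hh : 0 < h) {z : ℝ} (hz : z ≠ 0) : cellIdx h z ≠ 0 := by
  intro h0
  have : z ∈ cell h 0 := (mem_cell_iff hh).2 ⟨hz, h0⟩
  simp [cell] at this

theorem abs_cell_sub_le {h : ℝ} {k : ℤ} {z : ℝ} (hz : z ∈ cell h k) : |h * k - z| ≤ h := by
  unfold cell at hz
  rw [abs_le]
  split_ifs at hz
  · constructor <;> nlinarith [hz.1, hz.2]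
  · constructor <;> nlinarith [hz.1, hz.2]
  · exact hz.elim

/-- Since `1 / h` is the integer `n`, the points `±1` lie on the mesh and rounding away from the
origin never crosses them. The cells therefore split exactly into small and large jumps. -/
theorem cellIdx_mem_indexA_iff {n : ℕ} (hn : 1 ≤ n) {z : ℝ} (hz : z ≠ 0) :
    cellIdx (1 / (n : ℝ)) z ∈ indexA (1 / (n : ℝ)) ↔ |z| ≤ 1 := by
  have hn0 : (0 : ℝ) < n := by exact_mod_cast hn
  have hh : 0 < 1 / (n : ℝ) := by positivity
  have e : (1 : ℝ) / (1 / (n : ℝ)) = n := by rw [one_div_one_div]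
  have e2 : z / (1 / (n : ℝ)) = z * n := by rw [div_div_eq_mul_div, div_one]
  rw [mem_indexA, e, and_iff_left (cellIdx_ne_zero hh hz), cellIdx, e2]
  split_ifs with h0
  · have h1 : 0 ≤ ⌈z * n⌉ := Int.ceil_nonneg (by positivity)
    rw [abs_of_nonneg (by exact_mod_cast h1), abs_of_pos h0]
    have : ((⌈z * n⌉ : ℤ) : ℝ) ≤ n ↔ ⌈z * n⌉ ≤ (n : ℤ) := by exact_mod_cast Iff.rfl
    rw [this, Int.ceil_le, Int.cast_natCast]
    constructor <;> intro h <;> nlinarith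
  · have h1 : z < 0 := lt_of_le_of_ne (not_lt.1 h0) hz
    have h2 : ⌊z * n⌋ ≤ 0 := by
      have := (Int.floor_le (z * n)).trans (mul_nonpos_of_nonpos_of_nonneg h1.le hn0.le)
      exact_mod_cast this
    rw [abs_of_nonpos (by exact_mod_cast h2), abs_of_neg h1, neg_le]
    have : (-(n : ℝ)) ≤ ((⌊z * n⌋ : ℤ) : ℝ) ↔ (-(n : ℤ)) ≤ ⌊z * n⌋ := by
      rw [← Int.cast_le (R := ℝ)]; simp
    rw [this, Int.le_floor]
    push_cast
    constructor <;> intro h <;> nlinarith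

theorem iUnion_cell_indexB {n : ℕ} (hn : 1 ≤ n) :
    ⋃ k : indexB (1 / (n : ℝ)), cell (1 / (n : ℝ)) k = {z : ℝ | 1 < |z|} := by
  have hh : 0 < 1 / (n : ℝ) := by have : (0 : ℝ) < n := by exact_mod_cast hn
                                  positivity
  ext z
  simp only [mem_iUnion, mem_ofPred_eq]
  constructor
  · rintro ⟨⟨k, hk⟩, hz⟩
    obtain ⟨h0, h1⟩ := (mem_cell_iff hh).1 hz
    have := hk.1
    simp only at h1
    rw [← h1, cellIdx_mem_indexA_iff hn h0] at this
    exact not_le.1 this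
  · intro hz
    have h0 : z ≠ 0 := by rintro rfl; norm_num at hz
    exact ⟨⟨cellIdx _ z, by rw [cellIdx_mem_indexA_iff hn h0]; exact not_le.2 hz,
      cellIdx_ne_zero hh h0⟩, (mem_cell_iff hh).2 ⟨h0, rfl⟩⟩

theorem biUnion_cell_indexA {n : ℕ} (hn : 1 ≤ n) :
    ⋃ k ∈ indexA (1 / (n : ℝ)), cell (1 / (n : ℝ)) k = {z : ℝ | |z| ≤ 1} \ {0} := by
  have hh : 0 < 1 / (n : ℝ) := by have : (0 : ℝ) < n := by exact_mod_cast hn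
                                  positivity
  ext z
  simp only [mem_iUnion, mem_ofPred_eq, Set.mem_sdiff, mem_singleton_iff, exists_prop]
  constructor
  · rintro ⟨k, hk, hz⟩
    obtain ⟨h0, h1⟩ := (mem_cell_iff hh).1 hz
    rw [← h1, cellIdx_mem_indexA_iff hn h0] at hk
    exact ⟨hk, h0⟩
  · rintro ⟨hz, h0⟩
    exact ⟨cellIdx _ z, by rwa [cellIdx_mem_indexA_iff hn h0], (mem_cell_iff hh).2 ⟨h0, rfl⟩⟩

/-! ### Lévy measures -/

/-- `ν` has no atom at `0`, mass `μ₀` outside `[-1, 1]` and second moment `μ₂` inside. -/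
structure LevyMoments (ν : Measure ℝ) (μ₀ μ₂ : ℝ≥0) : Prop where
  zero : ν {0} = 0
  large : ν {z : ℝ | 1 < |z|} = μ₀
  small : ∫⁻ z in {z : ℝ | |z| ≤ 1}, ENNReal.ofReal (z ^ 2) ∂ν = μ₂

section

variable {ν : Measure ℝ} {μ₀ μ₂ : ℝ≥0}

theorem LevyMoments.isFiniteMeasure (hν : LevyMoments ν μ₀ μ₂) :
    IsFiniteMeasure (ν.restrict {z : ℝ | 1 < |z|}) :=
  ⟨by rw [Measure.restrict_apply_univ, hν.large]; exact ENNReal.coe_lt_top⟩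

theorem LevyMoments.integrableOn_sq (hν : LevyMoments ν μ₀ μ₂) :
    IntegrableOn (fun z : ℝ => z ^ 2) {z : ℝ | |z| ≤ 1} ν := by
  refine ⟨(by fun_prop : Measurable fun z : ℝ => z ^ 2).aestronglyMeasurable, ?_⟩
  rw [hasFiniteIntegral_iff_ofReal (ae_of_all _ fun z => sq_nonneg z), hν.small]
  exact ENNReal.coe_lt_top

theorem LevyMoments.integral_sq (hν : LevyMoments ν μ₀ μ₂) :
    ∫ z in {z : ℝ | |z| ≤ 1}, z ^ 2 ∂ν = μ₂ := by
  rw [integral_eq_lintegral_of_nonneg_ae (ae_of_all _ fun z => sq_nonneg z)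
    (by fun_prop : Measurable fun z : ℝ => z ^ 2).aestronglyMeasurable, hν.small]
  rfl

theorem LevyMoments.integral_one (hν : LevyMoments ν μ₀ μ₂) :
    ∫ _z in {z : ℝ | 1 < |z|}, (1 : ℝ) ∂ν = μ₀ := by
  simp [Measure.real, hν.large]

theorem measurableSet_large : MeasurableSet {z : ℝ | 1 < |z|} :=
  measurableSet_lt measurable_const measurable_norm

/-! ### The large jumps -/

/-- The jump operator for jump sizes `σ z`, `|z| > 1`. -/
def largeJump (ν : Measure ℝ) (σ : ℝ → ℝ) (u : L2) : L2 :=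
  ∫ z in {z : ℝ | 1 < |z|}, (shift (σ z) u - u) ∂ν

theorem aestronglyMeasurable_shift {ρ : Measure ℝ} {σ : ℝ → ℝ} (hσ : Measurable σ) (u : L2) :
    AEStronglyMeasurable (fun z => shift (σ z) u) ρ :=
  ((continuous_shift u).stronglyMeasurable.comp_measurable hσ).aestronglyMeasurable

theorem integrable_largeJump (hν : LevyMoments ν μ₀ μ₂) {σ : ℝ → ℝ} (hσ : Measurable σ) (u : L2) :
    Integrable (fun z => shift (σ z) u - u) (ν.restrict {z : ℝ | 1 < |z|}) := by
  have := hν.isFiniteMeasure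
  refine Integrable.of_bound (C := 2 * ‖u‖)
    ((aestronglyMeasurable_shift hσ u).sub aestronglyMeasurable_const) (ae_of_all _ fun z => ?_)
  refine (norm_sub_le _ _).trans ?_
  rw [norm_shift]; linarith

theorem transOp_largeJump (hν : LevyMoments ν μ₀ μ₂) {σ : ℝ → ℝ} (hσ : Measurable σ) :
    TransOp (2 * μ₀) (largeJump ν σ) := by
  have := hν.isFiniteMeasure
  have h := TransOp.integral (ρ := ν.restrict {z : ℝ | 1 < |z|}) (C := fun _ => 2)
    (B := fun z u => shift (σ z) u - u)
    (fun z => by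
      have := (TransOp.shift (σ z)).add (TransOp.id.smul (-1))
      norm_num at this
      simpa [sub_eq_add_neg] using this)
    (integrable_const _) (fun u => (integrable_largeJump hν hσ u).1)
  refine h.mono (le_of_eq ?_)
  rw [← hν.integral_one, ← integral_const_mul, mul_one]

/-- Translations are isometries, so Cauchy-Schwarz makes each jump dissipative, whatever its size.
With `σ` general this serves both the exact and the rounded jumps. -/
theorem inner_largeJump_nonpos (hν : LevyMoments ν μ₀ μ₂) {σ : ℝ → ℝ} (hσ : Measurable σ) (u : L2) :
    inner ℝ (largeJump ν σ u) u ≤ 0 := by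
  rw [real_inner_comm]
  refine ((innerSL ℝ u).integral_comp_comm (integrable_largeJump hν hσ u)).symm.trans_le ?_
  refine integral_nonpos fun z => ?_
  simp only [innerSL_apply_apply, inner_sub_right, real_inner_self_eq_norm_sq, Pi.zero_apply]
  have := real_inner_le_norm u (shift (σ z) u)
  rw [norm_shift] at this
  nlinarith

theorem norm_largeJump_sub_le (hν : LevyMoments ν μ₀ μ₂) {σ τ : ℝ → ℝ} (hσ : Measurable σ)
    (hτ : Measurable τ) {u v : L2} (huv : HasD u v) {r : ℝ}
    (hr : ∀ z : ℝ, 1 < |z| → |σ z - τ z| ≤ r) :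
    ‖largeJump ν σ u - largeJump ν τ u‖ ≤ μ₀ * (r * ‖v‖) := by
  have := hν.isFiniteMeasure
  rw [largeJump, largeJump,
    ← integral_sub (integrable_largeJump hν hσ u) (integrable_largeJump hν hτ u)]
  refine (norm_integral_le_of_norm_le (integrable_const (r * ‖v‖)) ?_).trans (le_of_eq ?_)
  · refine (ae_restrict_iff' measurableSet_large).2 (ae_of_all _ fun z hz => ?_)
    have e : shift (σ z) u - u - (shift (τ z) u - u) =
        shift (τ z) (shift (σ z - τ z) u - u) := by
      rw [shift_sub, shift_shift, add_sub_cancel]; abel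
    rw [e, norm_shift]
    exact (huv.norm_shift_sub_le _).trans (mul_le_mul_of_nonneg_right (hr z hz) (norm_nonneg _))
  · simp [Measure.real, hν.large]

/-- The rounded jump is constant on each cell, so countable additivity over the disjoint cells turns
the series into an integral. -/
theorem opJ2h_eq (hν : LevyMoments ν μ₀ μ₂) {n : ℕ} (hn : 1 ≤ n) (u : L2) :
    opJ2h ν (1 / (n : ℝ)) u =
      largeJump ν (fun z => 1 / (n : ℝ) * cellIdx (1 / (n : ℝ)) z) u := by
  have hh : 0 < 1 / (n : ℝ) := by have : (0 : ℝ) < n := by exact_mod_cast hn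
                                  positivity
  have hσ : Measurable fun z => 1 / (n : ℝ) * (cellIdx (1 / (n : ℝ)) z : ℝ) :=
    (measurable_from_top.comp (measurable_cellIdx _)).const_mul _
  have hi := integrable_largeJump hν hσ u
  have hs := hasSum_integral_iUnion (μ := ν) (f := fun z =>
      shift (1 / (n : ℝ) * cellIdx (1 / (n : ℝ)) z) u - u)
    (s := fun k : indexB (1 / (n : ℝ)) => cell (1 / (n : ℝ)) k)
    (fun k => measurableSet_cell _ _)
    (fun k l hkl => disjoint_cell hh fun h => hkl (Subtype.ext h))
    (by rw [iUnion_cell_indexB hn]; exact hi)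
  rw [iUnion_cell_indexB hn] at hs
  rw [opJ2h, largeJump, ← hs.tsum_eq]
  refine tsum_congr fun k => ?_
  rw [setIntegral_congr_fun (measurableSet_cell _ _)
    (g := fun _ => shift (1 / (n : ℝ) * ((k : ℤ) : ℝ)) u - u)
    fun z hz => by simp only [((mem_cell_iff hh).1 hz).2]]
  rw [setIntegral_const]

end

section

variable {ν : Measure ℝ} {μ₀ μ₂ : ℝ≥0}

/-! ### The small jumps -/

/-- The average `∫_0^1 (1 - θ) u(· + θ z) dθ`. -/
def taylorAvg (z : ℝ) (u : L2) : L2 := ∫ θ in (0 : ℝ)..1, (1 - θ) • shift (θ * z) u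

/-- `∫_{|z| ≤ 1} z² ∫_0^1 (1 - θ) u(· + θ z) dθ ν(dz)`. -/
def smallJump (ν : Measure ℝ) (u : L2) : L2 := ∫ z in {z : ℝ | |z| ≤ 1}, z ^ 2 • taylorAvg z u ∂ν

/-- The Riemann sum replacing `taylorAvg` on the `k`-th cell. -/
def taylorSum (h : ℝ) (k : ℤ) (u : L2) : L2 :=
  ∑ l ∈ Finset.range k.natAbs, theta k l • shift ((k / |(k : ℝ)|) * l * h) u

/-- The discretization of `smallJump`. -/
def discSmallJump (ν : Measure ℝ) (h : ℝ) (u : L2) : L2 :=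
  ∑ k ∈ indexA h, zeta ν h k • taylorSum h k u

theorem opJ1h_eq (ν : Measure ℝ) (h : ℝ) (u : L2) : opJ1h ν h u = discSmallJump ν h (lap h u) :=
  rfl

theorem continuous_smul_shift (z : ℝ) (u : L2) :
    Continuous fun θ : ℝ => (1 - θ) • shift (θ * z) u :=
  (continuous_const.sub continuous_id).smul
    ((continuous_shift u).comp (continuous_id.mul continuous_const))

theorem continuous_taylorAvg (u : L2) : Continuous fun z => taylorAvg z u := by
  refine intervalIntegral.continuous_parametric_intervalIntegral_of_continuous' ?_ 0 1
  exact (continuous_const.sub continuous_snd).smul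
    ((continuous_shift u).comp (continuous_snd.mul continuous_fst))

theorem transOp_taylorAvg (z : ℝ) : TransOp 1 (taylorAvg z) := by
  have h := TransOp.integral (ρ := (volume : Measure ℝ).restrict (Ioc 0 1))
    (C := fun θ => |1 - θ| * 1) (B := fun θ u => (1 - θ) • shift (θ * z) u)
    (fun θ => (TransOp.shift (θ * z)).smul (1 - θ))
    (((by fun_prop : Continuous fun θ : ℝ => |1 - θ| * 1).integrableOn_Icc).mono_set
      Ioc_subset_Icc_self)
    (fun u => (continuous_smul_shift z u).aestronglyMeasurable)
  have e : taylorAvg z = fun u => ∫ θ in Ioc (0 : ℝ) 1, (1 - θ) • shift (θ * z) u := by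
    funext u
    rw [taylorAvg, intervalIntegral.integral_of_le zero_le_one]
  rw [e]
  refine h.mono ?_
  rw [← intervalIntegral.integral_of_le zero_le_one]
  have := intervalIntegral.integral_mono_on (μ := volume) (a := 0) (b := 1)
    (f := fun θ : ℝ => |1 - θ| * 1) (g := fun _ => 1) zero_le_one
    ((by fun_prop : Continuous fun θ : ℝ => |1 - θ| * 1).intervalIntegrable _ _)
    intervalIntegrable_const (fun θ hθ => by
      rw [mul_one, abs_of_nonneg (by linarith [hθ.2])]; linarith [hθ.1])
  simpa using this

theorem aestronglyMeasurable_smallJump (u : L2) :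
    AEStronglyMeasurable (fun z => z ^ 2 • taylorAvg z u) (ν.restrict {z : ℝ | |z| ≤ 1}) :=
  ((continuous_id.pow 2).smul (continuous_taylorAvg u)).aestronglyMeasurable

theorem integrable_smallJump (hν : LevyMoments ν μ₀ μ₂) (u : L2) :
    Integrable (fun z => z ^ 2 • taylorAvg z u) (ν.restrict {z : ℝ | |z| ≤ 1}) := by
  refine (hν.integrableOn_sq.integrable.mul_const ‖u‖).mono' (aestronglyMeasurable_smallJump u)
    (ae_of_all _ fun z => ?_)
  rw [norm_smul, Real.norm_of_nonneg (sq_nonneg z)]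
  gcongr
  simpa using (transOp_taylorAvg z).norm_le u

theorem transOp_smallJump (hν : LevyMoments ν μ₀ μ₂) : TransOp μ₂ (smallJump ν) := by
  have h := TransOp.integral (ρ := ν.restrict {z : ℝ | |z| ≤ 1}) (C := fun z => |z ^ 2| * 1)
    (B := fun z u => z ^ 2 • taylorAvg z u) (fun z => (transOp_taylorAvg z).smul (z ^ 2))
    (by simpa using hν.integrableOn_sq.integrable) aestronglyMeasurable_smallJump
  refine h.mono (le_of_eq ?_)
  simpa using hν.integral_sq

theorem inner_smallJump (hν : LevyMoments ν μ₀ μ₂) (u v : L2) :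
    inner ℝ (smallJump ν u) v = ∫ z in {z : ℝ | |z| ≤ 1},
      (∫ θ in (0 : ℝ)..1, (1 - θ) * z ^ 2 * inner ℝ (shift (θ * z) u) v) ∂ν := by
  rw [real_inner_comm]
  refine ((innerSL ℝ v).integral_comp_comm (integrable_smallJump hν u)).symm.trans ?_
  refine integral_congr_ae (ae_of_all _ fun z => ?_)
  simp only [innerSL_apply_apply, inner_smul_right]
  have e := (innerSL ℝ v).intervalIntegral_comp_comm
    ((continuous_smul_shift z u).intervalIntegrable (μ := volume) 0 1)
  simp only [innerSL_apply_apply, inner_smul_right] at e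
  rw [taylorAvg, ← e, ← intervalIntegral.integral_const_mul]
  refine intervalIntegral.integral_congr fun θ _ => ?_
  simp only [real_inner_comm v]
  ring

/-- Linearity of the weights in `l` is what makes the summation by parts in `inner_opJ1h_nonpos`
leave only end terms. -/
theorem theta_eq {k : ℤ} (hk : k ≠ 0) (l : ℕ) :
    theta k l = (|(k : ℝ)|⁻¹ - |(k : ℝ)|⁻¹ ^ 2 / 2) - |(k : ℝ)|⁻¹ ^ 2 * l := by
  have h0 : |(k : ℝ)| ≠ 0 := by simpa using hk
  rw [theta, intervalIntegral.integral_sub intervalIntegrable_const intervalIntegral.intervalIntegrable_id]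
  simp only [intervalIntegral.integral_const, integral_id, smul_eq_mul]
  field_simp
  ring

theorem zeta_nonneg (ν : Measure ℝ) (h : ℝ) (k : ℤ) : 0 ≤ zeta ν h k :=
  integral_nonneg fun z => sq_nonneg z

theorem natAbs_cast_eq (k : ℤ) : ((k.natAbs : ℕ) : ℝ) = |(k : ℝ)| := by
  rw [← Int.cast_abs, Int.abs_eq_natAbs, Int.cast_natCast]

theorem transOp_discSmallJump (ν : Measure ℝ) (h : ℝ) :
    ∃ C, 0 ≤ C ∧ TransOp C (discSmallJump ν h) := by
  refine ⟨_, ?_, TransOp.sum fun k _ => (TransOp.sum fun l _ =>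
    (TransOp.shift _).smul _).smul _⟩
  positivity

theorem cell_subset_small {n : ℕ} (hn : 1 ≤ n) {k : ℤ} (hk : k ∈ indexA (1 / (n : ℝ))) :
    cell (1 / (n : ℝ)) k ⊆ {z : ℝ | |z| ≤ 1} := by
  intro z hz
  have : z ∈ ⋃ k ∈ indexA (1 / (n : ℝ)), cell (1 / (n : ℝ)) k := mem_biUnion hk hz
  rw [biUnion_cell_indexA hn] at this
  exact this.1

/-- Split `[0, 1]` into `|k|` equal intervals. On the `l`-th one the node `s_k l h` is within `h` of
`θ z`, so the integrands differ by at most `‖v - u‖ + η`, and the interval lengths add up to one. -/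
theorem norm_taylorSum_sub_le {h : ℝ} (hh : 0 < h) {k : ℤ} (hk : k ≠ 0) {z : ℝ}
    (hz : z ∈ cell h k) {u v : L2} {η : ℝ} (hη : ∀ r, |r| ≤ h → ‖shift r u - u‖ ≤ η) :
    ‖taylorSum h k v - taylorAvg z u‖ ≤ ‖v - u‖ + η := by
  have hN : 0 < |(k : ℝ)| := by simpa using hk
  have hη0 : 0 ≤ η := (norm_nonneg _).trans (hη 0 (by simpa using hh.le))
  have hi := fun a b => (continuous_smul_shift z u).intervalIntegrable (μ := volume) a b
  have e1 : taylorAvg z u = ∑ l ∈ Finset.range k.natAbs,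
      ∫ θ in ((l : ℝ) / |(k : ℝ)|)..(((l : ℝ) + 1) / |(k : ℝ)|), (1 - θ) • shift (θ * z) u := by
    have := intervalIntegral.sum_integral_adjacent_intervals (μ := volume)
      (f := fun θ => (1 - θ) • shift (θ * z) u)
      (a := fun l : ℕ => (l : ℝ) / |(k : ℝ)|) (n := k.natAbs) (fun l _ => hi _ _)
    simp only [Nat.cast_add, Nat.cast_one, Nat.cast_zero, zero_div] at this
    rw [this, natAbs_cast_eq, div_self hN.ne', taylorAvg]
  have e2 : ∀ l : ℕ, theta k l • shift ((k / |(k : ℝ)|) * l * h) v =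
      ∫ θ in ((l : ℝ) / |(k : ℝ)|)..(((l : ℝ) + 1) / |(k : ℝ)|),
        (1 - θ) • shift ((k / |(k : ℝ)|) * l * h) v := fun l => by
    rw [theta, intervalIntegral.integral_smul_const]
  have hs : ((k : ℝ) / |(k : ℝ)|) = 1 ∧ (|(k : ℝ)| - 1) * h ≤ z ∧ z ≤ |(k : ℝ)| * h ∨
      ((k : ℝ) / |(k : ℝ)|) = -1 ∧ (|(k : ℝ)| - 1) * h ≤ -z ∧ -z ≤ |(k : ℝ)| * h := by
    unfold cell at hz
    split_ifs at hz with h1 h2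
    · have h1' : (0 : ℝ) < k := by exact_mod_cast h1
      rw [abs_of_pos h1', div_self h1'.ne']
      exact Or.inl ⟨rfl, hz.1.le, hz.2⟩
    · have h2' : (k : ℝ) < 0 := by exact_mod_cast h2
      rw [abs_of_neg h2', div_neg, div_self h2'.ne]
      exact Or.inr ⟨rfl, by linarith [hz.2], by linarith [hz.1]⟩
    · exact hz.elim
  have key : ∀ l ∈ Finset.range k.natAbs, ∀ θ ∈ Ioc ((l : ℝ) / |(k : ℝ)|) (((l : ℝ) + 1) / |(k : ℝ)|),
      ‖(1 - θ) • shift ((k / |(k : ℝ)|) * l * h) v - (1 - θ) • shift (θ * z) u‖ ≤ ‖v - u‖ + η := by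
    intro l hl θ hθ
    have hl' : (l : ℝ) + 1 ≤ |(k : ℝ)| := by
      rw [← natAbs_cast_eq]
      exact_mod_cast Finset.mem_range.1 hl
    have hl0 : (0 : ℝ) ≤ l := Nat.cast_nonneg l
    have t1 : (l : ℝ) ≤ θ * |(k : ℝ)| := (div_le_iff₀ hN).1 hθ.1.le
    have t2 : θ * |(k : ℝ)| ≤ l + 1 := (le_div_iff₀ hN).1 hθ.2
    have t0 : 0 ≤ θ := le_trans (by positivity) hθ.1.le
    have t3 : θ ≤ 1 := hθ.2.trans ((div_le_one hN).2 hl')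
    -- With `w = |z|` between `(|k| - 1) h` and `|k| h`, and `θ |k|` between `l` and `l + 1`, the
    -- product `θ w` lies between `l h - θ h` and `(l + 1) h`; moreover `θ ≤ 1`.
    have hd : |(k / |(k : ℝ)|) * l * h - θ * z| ≤ h := by
      have a1 : ∀ w : ℝ, (|(k : ℝ)| - 1) * h ≤ w → w ≤ |(k : ℝ)| * h → |l * h - θ * w| ≤ h := by
        intro w h1 h2
        have b1 : θ * w ≤ θ * (|(k : ℝ)| * h) := by gcongr
        have b2 : θ * ((|(k : ℝ)| - 1) * h) ≤ θ * w := by gcongr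
        have b3 : (θ * |(k : ℝ)|) * h ≤ (l + 1) * h := by gcongr
        have b4 : l * h ≤ (θ * |(k : ℝ)|) * h := by gcongr
        have b5 : θ * h ≤ 1 * h := by gcongr
        rw [abs_le]
        constructor <;> linarith
      rcases hs with ⟨s1, s2, s3⟩ | ⟨s1, s2, s3⟩
      · rw [s1, one_mul]
        exact a1 z s2 s3
      · rw [s1]
        have := a1 (-z) s2 s3
        rw [← abs_neg] at this
        convert this using 2
        ring
    have e3 : (1 - θ) • shift ((k / |(k : ℝ)|) * l * h) v - (1 - θ) • shift (θ * z) u =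
        (1 - θ) • (shift ((k / |(k : ℝ)|) * l * h) (v - u) +
          shift (θ * z) (shift ((k / |(k : ℝ)|) * l * h - θ * z) u - u)) := by
      rw [shift_sub, shift_sub, shift_shift, add_sub_cancel]
      module
    rw [e3, norm_smul, Real.norm_of_nonneg (by linarith)]
    calc _ ≤ 1 * (‖v - u‖ + η) := by
          refine mul_le_mul (by linarith) ?_ (norm_nonneg _) zero_le_one
          refine (norm_add_le _ _).trans ?_
          rw [norm_shift, norm_shift]
          gcongr
          exact hη _ hd
      _ = _ := one_mul _
  rw [e1, taylorSum, ← Finset.sum_sub_distrib]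
  calc _ ≤ ∑ l ∈ Finset.range k.natAbs, (‖v - u‖ + η) * |(k : ℝ)|⁻¹ := by
        refine norm_sum_le_of_le _ fun l hl => ?_
        rw [e2, ← intervalIntegral.integral_sub
          ((by fun_prop : Continuous fun θ : ℝ =>
            (1 - θ) • shift ((k / |(k : ℝ)|) * l * h) v).intervalIntegrable _ _) (hi _ _)]
        have hle : (l : ℝ) / |(k : ℝ)| ≤ ((l : ℝ) + 1) / |(k : ℝ)| := by gcongr; linarith
        have := intervalIntegral.norm_integral_le_of_norm_le_const
          (f := fun θ => (1 - θ) • shift ((k / |(k : ℝ)|) * l * h) v - (1 - θ) • shift (θ * z) u)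
          (C := ‖v - u‖ + η) (a := (l : ℝ) / |(k : ℝ)|) (b := ((l : ℝ) + 1) / |(k : ℝ)|)
          (by rw [uIoc_of_le hle]; exact key l hl)
        refine this.trans (le_of_eq ?_)
        rw [← sub_div, add_sub_cancel_left, abs_of_nonneg (by positivity), one_div]
    _ = _ := by
        rw [Finset.sum_const, Finset.card_range, nsmul_eq_mul, natAbs_cast_eq]
        field_simp

/-- The cellwise comparison integrated against `z² ν(dz)`. Keeping `v` separate from `u` allows two
uses: `v = lap h w` for consistency, and `v` a difference quotient in
`inner_smallJump_deriv_nonneg`. The modulus `η` is `O(h)` in the first and merely small in the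
second. -/
theorem norm_discSmallJump_sub_le (hν : LevyMoments ν μ₀ μ₂) {n : ℕ} (hn : 1 ≤ n) {u v : L2}
    {η : ℝ} (hη : ∀ r, |r| ≤ 1 / (n : ℝ) → ‖shift r u - u‖ ≤ η) :
    ‖discSmallJump ν (1 / (n : ℝ)) v - smallJump ν u‖ ≤ μ₂ * (‖v - u‖ + η) := by
  have hh : 0 < 1 / (n : ℝ) := by have : (0 : ℝ) < n := by exact_mod_cast hn
                                  positivity
  set h : ℝ := 1 / (n : ℝ) with hdef
  -- The cells miss the origin, which `ν` does not charge.
  have hset : ({z : ℝ | |z| ≤ 1} \ {0} : Set ℝ) =ᵐ[ν] {z : ℝ | |z| ≤ 1} :=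
    sdiff_null_ae_eq_self hν.zero
  have hci : ∀ k ∈ indexA h, IntegrableOn (fun z => z ^ 2 • taylorSum h k v) (cell h k) ν :=
    fun k hk => (hν.integrableOn_sq.mono_set (cell_subset_small hn hk)).smul_const _
  have hi1 : ∀ k ∈ indexA h, IntegrableOn (fun z => z ^ 2 • taylorSum h (cellIdx h z) v)
      (cell h k) ν := fun k hk => (hci k hk).congr_fun
      (fun z hz => by simp only [((mem_cell_iff hh).1 hz).2]) (measurableSet_cell h k)
  have e1 : discSmallJump ν h v =
      ∫ z in {z : ℝ | |z| ≤ 1}, z ^ 2 • taylorSum h (cellIdx h z) v ∂ν := by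
    rw [← setIntegral_congr_set hset, ← biUnion_cell_indexA hn,
      integral_biUnion_finset _ (fun k _ => measurableSet_cell h k)
        (fun k _ l _ hkl => disjoint_cell hh hkl) hi1]
    refine Finset.sum_congr rfl fun k _ => ?_
    rw [zeta, ← integral_smul_const]
    exact setIntegral_congr_fun (measurableSet_cell h k)
      fun z hz => by simp only [((mem_cell_iff hh).1 hz).2]
  have hi2 : IntegrableOn (fun z => z ^ 2 • taylorSum h (cellIdx h z) v) {z : ℝ | |z| ≤ 1} ν := by
    rw [← integrableOn_congr_set_ae hset, ← biUnion_cell_indexA hn]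
    exact integrableOn_finset_iUnion.2 hi1
  have hne : ∀ᵐ z ∂ν, z ≠ 0 := by
    rw [ae_iff]; simpa using hν.zero
  rw [e1, smallJump, ← integral_sub hi2 (integrable_smallJump hν u)]
  refine (norm_integral_le_of_norm_le
    (hν.integrableOn_sq.integrable.mul_const (‖v - u‖ + η)) ?_).trans (le_of_eq ?_)
  · filter_upwards [ae_restrict_of_ae hne] with z hz
    rw [← smul_sub, norm_smul, Real.norm_of_nonneg (sq_nonneg z)]
    gcongr
    exact norm_taylorSum_sub_le hh (cellIdx_ne_zero hh hz) ((mem_cell_iff hh).2 ⟨hz, rfl⟩) hη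
  · rw [integral_mul_const, hν.integral_sq]

/-! ### Dissipativity -/

/-- Linear weights have vanishing second difference, so two summations by parts leave boundary terms
only. -/
theorem sum_arith_second_difference {E : Type*} [AddCommGroup E] [Module ℝ E] (α β : ℝ)
    (y : ℕ → E) (N : ℕ) :
    ∑ l ∈ Finset.range N, (α - β * l) • (y (l + 2) - (2 : ℝ) • y (l + 1) + y l) =
      α • y 0 - (α + β) • y 1 + (α - β * ((N : ℝ) - 1)) • y (N + 1) - (α - β * N) • y N := by
  induction N with
  | zero => simp
  | succ N ih =>
    rw [Finset.sum_range_succ, ih]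
    push_cast
    module

/-- With `q = 1/|k|`, `α = q - q²/2` and `N = |k|`, summation by parts leaves `α y 0 - (α + q²) y 1
+ (q²/2) (y (N + 1) + y N)`, up to a nonnegative factor. The coefficients sum to zero and the only
negative one sits at `y 1 = u`; Cauchy-Schwarz for translates concludes. -/
theorem inner_opJ1h_nonpos (ν : Measure ℝ) (h : ℝ) (u : L2) : inner ℝ (opJ1h ν h u) u ≤ 0 := by
  rw [opJ1h_eq, discSmallJump, sum_inner]
  refine Finset.sum_nonpos fun k hk => ?_
  have hk0 : k ≠ 0 := ((mem_indexA h k).1 hk).2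
  have hN : 0 < |(k : ℝ)| := by simpa using hk0
  rw [inner_smul_left]
  refine mul_nonpos_of_nonneg_of_nonpos (zeta_nonneg ν h k) ?_
  set s : ℝ := k / |(k : ℝ)| with hsdef
  set q : ℝ := |(k : ℝ)|⁻¹ with hq
  have hs : s = 1 ∨ s = -1 := by
    rcases lt_or_gt_of_ne hk0 with h1 | h1
    · have h2 : (k : ℝ) < 0 := by exact_mod_cast h1
      rw [hsdef, abs_of_neg h2, div_neg, div_self h2.ne]
      exact Or.inr rfl
    · have h2 : (0 : ℝ) < k := by exact_mod_cast h1
      rw [hsdef, abs_of_pos h2, div_self h2.ne']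
      exact Or.inl rfl
  -- The index is offset by one: the second difference centred at `l = 0` reaches one step behind
  -- `u`, in the direction opposite to `s`.
  let y : ℕ → L2 := fun i => shift (s * ((i : ℝ) - 1) * h) u
  have e1 : taylorSum h k (lap h u) = (h⁻¹ * h⁻¹) • ∑ l ∈ Finset.range k.natAbs,
      ((q - q ^ 2 / 2) - q ^ 2 * l) • (y (l + 2) - (2 : ℝ) • y (l + 1) + y l) := by
    rw [taylorSum, Finset.smul_sum]
    refine Finset.sum_congr rfl fun l _ => ?_
    rw [theta_eq hk0, ← hsdef, ← hq, lap_eq, shift_smul, smul_comm]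
    congr 2
    rw [LevyPIDE.shift_add, shift_sub, shift_smul, shift_shift, shift_shift]
    simp only [y]
    rcases hs with hs | hs <;> rw [hs] <;> push_cast
    · rw [show (1 : ℝ) * l * h + h = 1 * ((l : ℝ) + 2 - 1) * h by ring,
        show (1 : ℝ) * l * h = 1 * ((l : ℝ) + 1 - 1) * h by ring,
        show (1 : ℝ) * ((l : ℝ) + 1 - 1) * h + -h = 1 * ((l : ℝ) - 1) * h by ring]
    · rw [show (-1 : ℝ) * l * h + h = -1 * ((l : ℝ) - 1) * h by ring,
        show (-1 : ℝ) * l * h = -1 * ((l : ℝ) + 1 - 1) * h by ring,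
        show (-1 : ℝ) * ((l : ℝ) + 1 - 1) * h + -h = -1 * ((l : ℝ) + 2 - 1) * h by ring]
      module
  have hy1 : y 1 = u := by simp [y]
  have hy : ∀ i, inner ℝ (y i) u ≤ ‖u‖ ^ 2 := fun i => by
    have := real_inner_le_norm (y i) u
    rw [norm_shift] at this
    linarith [sq ‖u‖]
  have hN1 : (1 : ℝ) ≤ |(k : ℝ)| := by
    rw [← natAbs_cast_eq]
    exact_mod_cast Int.natAbs_pos.2 hk0
  have hq1 : q ≤ 1 := inv_le_one_of_one_le₀ hN1
  have hq0 : 0 < q := inv_pos.2 hN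
  have hqN : q * |(k : ℝ)| = 1 := inv_mul_cancel₀ hN.ne'
  rw [e1, sum_arith_second_difference, inner_smul_left, hy1, natAbs_cast_eq]
  refine mul_nonpos_of_nonneg_of_nonpos (mul_self_nonneg _) ?_
  have c1 : q - q ^ 2 / 2 - q ^ 2 * (|(k : ℝ)| - 1) = q ^ 2 / 2 := by
    linear_combination (-q) * hqN
  have c2 : q - q ^ 2 / 2 - q ^ 2 * |(k : ℝ)| = -(q ^ 2 / 2) := by
    linear_combination (-q) * hqN
  rw [c1, c2, inner_sub_left, inner_add_left, inner_sub_left, inner_smul_left, inner_smul_left,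
    inner_smul_left, inner_smul_left, real_inner_self_eq_norm_sq]
  simp only [conj_trivial]
  have d0 : 0 ≤ q - q ^ 2 / 2 := by nlinarith
  have d1 := mul_le_mul_of_nonneg_left (hy 0) d0
  have d2 := mul_le_mul_of_nonneg_left (hy (k.natAbs + 1)) (by positivity : 0 ≤ q ^ 2 / 2)
  have d3 := mul_le_mul_of_nonneg_left (hy k.natAbs) (by positivity : 0 ≤ q ^ 2 / 2)
  linarith

/-! ### Boundedness and dissipativity of the full operator `J^h` -/

theorem transOp_diffQ (r : ℝ) : TransOp (|r⁻¹| * 2) (diffQ r) where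
  map_add := (diffQL r).map_add
  map_smul := (diffQL r).map_smul
  norm_le u := by
    rw [diffQ, norm_smul, mul_assoc, Real.norm_eq_abs]
    refine mul_le_mul_of_nonneg_left ((norm_sub_le _ _).trans ?_) (abs_nonneg _)
    rw [norm_shift]; linarith
  comm := diffQ_comm_shift r

theorem transOp_opJh (hν : LevyMoments ν μ₀ μ₂) {n : ℕ} (hn : 1 ≤ n) :
    ∃ C, 0 ≤ C ∧ TransOp C (opJh ν (1 / (n : ℝ))) := by
  obtain ⟨C, hC, h1⟩ := transOp_discSmallJump ν (1 / (n : ℝ))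
  have h2 := h1.comp ((transOp_diffQ (-(1 / (n : ℝ)))).comp (transOp_diffQ (1 / (n : ℝ)))
    (by positivity)) hC
  have h3 := h2.add (transOp_largeJump hν (σ := fun z => 1 / (n : ℝ) * cellIdx (1 / (n : ℝ)) z)
    ((measurable_from_top.comp (measurable_cellIdx _)).const_mul _))
  have e : opJh ν (1 / (n : ℝ)) = _ := funext fun u => by
    rw [opJh, opJ2h_eq hν hn, opJ1h_eq, lap]
  rw [← e] at h3
  exact ⟨_, by positivity, h3⟩

theorem inner_opJh_nonpos (hν : LevyMoments ν μ₀ μ₂) {n : ℕ} (hn : 1 ≤ n) (u : L2) :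
    inner ℝ (opJh ν (1 / (n : ℝ)) u) u ≤ 0 := by
  rw [opJh, inner_add_left, opJ2h_eq hν hn]
  exact add_nonpos (inner_opJ1h_nonpos _ _ _) (inner_largeJump_nonpos hν
    ((measurable_from_top.comp (measurable_cellIdx _)).const_mul _) u)

end

section

variable {ν : Measure ℝ} {μ₀ μ₂ : ℝ≥0}

/-! ### The scheme acting on a function and its derivatives -/

/-- The `j`-th derivative of `(L^h + J^h) u`, where `u` has the derivatives `w 0, w 1, …`. -/
def schemeOp (ν : Measure ℝ) (h : ℝ) (a b c : ℝ → ℝ) (w : ℕ → L2) (j : ℕ) : L2 :=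
  leib a (fun i => lap (2 * h) (w i)) j + leib b (fun i => symDiffQ h (w i)) j + leib c w j +
    opJh ν h (w j)

/-- The `j`-th derivative of `(L + J) u`, where `u` has the derivatives `w 0, w 1, …`. -/
def limitOp (ν : Measure ℝ) (a b c : ℝ → ℝ) (w : ℕ → L2) (j : ℕ) : L2 :=
  leib a (fun i => w (i + 2)) j + leib b (fun i => w (i + 1)) j + leib c w j +
    (smallJump ν (w (j + 2)) + largeJump ν id (w j))

theorem schemeOp_zero (ν : Measure ℝ) (h : ℝ) (a b c : ℝ → ℝ) (w : ℕ → L2) :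
    schemeOp ν h a b c w 0 = opLh h a b c (w 0) + opJh ν h (w 0) := by
  simp only [schemeOp, leib_zero, opLh, symDiffQ_symDiffQ]

theorem pos_mesh {n : ℕ} (hn : 1 ≤ n) : 0 < 1 / (n : ℝ) := by
  have : (0 : ℝ) < n := by exact_mod_cast hn
  positivity

theorem hasD_schemeOp (hν : LevyMoments ν μ₀ μ₂) {n : ℕ} (hn : 1 ≤ n) {K : ℝ} {r : ℕ}
    {a b c : ℝ → ℝ} (ha : BddDeriv K r a) (hb : BddDeriv K r b) (hc : BddDeriv K r c)
    {w : ℕ → L2} {j : ℕ} (hj : j < r) (hw : ∀ i ≤ j, HasD (w i) (w (i + 1))) :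
    HasD (schemeOp ν (1 / (n : ℝ)) a b c w j) (schemeOp ν (1 / (n : ℝ)) a b c w (j + 1)) := by
  obtain ⟨C, -, hC⟩ := transOp_opJh hν hn
  exact (((hasD_leib ha hj fun i hi => (hw i hi).lap _).add
    (hasD_leib hb hj fun i hi => (hw i hi).symDiffQ _)).add (hasD_leib hc hj hw)).add
    (hC.hasD (hw j le_rfl))

theorem schemeOp_sub (hν : LevyMoments ν μ₀ μ₂) {n : ℕ} (hn : 1 ≤ n) {K : ℝ} {r : ℕ}
    {a b c : ℝ → ℝ} (ha : BddDeriv K r a) (hb : BddDeriv K r b) (hc : BddDeriv K r c)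
    (w w' : ℕ → L2) {j : ℕ} (hj : j ≤ r) :
    schemeOp ν (1 / (n : ℝ)) a b c (fun i => w i - w' i) j =
      schemeOp ν (1 / (n : ℝ)) a b c w j - schemeOp ν (1 / (n : ℝ)) a b c w' j := by
  obtain ⟨C, -, hC⟩ := transOp_opJh hν hn
  simp only [schemeOp, lap_sub, symDiffQ_sub, leib_sub ha _ _ hj, leib_sub hb _ _ hj,
    leib_sub hc _ _ hj, hC.map_sub]
  abel

/-- The constant depends on the mesh, through difference quotients bounded by twice the inverse
step. It serves solvability and integrability only, never the error estimate. -/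
theorem schemeOp_bound (hν : LevyMoments ν μ₀ μ₂) {n : ℕ} (hn : 1 ≤ n) (K : ℝ) (r : ℕ) :
    ∃ C, 0 ≤ C ∧ ∀ a b c : ℝ → ℝ, BddDeriv K r a → BddDeriv K r b → BddDeriv K r c →
      ∀ (w : ℕ → L2) (j : ℕ), j ≤ r → ∀ M : ℝ, (∀ i ≤ j, ‖w i‖ ≤ M) →
        ‖schemeOp ν (1 / (n : ℝ)) a b c w j‖ ≤ C * M := by
  obtain ⟨C, hC0, hC⟩ := transOp_opJh hν hn
  set h : ℝ := 1 / (n : ℝ) with hh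
  set q : ℝ := |(2 * h)⁻¹| * 2 with hq
  set s : ℝ := |h⁻¹| * 2 with hs
  have hlap : ∀ u, ‖lap (2 * h) u‖ ≤ q * q * ‖u‖ := fun u => by
    have h1 := (transOp_diffQ (-(2 * h))).norm_le (diffQ (2 * h) u)
    rw [inv_neg, abs_neg] at h1
    have h2 := (transOp_diffQ (2 * h)).norm_le u
    calc _ ≤ _ := h1
      _ ≤ q * (q * ‖u‖) := by gcongr
      _ = _ := by ring
  have hsym : ∀ u, ‖symDiffQ h u‖ ≤ s * ‖u‖ := fun u => by
    have h1 := (transOp_diffQ h).norm_le u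
    have h2 := (transOp_diffQ (-h)).norm_le u
    rw [inv_neg, abs_neg] at h2
    rw [symDiffQ, norm_smul]
    have := norm_add_le (diffQ h u) (diffQ (-h) u)
    norm_num
    linarith
  refine ⟨2 ^ r * (|K| * (q * q)) + 2 ^ r * (|K| * s) + 2 ^ r * |K| + C, by positivity, ?_⟩
  intro a b c ha hb hc w j hj M hM
  have hK := ha.isMul_zero.nonneg
  rw [abs_of_nonneg hK]
  have hM0 : 0 ≤ M := (norm_nonneg _).trans (hM 0 (Nat.zero_le _))
  have h2 : (2 : ℝ) ^ j ≤ 2 ^ r := pow_le_pow_right₀ (by norm_num) hj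
  have b1 := norm_leib_le ha (fun i => lap (2 * h) (w i)) hj (M := q * q * M) fun i hi =>
    (hlap _).trans (mul_le_mul_of_nonneg_left (hM i hi) (by positivity))
  have b2 := norm_leib_le hb (fun i => symDiffQ h (w i)) hj (M := s * M) fun i hi =>
    (hsym _).trans (mul_le_mul_of_nonneg_left (hM i hi) (by positivity))
  have b3 := norm_leib_le hc w hj hM
  have b4 := (hC.norm_le (w j)).trans (mul_le_mul_of_nonneg_left (hM j le_rfl) hC0)
  have c1 : (2 : ℝ) ^ j * (K * (q * q * M)) ≤ 2 ^ r * (K * (q * q * M)) := by gcongr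
  have c2 : (2 : ℝ) ^ j * (K * (s * M)) ≤ 2 ^ r * (K * (s * M)) := by gcongr
  have c3 : (2 : ℝ) ^ j * (K * M) ≤ 2 ^ r * (K * M) := by gcongr
  refine (norm_add₄_le).trans ?_
  linarith

/-! ### Stability -/

theorem BddDeriv.iteratedDeriv_one {K : ℝ} {r : ℕ} {g : ℝ → ℝ} (hg : BddDeriv K (r + 1) g) :
    BddDeriv K r (iteratedDeriv 1 g) := by
  refine ⟨?_, fun j hj x => ?_⟩
  · have := hg.1
    push_cast at this
    rw [_root_.iteratedDeriv_one]
    exact this.deriv'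
  · rw [_root_.iteratedDeriv_one, ← iteratedDeriv_succ']
    exact hg.2 (j + 1) (by omega) x

theorem BddDeriv.mono {K : ℝ} {r s : ℕ} {g : ℝ → ℝ} (hg : BddDeriv K r g) (h : s ≤ r) :
    BddDeriv K s g :=
  ⟨hg.1.of_le (by exact_mod_cast h), fun j hj => hg.2 j (hj.trans h)⟩

theorem inner_leib_le {g : ℝ → ℝ} {w : ℕ → L2} {v : L2} {j : ℕ} {D : ℝ}
    (h : ∀ p q, p + q = j → inner ℝ (mulL2 (iteratedDeriv p g) (w q)) v ≤ D) :
    inner ℝ (leib g w j) v ≤ 2 ^ j * D := by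
  have h2 : (2 : ℝ) ^ j = ∑ p ∈ Finset.HasAntidiagonal.antidiagonal j, (j.choose p.1 : ℝ) := by
    rw [Finset.Nat.sum_antidiagonal_eq_sum_range_succ_mk]
    exact_mod_cast (Nat.sum_range_choose j).symm
  rw [h2, Finset.sum_mul, leib, sum_inner]
  refine Finset.sum_le_sum fun p hp => ?_
  rw [← Nat.cast_smul_eq_nsmul ℝ, inner_smul_left]
  exact mul_le_mul_of_nonneg_left (h _ _ (Finset.HasAntidiagonal.mem_antidiagonal.1 hp))
    (Nat.cast_nonneg _)

/-- Stability with a constant free of the mesh. Everything is estimated by `M = √S`, which dominates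
each `‖w i‖`; the factor `10` is `8 + 1 + 1` from `a`, `b`, `c`, while `J^h` contributes nothing
positive. -/
theorem inner_schemeOp_le (hν : LevyMoments ν μ₀ μ₂) {n : ℕ} (hn : 1 ≤ n) {K : ℝ} {r : ℕ}
    (hr : 3 ≤ r) {a b c : ℝ → ℝ} (ha : BddDeriv K r a) (hb : BddDeriv K r b) (hc : BddDeriv K r c)
    (ha0 : ∀ x, 0 ≤ a x) {w : ℕ → L2} {j : ℕ} (hj : j ≤ r)
    (hw : ∀ i < j, HasD (w i) (w (i + 1))) :
    inner ℝ (schemeOp ν (1 / (n : ℝ)) a b c w j) (w j) ≤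
      10 * 2 ^ r * K * ∑ i ∈ Finset.range (j + 1), ‖w i‖ ^ 2 := by
  have hh := pos_mesh hn
  set h : ℝ := 1 / (n : ℝ)
  set S : ℝ := ∑ i ∈ Finset.range (j + 1), ‖w i‖ ^ 2 with hS
  have hS0 : 0 ≤ S := Finset.sum_nonneg fun i _ => sq_nonneg _
  have hK := ha.isMul_zero.nonneg
  set M : ℝ := √S with hM
  have hM0 : 0 ≤ M := Real.sqrt_nonneg _
  have hMS : M * M = S := Real.mul_self_sqrt hS0
  have hwM : ∀ i ≤ j, ‖w i‖ ≤ M := fun i hi => Real.le_sqrt_of_sq_le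
    (Finset.single_le_sum (f := fun i => ‖w i‖ ^ 2) (fun i _ => sq_nonneg _)
      (Finset.mem_range.2 (by omega)))
  have hh2 : 2 * h ≠ 0 := by positivity
  have gen : ∀ {g : ℝ → ℝ}, BddDeriv K r g → ∀ p ≤ r, ∀ u : L2, ‖u‖ ≤ M →
      inner ℝ (mulL2 (iteratedDeriv p g) u) (w j) ≤ K * S := fun hg p hp u hu => by
    refine (real_inner_le_norm _ _).trans ?_
    have h1 := (norm_mulL2_le (hg.isMul hp) u).trans (mul_le_mul_of_nonneg_left hu hK)
    calc _ ≤ K * M * M := mul_le_mul h1 (hwM j le_rfl) (norm_nonneg _) (by positivity)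
      _ = _ := by rw [mul_assoc, hMS]
  have hwj : ‖w j‖ ^ 2 ≤ S := by
    rw [← hMS, ← sq]; exact pow_le_pow_left₀ (norm_nonneg _) (hwM j le_rfl) 2
  have hd0 : ∀ {g : ℝ → ℝ}, BddDeriv K r g → ∀ x, HasDerivAt g (iteratedDeriv 1 g x) x :=
    fun hg => by simpa using fun x => hg.hasDerivAt (j := 0) (by omega) x
  have h1 : inner ℝ (leib a (fun i => lap (2 * h) (w i)) j) (w j) ≤ 2 ^ j * (8 * K * S) := by
    refine inner_leib_le fun p q hpq => ?_
    have hKS : 0 ≤ K * S := by positivity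
    -- Here `p` counts derivatives falling on `a`. With none, the sign of `a` is used; with one, the
    -- commutator argument, giving `2 K (2 M)² = 8 K S`; with two or more, `lap` costs two
    -- derivatives of `w q`, and `q + 2 ≤ j`.
    rcases Nat.lt_or_ge p 2 with hp | hp
    · interval_cases p
      · obtain rfl : q = j := by omega
        rw [iteratedDeriv_zero]
        have := inner_mulL2_lap_le ha.isMul_zero ha0 (hd0 ha)
          (fun x => ha.hasDerivAt (j := 1) (by omega) x) (ha.2 2 (by omega)) hh2 (w q)
        have := mul_le_mul_of_nonneg_left hwj hK
        linarith
      · obtain rfl : j = q + 1 := by omega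
        have h3 := (le_abs_self _).trans (inner_mulL2_lap_deriv_le
          (ha.mono hr).iteratedDeriv_one hh2 (hw q (by omega)))
        have h4 : (‖w q‖ + ‖w (q + 1)‖) ^ 2 ≤ (2 * M) ^ 2 :=
          pow_le_pow_left₀ (by positivity) (by linarith [hwM q (by omega), hwM (q + 1) le_rfl]) 2
        refine h3.trans ((mul_le_mul_of_nonneg_left h4 (by positivity)).trans (le_of_eq ?_))
        rw [← hMS]; ring
    · have h3 := (hw q (by omega)).norm_lap_le (hw (q + 1) (by omega)) (2 * h)
      have := gen ha p (by omega) _ (h3.trans (hwM _ (by omega)))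
      linarith
  have h2 : inner ℝ (leib b (fun i => symDiffQ h (w i)) j) (w j) ≤ 2 ^ j * (K * S) := by
    refine inner_leib_le fun p q hpq => ?_
    rcases Nat.eq_zero_or_pos p with rfl | hp
    · obtain rfl : q = j := by omega
      rw [iteratedDeriv_zero]
      exact (inner_mulL2_symDiffQ_le hb.isMul_zero (hd0 hb) (hb.2 1 (by omega)) hh.ne' _).trans
        (mul_le_mul_of_nonneg_left hwj hK)
    · exact gen hb p (by omega) _ (((hw q (by omega)).norm_symDiffQ_le h).trans (hwM _ (by omega)))
  have h3 : inner ℝ (leib c w j) (w j) ≤ 2 ^ j * (K * S) :=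
    inner_leib_le fun p q hpq => gen hc p (by omega) _ (hwM _ (by omega))
  have h4 := inner_opJh_nonpos hν hn (w j)
  rw [schemeOp, inner_add_left, inner_add_left, inner_add_left]
  have h5 : (2 : ℝ) ^ j * (10 * K * S) ≤ 2 ^ r * (10 * K * S) := by
    have h2 : (2 : ℝ) ^ j ≤ 2 ^ r := pow_le_pow_right₀ (by norm_num) hj
    gcongr
  linarith

/-! ### Consistency -/

/-- The constant of the consistency estimate. -/
def consistencyConst (r : ℕ) (K : ℝ) (μ₀ μ₂ : ℝ≥0) : ℝ := 5 * 2 ^ r * K + 3 * μ₂ + μ₀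

/-- Each piece of the scheme is a first order approximation. In `consistencyConst`, `5 K` is `4 K`
from the second difference of step `2h` plus `K` from the symmetric quotient. The small jumps give
`3 μ₂`, of which `2` come from `lap h` and `1` from moving nodes by at most `h`; rounding large
jumps gives `μ₀`. The second differences require three derivatives beyond `j`. -/
theorem norm_schemeOp_sub_limitOp_le (hν : LevyMoments ν μ₀ μ₂) {n : ℕ} (hn : 1 ≤ n) {K : ℝ}
    {r : ℕ} {a b c : ℝ → ℝ} (ha : BddDeriv K r a) (hb : BddDeriv K r b)
    {w : ℕ → L2} {j : ℕ} (hj : j + 3 ≤ r) (hw : ∀ i < r, HasD (w i) (w (i + 1))) {M : ℝ}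
    (hM : ∀ i ≤ r, ‖w i‖ ≤ M) :
    ‖schemeOp ν (1 / (n : ℝ)) a b c w j - limitOp ν a b c w j‖ ≤
      consistencyConst r K μ₀ μ₂ * M * (1 / (n : ℝ)) := by
  have hh := pos_mesh hn
  set h : ℝ := 1 / (n : ℝ) with hdef
  have hK := ha.isMul_zero.nonneg
  have hM0 : 0 ≤ M := (norm_nonneg _).trans (hM 0 (Nat.zero_le _))
  have e : schemeOp ν h a b c w j - limitOp ν a b c w j =
      leib a (fun i => lap (2 * h) (w i) - w (i + 2)) j +
      leib b (fun i => symDiffQ h (w i) - w (i + 1)) j +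
      (discSmallJump ν h (lap h (w j)) - smallJump ν (w (j + 2))) +
      (largeJump ν (fun z => h * cellIdx h z) (w j) - largeJump ν id (w j)) := by
    rw [leib_sub ha _ _ (by omega), leib_sub hb _ _ (by omega), schemeOp, limitOp, opJh,
      opJ2h_eq hν hn, opJ1h_eq]
    abel
  have h2 : (2 : ℝ) ^ j ≤ 2 ^ r := pow_le_pow_right₀ (by norm_num) (by omega)
  have b1 := norm_leib_le ha (fun i => lap (2 * h) (w i) - w (i + 2)) (j := j) (by omega)
    (M := 4 * h * M) fun i hi => by
      refine ((hw i (by omega)).norm_lap_sub_le (hw (i + 1) (by omega)) (hw (i + 2) (by omega))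
        (by positivity : 2 * h ≠ 0)).trans ?_
      rw [abs_of_pos (by positivity)]
      have := hM (i + 3) (by omega)
      calc _ ≤ 2 * (2 * h) * M := by gcongr
        _ = _ := by ring
  have b2 := norm_leib_le hb (fun i => symDiffQ h (w i) - w (i + 1)) (j := j) (by omega)
    (M := h * M) fun i hi => by
      refine ((hw i (by omega)).norm_symDiffQ_sub_le (hw (i + 1) (by omega)) hh.ne').trans ?_
      rw [abs_of_pos hh]
      have := hM (i + 2) (by omega)
      gcongr
  have b3 := norm_discSmallJump_sub_le hν hn (u := w (j + 2)) (v := lap h (w j)) (η := h * M)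
    fun r hr => ((hw (j + 2) (by omega)).norm_shift_sub_le r).trans
      (mul_le_mul hr (hM (j + 3) (by omega)) (norm_nonneg _) hh.le)
  have b4 : ‖lap h (w j) - w (j + 2)‖ ≤ 2 * h * M := by
    refine ((hw j (by omega)).norm_lap_sub_le (hw (j + 1) (by omega)) (hw (j + 2) (by omega))
        hh.ne').trans ?_
    rw [abs_of_pos hh]
    have := hM (j + 3) (by omega)
    gcongr
  have b5 := norm_largeJump_sub_le hν (σ := fun z => h * cellIdx h z) (τ := id)
    ((measurable_from_top.comp (measurable_cellIdx _)).const_mul _) measurable_id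
    (hw j (by omega)) (r := h) fun z hz => by
      have h0 : z ≠ 0 := by rintro rfl; norm_num at hz
      exact abs_cell_sub_le ((mem_cell_iff hh).2 ⟨h0, rfl⟩)
  have b6 : (μ₀ : ℝ) * (h * ‖w (j + 1)‖) ≤ μ₀ * (h * M) := by
    have := hM (j + 1) (by omega)
    gcongr
  have b7 : (μ₂ : ℝ) * (‖lap h (w j) - w (j + 2)‖ + h * M) ≤ μ₂ * (2 * h * M + h * M) := by
    gcongr
  have c1 : (2 : ℝ) ^ j * (K * (4 * h * M)) ≤ 2 ^ r * (K * (4 * h * M)) := by gcongr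
  have c2 : (2 : ℝ) ^ j * (K * (h * M)) ≤ 2 ^ r * (K * (h * M)) := by gcongr
  rw [e, consistencyConst]
  refine (norm_add₄_le).trans ?_
  linarith

/-! ### The weak form of the limit operator -/

/-- The part of the weak form of `(L + J) u` tested against `φ`; here `v` is the derivative
of `u`. -/
def weakZero (ν : Measure ℝ) (a b c : ℝ → ℝ) (u v : L2) : L2 :=
  mulL2 b v - mulL2 (iteratedDeriv 1 a) v + mulL2 c u + largeJump ν id u

/-- The part of the weak form of `(L + J) u` tested against `φ'`. -/
def weakOne (ν : Measure ℝ) (a : ℝ → ℝ) (v : L2) : L2 := -(mulL2 a v + smallJump ν v)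

/-- One integration by parts in the second order and small jump terms. It puts regular scheme
solutions in the same weak form as `u`. -/
theorem inner_limitOp_zero (hν : LevyMoments ν μ₀ μ₂) {K : ℝ} {a b c : ℝ → ℝ}
    (ha : BddDeriv K 1 a) {w : ℕ → L2}
    (hw : HasD (w 1) (w 2)) {e e' : L2} (he : HasD e e') :
    inner ℝ (limitOp ν a b c w 0) e =
      inner ℝ (weakZero ν a b c (w 0) (w 1)) e + inner ℝ (weakOne ν a (w 1)) e' := by
  have hd : ∀ x, HasDerivAt a (iteratedDeriv 1 a x) x := by
    simpa using fun x => ha.hasDerivAt (j := 0) (by omega) x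
  have h1 := (HasD.mulL2 ha.isMul_zero (ha.isMul le_rfl) hd hw).inner_left he
  have h2 := ((transOp_smallJump hν).hasD hw).inner_left he
  simp only [limitOp, leib_zero, weakZero, weakOne, inner_add_left, inner_sub_left,
    inner_neg_left] at h1 h2 ⊢
  linarith

/-- Integration by parts gives `(g u', u) = -½ (g' u, u)`. -/
theorem abs_inner_mulL2_deriv_le {K : ℝ} {g : ℝ → ℝ} (hg : BddDeriv K 1 g) {u v : L2}
    (huv : HasD u v) : |inner ℝ (mulL2 g v) u| ≤ K / 2 * ‖u‖ ^ 2 := by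
  have hd : ∀ x, HasDerivAt g (iteratedDeriv 1 g x) x := by
    simpa using fun x => hg.hasDerivAt (j := 0) (by omega) x
  have h1 := (HasD.mulL2 hg.isMul_zero (hg.isMul le_rfl) hd huv).inner_left huv
  rw [inner_add_left, inner_mulL2_left hg.isMul_zero u v, real_inner_comm (mulL2 g v) u] at h1
  have h2 := (abs_real_inner_le_norm (mulL2 (iteratedDeriv 1 g) u) u).trans
    (mul_le_mul_of_nonneg_right (norm_mulL2_le (hg.isMul le_rfl) u) (norm_nonneg _))
  rw [abs_le] at h2 ⊢
  constructor <;> nlinarith [h2.1, h2.2]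

/-- Dissipativity is inherited from the scheme. One discrete integration by parts writes `-(J_1^h u,
u)` as the discretized form at the difference quotient of `u`, which tends to `v`. Only one
derivative of `u` is available, so the convergence has no rate. -/
theorem inner_smallJump_deriv_nonneg (hν : LevyMoments ν μ₀ μ₂) {u v : L2} (huv : HasD u v) :
    0 ≤ inner ℝ (smallJump ν v) v := by
  have hn : ∀ n : ℕ, 1 ≤ n + 1 := fun n => by omega
  have hh0 : Tendsto (fun n : ℕ => 1 / ((n + 1 : ℕ) : ℝ)) atTop (𝓝 0) := by
    simpa using tendsto_one_div_add_atTop_nhds_zero_nat (𝕜 := ℝ)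
  have hq : Tendsto (fun n : ℕ => diffQ (1 / ((n + 1 : ℕ) : ℝ)) u) atTop (𝓝 v) :=
    huv.tendsto.comp (tendsto_nhdsWithin_iff.2
      ⟨hh0, Eventually.of_forall fun n => (pos_mesh (hn n)).ne'⟩)
  have hP : Tendsto (fun n : ℕ => discSmallJump ν (1 / ((n + 1 : ℕ) : ℝ))
      (diffQ (1 / ((n + 1 : ℕ) : ℝ)) u)) atTop (𝓝 (smallJump ν v)) := by
    rw [Metric.tendsto_nhds]
    intro ε hε
    set δ := ε / (2 * (μ₂ + 1)) with hδ
    have hδ0 : 0 < δ := by positivity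
    have hc : ∀ᶠ r in 𝓝 (0 : ℝ), ‖shift r v - v‖ < δ := by
      have := (continuous_shift v).tendsto 0
      rw [shift_zero, Metric.tendsto_nhds] at this
      simpa [dist_eq_norm] using this δ hδ0
    obtain ⟨ρ, hρ, hball⟩ := Metric.eventually_nhds_iff.1 hc
    have e1 := Metric.tendsto_nhds.1 hq δ hδ0
    have e2 := Metric.tendsto_nhds.1 hh0 ρ hρ
    filter_upwards [e1, e2] with n h1 h2
    rw [dist_zero_right, Real.norm_of_nonneg (pos_mesh (hn n)).le] at h2
    rw [dist_eq_norm] at h1 ⊢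
    have := norm_discSmallJump_sub_le hν (hn n) (u := v)
      (v := diffQ (1 / ((n + 1 : ℕ) : ℝ)) u) (η := δ) fun r hr =>
        (hball (by rw [dist_zero_right, Real.norm_eq_abs]; exact hr.trans_lt h2)).le
    calc _ ≤ _ := this
      _ ≤ μ₂ * (δ + δ) := by gcongr
      _ < (μ₂ + 1) * (δ + δ) := by gcongr; linarith
      _ = ε := by rw [hδ]; field_simp; norm_num
  refine ge_of_tendsto' (hP.inner hq) fun n => ?_
  have h1 := inner_opJ1h_nonpos ν (1 / ((n + 1 : ℕ) : ℝ)) u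
  obtain ⟨C, -, hC⟩ := transOp_discSmallJump ν (1 / ((n + 1 : ℕ) : ℝ))
  obtain ⟨L, hL⟩ := hC.toCLM
  have e : discSmallJump ν (1 / ((n + 1 : ℕ) : ℝ)) (lap (1 / ((n + 1 : ℕ) : ℝ)) u) =
      diffQ (-(1 / ((n + 1 : ℕ) : ℝ))) (discSmallJump ν (1 / ((n + 1 : ℕ) : ℝ))
        (diffQ (1 / ((n + 1 : ℕ) : ℝ)) u)) := by
    rw [lap]
    conv_lhs => rw [diffQ]
    conv_rhs => rw [diffQ]
    rw [hC.map_smul, hC.map_sub, hC.comm]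
  rw [opJ1h_eq, e, inner_diffQ_left, neg_neg] at h1
  linarith

/-- The first order terms with `b` and `a'` contribute `K / 2` each and `c` contributes `K`; the
diffusion and jump terms have a favourable sign. -/
theorem inner_weak_le (hν : LevyMoments ν μ₀ μ₂) {K : ℝ} {a b c : ℝ → ℝ}
    (ha : BddDeriv K 2 a) (hb : BddDeriv K 1 b) (hc : BddDeriv K 0 c) (ha0 : ∀ x, 0 ≤ a x)
    {u v : L2} (huv : HasD u v) :
    inner ℝ (weakZero ν a b c u v) u + inner ℝ (weakOne ν a v) v ≤ 2 * K * ‖u‖ ^ 2 := by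
  have h1 := (abs_le.1 (abs_inner_mulL2_deriv_le hb huv)).2
  have h2 := (abs_le.1 (abs_inner_mulL2_deriv_le ha.iteratedDeriv_one huv)).1
  have h3 := (real_inner_le_norm (mulL2 c u) u).trans
    (mul_le_mul_of_nonneg_right (norm_mulL2_le hc.isMul_zero u) (norm_nonneg _))
  have h4 := inner_largeJump_nonpos hν measurable_id u
  have h5 := inner_mulL2_self_nonneg ha.isMul_zero ha0 v
  have h6 := inner_smallJump_deriv_nonneg hν huv
  simp only [weakZero, weakOne, inner_add_left, inner_sub_left, inner_neg_left]
  nlinarith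

end

/-! ### Weak and strong measurability -/

/-- A closed ball is the intersection of the half-spaces given by countably many dense directions.
-/
theorem measurableSet_norm_sub_le_of_inner {Ω X : Type*} [MeasurableSpace Ω]
    [NormedAddCommGroup X] [InnerProductSpace ℝ X] [SecondCountableTopology X] {f : Ω → X}
    (h : ∀ v, Measurable fun t => inner ℝ (f t) v) (x : X) {r : ℝ} (hr : 0 ≤ r) :
    MeasurableSet {t | ‖f t - x‖ ≤ r} := by
  obtain ⟨d, hd⟩ := TopologicalSpace.exists_dense_seq X
  have e : {t | ‖f t - x‖ ≤ r} =
      ⋂ n, {t | inner ℝ (f t) (d n) - inner ℝ x (d n) ≤ r * ‖d n‖} := by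
    ext t
    simp only [mem_iInter, mem_ofPred_eq, ← inner_sub_left]
    constructor
    · intro ht n
      exact (real_inner_le_norm _ _).trans (mul_le_mul_of_nonneg_right ht (norm_nonneg _))
    · intro ht
      have h1 : ∀ v : X, inner ℝ (f t - x) v ≤ r * ‖v‖ := by
        intro v
        have hcl : IsClosed {v : X | inner ℝ (f t - x) v ≤ r * ‖v‖} :=
          isClosed_le (by fun_prop) (by fun_prop)
        have : closure (range d) ⊆ {v : X | inner ℝ (f t - x) v ≤ r * ‖v‖} :=
          hcl.closure_subset_iff.2 (by rintro _ ⟨n, rfl⟩; exact ht n)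
        exact this (hd v)
      have h2 := h1 (f t - x)
      rw [real_inner_self_eq_norm_sq, sq] at h2
      rcases (norm_nonneg (f t - x)).eq_or_lt with h0 | h0
      · rwa [← h0]
      · exact le_of_mul_le_mul_right h2 h0
  rw [e]
  refine MeasurableSet.iInter fun n => ?_
  exact measurableSet_le ((h (d n)).sub_const _) measurable_const

/-- Pettis' theorem for separable inner product spaces: open sets are countable unions of closed
balls with centres in a dense sequence and rational radii. -/
theorem stronglyMeasurable_of_inner {Ω X : Type*} [MeasurableSpace Ω] [NormedAddCommGroup X]
    [InnerProductSpace ℝ X] [SecondCountableTopology X] {f : Ω → X}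
    (h : ∀ v, Measurable fun t => inner ℝ (f t) v) : StronglyMeasurable f := by
  borelize X
  refine Measurable.stronglyMeasurable (measurable_of_isOpen fun U hU => ?_)
  obtain ⟨d, hd⟩ := TopologicalSpace.exists_dense_seq X
  have e : f ⁻¹' U = ⋃ (p : ℕ × ℚ) (_ : 0 ≤ p.2 ∧ Metric.closedBall (d p.1) p.2 ⊆ U),
      {t | ‖f t - d p.1‖ ≤ p.2} := by
    ext t
    simp only [mem_preimage, mem_iUnion, mem_ofPred_eq, exists_prop]
    constructor
    · intro ht
      obtain ⟨ε, hε, hball⟩ := Metric.isOpen_iff.1 hU _ ht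
      obtain ⟨n, hn⟩ := hd.exists_dist_lt (f t) (half_pos hε)
      obtain ⟨q, hq1, hq2⟩ := exists_rat_btwn hn
      refine ⟨(n, q), ⟨?_, ?_⟩, ?_⟩
      · exact_mod_cast dist_nonneg.trans hq1.le
      · intro y hy
        refine hball ?_
        rw [Metric.mem_closedBall] at hy
        rw [Metric.mem_ball]
        calc dist y (f t) ≤ dist y (d n) + dist (d n) (f t) := dist_triangle _ _ _
          _ < ε := by rw [dist_comm (d n)]; simp only at hy; linarith
      · rw [← dist_eq_norm]
        exact hq1.le
    · rintro ⟨p, ⟨-, hp⟩, ht⟩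
      exact hp (by rwa [Metric.mem_closedBall, dist_eq_norm])
  rw [e]
  refine MeasurableSet.iUnion fun p => MeasurableSet.iUnion fun hp => ?_
  exact measurableSet_norm_sub_le_of_inner h _ (by exact_mod_cast hp.1)

/-! ### The energy identity -/

/-- It transfers absolute continuity from the primitive of `‖G‖` to the squared norm in
`norm_sq_primitive`. -/
theorem AbsolutelyContinuousOnInterval.of_dist_le {X Y : Type*} [PseudoMetricSpace X]
    [PseudoMetricSpace Y] {f : ℝ → X} {g : ℝ → Y} {a b C : ℝ}
    (hg : AbsolutelyContinuousOnInterval g a b)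
    (h : ∀ s ∈ uIcc a b, ∀ t ∈ uIcc a b, dist (f s) (f t) ≤ C * dist (g s) (g t)) :
    AbsolutelyContinuousOnInterval f a b := by
  have h0 := Filter.Tendsto.const_mul C hg
  rw [mul_zero] at h0
  refine squeeze_zero' (Eventually.of_forall fun E => Finset.sum_nonneg fun i _ => dist_nonneg)
    ?_ h0
  rw [eventually_inf_principal]
  refine Eventually.of_forall fun E hE => ?_
  rw [Finset.mul_sum]
  exact Finset.sum_le_sum fun i hi => h _ (hE.1 i hi).1 _ (hE.1 i hi).2

/-- Since `G` is merely integrable, the chain rule holds only almost everywhere. The squared norm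
minus twice the integral is absolutely continuous with derivative zero almost everywhere, hence
constant. -/
theorem norm_sq_primitive {X : Type*} [NormedAddCommGroup X] [InnerProductSpace ℝ X]
    [CompleteSpace X] {T : ℝ} (hT : 0 ≤ T) {G v : ℝ → X} {v₀ : X}
    (hG : IntervalIntegrable G volume 0 T)
    (hv : ∀ t ∈ Icc 0 T, v t = v₀ + ∫ s in (0 : ℝ)..t, G s) :
    ContinuousOn v (Icc 0 T) ∧
    IntervalIntegrable (fun s => inner ℝ (G s) (v s)) volume 0 T ∧
    ∀ t ∈ Icc 0 T, ‖v t‖ ^ 2 = ‖v₀‖ ^ 2 + 2 * ∫ s in (0 : ℝ)..t, inner ℝ (G s) (v s) := by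
  have hsub : ∀ t ∈ Icc 0 T, uIcc 0 t ⊆ Icc 0 T := fun t ht => by
    rw [uIcc_of_le ht.1]; exact Icc_subset_Icc_right ht.2
  have hI : uIcc 0 T = Icc 0 T := uIcc_of_le hT
  set V : ℝ → X := fun t => v₀ + ∫ s in (0 : ℝ)..t, G s with hV
  have hVc : ContinuousOn V (uIcc 0 T) :=
    continuousOn_const.add (intervalIntegral.continuousOn_primitive_interval' hG left_mem_uIcc)
  have hvV : ∀ t ∈ Icc 0 T, v t = V t := hv
  have hGV : IntervalIntegrable (fun s => inner ℝ (G s) (V s)) volume 0 T := by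
    obtain ⟨M, hM⟩ := isCompact_uIcc.exists_bound_of_continuousOn hVc
    rw [intervalIntegrable_iff] at hG ⊢
    refine (hG.norm.mul_const M).mono' ?_ ?_
    · exact hG.1.inner ((hVc.mono uIoc_subset_uIcc).aestronglyMeasurable measurableSet_uIoc)
    · refine (ae_restrict_iff' measurableSet_uIoc).2 (ae_of_all _ fun s hs => ?_)
      exact (norm_inner_le_norm _ _).trans
        (mul_le_mul_of_nonneg_left (hM s (uIoc_subset_uIcc hs)) (norm_nonneg _))
  have hcongr : ∀ t ∈ Icc 0 T, ∀ s ∈ uIcc 0 t, inner ℝ (G s) (v s) = inner ℝ (G s) (V s) :=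
    fun t ht s hs => by rw [hvV s (hsub t ht hs)]
  refine ⟨(hI ▸ hVc).congr hvV, hGV.congr fun s hs => ?_, fun t ht => ?_⟩
  · exact (hcongr T (right_mem_Icc.2 hT) s (uIoc_subset_uIcc hs)).symm
  rw [intervalIntegral.integral_congr (hcongr t ht), hvV t ht]
  obtain ⟨M, hM⟩ := isCompact_uIcc.exists_bound_of_continuousOn hVc
  have hΓ := hG.norm.absolutelyContinuousOnInterval_intervalIntegral (c := 0) left_mem_uIcc
  have hE := hGV.absolutelyContinuousOnInterval_intervalIntegral (c := 0) left_mem_uIcc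
  have hint : ∀ s ∈ uIcc 0 T, ∀ t ∈ uIcc 0 T, IntervalIntegrable G volume s t :=
    fun s hs t ht => hG.mono_set (uIcc_subset_uIcc hs ht)
  have hdist : ∀ s ∈ uIcc 0 T, ∀ t ∈ uIcc 0 T, dist (‖V s‖ ^ 2) (‖V t‖ ^ 2) ≤
      (2 * M) * dist (∫ r in (0 : ℝ)..s, ‖G r‖) (∫ r in (0 : ℝ)..t, ‖G r‖) := by
    intro s hs t ht
    have e1 : V s - V t = ∫ r in t..s, G r := by
      simp only [hV, add_sub_add_left_eq_sub]
      exact intervalIntegral.integral_interval_sub_left (hint _ left_mem_uIcc _ hs)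
        (hint _ left_mem_uIcc _ ht)
    have e2 : (∫ r in (0 : ℝ)..s, ‖G r‖) - (∫ r in (0 : ℝ)..t, ‖G r‖) = ∫ r in t..s, ‖G r‖ :=
      intervalIntegral.integral_interval_sub_left (hint _ left_mem_uIcc _ hs).norm
        (hint _ left_mem_uIcc _ ht).norm
    have h1 : ‖V s - V t‖ ≤ |∫ r in t..s, ‖G r‖| := by
      rw [e1]; exact intervalIntegral.norm_integral_le_abs_integral_norm
    have h2 : |‖V s‖ - ‖V t‖| ≤ ‖V s - V t‖ := abs_norm_sub_norm_le _ _
    rw [Real.dist_eq, Real.dist_eq, e2, sq_sub_sq, abs_mul,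
      abs_of_nonneg (add_nonneg (norm_nonneg _) (norm_nonneg _))]
    have h3 : ‖V s‖ + ‖V t‖ ≤ 2 * M := by linarith [hM s hs, hM t ht]
    exact mul_le_mul h3 (h2.trans h1) (abs_nonneg _)
      ((add_nonneg (norm_nonneg _) (norm_nonneg _)).trans h3)
  have hN := AbsolutelyContinuousOnInterval.of_dist_le hΓ hdist
  have hD := hN.sub (hE.const_mul 2)
  have hder : ∀ᵐ x, x ∈ uIcc 0 T → HasDerivAt
      ((fun t => ‖V t‖ ^ 2) - fun t => 2 * ∫ s in (0 : ℝ)..t, inner ℝ (G s) (V s)) 0 x := by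
    filter_upwards [hG.ae_hasDerivAt_integral, hGV.ae_hasDerivAt_integral] with x h1 h2 hx
    have h3 := ((h1 hx 0 left_mem_uIcc).const_add v₀).norm_sq
    have h4 := (h2 hx 0 left_mem_uIcc).const_mul 2
    have h5 := h3.sub h4
    rw [real_inner_comm, sub_self] at h5
    exact h5
  obtain ⟨C, hC⟩ := hD.const_of_ae_hasDerivAt_zero hder
  have hC0 := hC 0 left_mem_uIcc
  have hCt := hC t (hI ▸ ht)
  simp only [Pi.sub_apply, intervalIntegral.integral_same, mul_zero, sub_zero, hV, add_zero]
    at hC0 hCt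
  simp only [hV]
  linarith

/-! ### Grönwall's inequality -/

/-- The projection of the time axis to `[0, T]`. -/
def clamp (T t : ℝ) : ℝ := max 0 (min t T)

theorem continuous_clamp (T : ℝ) : Continuous (clamp T) := by unfold clamp; fun_prop

theorem clamp_mem {T : ℝ} (hT : 0 ≤ T) (t : ℝ) : clamp T t ∈ Icc 0 T :=
  ⟨le_max_left _ _, max_le hT (min_le_right _ _)⟩

theorem clamp_eq {T t : ℝ} (ht : t ∈ Icc 0 T) : clamp T t = t := by
  rw [clamp, min_eq_left ht.2, max_eq_right ht.1]

theorem continuous_comp_clamp {X : Type*} [TopologicalSpace X] {T : ℝ} (hT : 0 ≤ T) {f : ℝ → X}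
    (hf : ContinuousOn f (Icc 0 T)) : Continuous fun t => f (clamp T t) :=
  hf.comp_continuous (continuous_clamp T) (clamp_mem hT)

/-- The bound on `y` makes `(α + N ∫ y) exp (-N t)` nonincreasing. Freezing `y` outside `[0, T]`
makes it continuous on the line, so its primitive is differentiable everywhere. -/
theorem le_exp_of_le_integral {T N α : ℝ} (hN : 0 ≤ N) {y : ℝ → ℝ}
    (hy : ContinuousOn y (Icc 0 T)) (h : ∀ t ∈ Icc 0 T, y t ≤ α + N * ∫ s in (0 : ℝ)..t, y s) :
    ∀ t ∈ Icc 0 T, y t ≤ α * Real.exp (N * t) := by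
  intro t ht
  have hT : 0 ≤ T := ht.1.trans ht.2
  set z : ℝ → ℝ := fun t => y (clamp T t)
  have hz : Continuous z := continuous_comp_clamp hT hy
  have hzy : ∀ t ∈ Icc 0 T, z t = y t := fun t ht => by simp only [z, clamp_eq ht]
  have hint : ∀ t ∈ Icc 0 T, ∫ s in (0 : ℝ)..t, y s = ∫ s in (0 : ℝ)..t, z s := fun t ht =>
    intervalIntegral.integral_congr fun s hs => by
      rw [uIcc_of_le ht.1] at hs
      exact (hzy s ⟨hs.1, hs.2.trans ht.2⟩).symm
  set F : ℝ → ℝ := fun t => (α + N * ∫ s in (0 : ℝ)..t, z s) * Real.exp (-(N * t))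
  have hF : ∀ t, HasDerivAt F ((N * z t) * Real.exp (-(N * t)) +
      (α + N * ∫ s in (0 : ℝ)..t, z s) * (Real.exp (-(N * t)) * -(N * 1))) t := fun t =>
    (((hz.integral_hasStrictDerivAt 0 t).hasDerivAt.const_mul N).const_add α).mul
      (((hasDerivAt_id t).const_mul N).neg.exp)
  have hanti : AntitoneOn F (Icc 0 T) := by
    refine antitoneOn_of_deriv_nonpos (convex_Icc 0 T)
      (fun t _ => (hF t).continuousAt.continuousWithinAt)
      (fun t _ => (hF t).differentiableAt.differentiableWithinAt) fun t ht' => ?_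
    rw [interior_Icc] at ht'
    have ht : t ∈ Icc 0 T := Ioo_subset_Icc_self ht'
    rw [(hF t).deriv]
    have h1 := h t ht
    rw [hint t ht, ← hzy t ht] at h1
    have h2 := mul_le_mul_of_nonneg_left h1 hN
    have h3 := mul_le_mul_of_nonneg_right h2 (Real.exp_pos (-(N * t))).le
    linarith
  have h0 := hanti (left_mem_Icc.2 hT) ht ht.1
  simp only [F, intervalIntegral.integral_same, mul_zero, add_zero, neg_zero, Real.exp_zero,
    mul_one] at h0
  have h1 := h t ht
  rw [hint t ht] at h1
  have h2 := mul_le_mul_of_nonneg_right h0 (Real.exp_pos (N * t)).le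
  rw [mul_assoc, ← Real.exp_add, neg_add_cancel, Real.exp_zero, mul_one] at h2
  exact h1.trans h2

/-! ### Linear evolution equations with bounded operators -/

/-- Picard iteration. No continuity in time is assumed of `A`, so measurability along continuous
curves is a separate hypothesis. -/
theorem exists_solution_of_lipschitz {X : Type*} [NormedAddCommGroup X] [NormedSpace ℝ X]
    [CompleteSpace X] {T C : ℝ} (hT : 0 ≤ T) (hC : 0 ≤ C) {A : ℝ → X → X}
    (hA : ∀ t x y, ‖A t x - A t y‖ ≤ C * ‖x - y‖) (hA0 : ∀ t, A t 0 = 0)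
    (hm : ∀ v : ℝ → X, Continuous v → AEStronglyMeasurable (fun t => A t (v t)) volume)
    {f : ℝ → X} (hf : IntervalIntegrable f volume 0 T) (ψ : X) :
    ∃ v : ℝ → X, Continuous v ∧
      ∀ t ∈ Icc 0 T, v t = ψ + ∫ s in (0 : ℝ)..t, (A s (v s) + f s) := by
  have hAi : ∀ v : ℝ → X, Continuous v → ∀ a b, IntervalIntegrable (fun s => A s (v s)) volume a b := by
    intro v hv a b
    rw [intervalIntegrable_iff]
    have h1 : IntegrableOn (fun s => C * ‖v s‖) (uIoc a b) :=
      intervalIntegrable_iff.1 ((continuous_const.mul hv.norm).intervalIntegrable a b)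
    refine h1.mono' (hm v hv).restrict (ae_of_all _ fun s => ?_)
    simpa [hA0] using hA s (v s) 0
  let P : C(Icc (0 : ℝ) T, X) → ℝ → X := fun v t => v (projIcc 0 T hT t)
  have hP : ∀ v, Continuous (P v) := fun v => v.continuous.comp continuous_projIcc
  have hPi : ∀ v t, t ∈ Icc 0 T → IntervalIntegrable (fun s => A s (P v s) + f s) volume 0 t :=
    fun v t ht => (hAi _ (hP v) _ _).add
      (hf.mono_set (uIcc_subset_uIcc left_mem_uIcc (by rwa [uIcc_of_le hT])))
  let Φ : C(Icc (0 : ℝ) T, X) → C(Icc (0 : ℝ) T, X) := fun v =>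
    ⟨fun t => ψ + ∫ s in (0 : ℝ)..t, (A s (P v s) + f s), by
      have h1 := intervalIntegral.continuousOn_primitive_interval' (a := 0)
        (hPi v T (right_mem_Icc.2 hT)) left_mem_uIcc
      rw [uIcc_of_le hT] at h1
      exact continuous_const.add (continuousOn_iff_continuous_domRestrict.1 h1)⟩
  have hiter : ∀ (n : ℕ) (v w : C(Icc (0 : ℝ) T, X)) (t : Icc (0 : ℝ) T),
      ‖(Φ^[n] v) t - (Φ^[n] w) t‖ ≤ (C * t) ^ n / n.factorial * dist v w := by
    intro n v w
    induction n with
    | zero =>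
      intro t
      simpa [dist_eq_norm] using ContinuousMap.dist_apply_le_dist (f := v) (g := w) t
    | succ n ih =>
      intro t
      rw [Function.iterate_succ_apply', Function.iterate_succ_apply']
      set v' := Φ^[n] v
      set w' := Φ^[n] w
      have e : (Φ v') t - (Φ w') t =
          ∫ s in (0 : ℝ)..t, (A s (P v' s) - A s (P w' s)) := by
        simp only [Φ, ContinuousMap.coe_mk, add_sub_add_left_eq_sub]
        rw [← intervalIntegral.integral_sub (hPi v' t t.2) (hPi w' t t.2)]
        simp only [add_sub_add_right_eq_sub]
      have hb : ∀ s ∈ Ioc (0 : ℝ) t, ‖A s (P v' s) - A s (P w' s)‖ ≤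
          C * ((C * s) ^ n / n.factorial * dist v w) := by
        intro s hs
        have hs' : s ∈ Icc 0 T := ⟨hs.1.le, hs.2.trans t.2.2⟩
        refine (hA s _ _).trans (mul_le_mul_of_nonneg_left ?_ hC)
        have := ih (projIcc 0 T hT s)
        rw [projIcc_of_mem hT hs'] at this
        simpa only [P, projIcc_of_mem hT hs'] using this
      rw [e]
      refine (intervalIntegral.norm_integral_le_of_norm_le t.2.1 (ae_of_all _ hb)
        ((by fun_prop : Continuous fun s : ℝ =>
          C * ((C * s) ^ n / n.factorial * dist v w)).intervalIntegrable _ _)).trans (le_of_eq ?_)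
      have e2 : ∀ s : ℝ, C * ((C * s) ^ n / n.factorial * dist v w) =
          (C * C ^ n / n.factorial * dist v w) * s ^ n := fun s => by rw [mul_pow]; ring
      simp_rw [e2]
      rw [intervalIntegral.integral_const_mul, integral_pow, Nat.factorial_succ, mul_pow]
      push_cast
      rw [zero_pow (Nat.succ_ne_zero n)]
      field_simp
      ring
  -- Some iterate of the Picard map is a contraction for arbitrary `T`, since `(C T)^n / n!` tends
  -- to zero.
  obtain ⟨n, hn⟩ := (FloorSemiring.tendsto_pow_div_factorial_atTop (C * T)
    |>.eventually (gt_mem_nhds zero_lt_one)).exists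
  have hnn : 0 ≤ (C * T) ^ n / n.factorial := by positivity
  have hcontr : ContractingWith ⟨_, hnn⟩ Φ^[n] := by
    refine ⟨by exact_mod_cast hn, LipschitzWith.of_dist_le_mul fun v w => ?_⟩
    rw [ContinuousMap.dist_le (by positivity)]
    intro t
    rw [dist_eq_norm]
    refine (hiter n v w t).trans (mul_le_mul_of_nonneg_right ?_ dist_nonneg)
    change (C * t) ^ n / n.factorial ≤ (C * T) ^ n / n.factorial
    have := t.2.1
    have := t.2.2
    gcongr
  have hfix : Φ (ContractingWith.fixedPoint (Φ^[n]) hcontr) =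
      ContractingWith.fixedPoint (Φ^[n]) hcontr := hcontr.isFixedPt_fixedPoint_iterate
  set v := ContractingWith.fixedPoint (Φ^[n]) hcontr
  refine ⟨P v, hP v, fun t ht => ?_⟩
  have := congrArg (fun w : C(Icc (0 : ℝ) T, X) => w ⟨t, ht⟩) hfix
  simp only [P, projIcc_of_mem hT ht]
  exact this.symm

/-! ### Time dependent coefficients -/

/-- `g` is jointly measurable and its spatial derivatives up to order `r` are bounded by `K`. -/
def TimeCoeff (K : ℝ) (r : ℕ) (g : ℝ → ℝ → ℝ) : Prop :=
  Measurable (fun p : ℝ × ℝ => g p.1 p.2) ∧ ∀ t, BddDeriv K r (g t)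

/-- Spatial derivatives are limits of difference quotients along the steps `1 / (n + 1)`, so joint
measurability passes to them. -/
theorem TimeCoeff.measurable_iteratedDeriv {K : ℝ} {r : ℕ} {g : ℝ → ℝ → ℝ}
    (hg : TimeCoeff K r g) {j : ℕ} (hj : j ≤ r) :
    Measurable (fun p : ℝ × ℝ => iteratedDeriv j (g p.1) p.2) := by
  induction j with
  | zero => simpa using hg.1
  | succ j ih =>
    have h0 := ih (by omega)
    refine measurable_of_tendsto_metrizable (f := fun (n : ℕ) (p : ℝ × ℝ) =>
      (1 / ((n : ℝ) + 1))⁻¹ * (iteratedDeriv j (g p.1) (p.2 + 1 / ((n : ℝ) + 1)) -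
        iteratedDeriv j (g p.1) p.2)) (fun n => ?_) ?_
    · refine Measurable.const_mul (Measurable.sub ?_ h0) _
      exact h0.comp (measurable_fst.prodMk (measurable_snd.add_const _))
    · rw [tendsto_pi_nhds]
      intro p
      have h1 := hasDerivAt_iff_tendsto_slope_zero.1 ((hg.2 p.1).hasDerivAt (by omega : j < r) p.2)
      have h2 : Tendsto (fun n : ℕ => 1 / ((n : ℝ) + 1)) atTop (𝓝[≠] 0) :=
        tendsto_nhdsWithin_iff.2 ⟨tendsto_one_div_add_atTop_nhds_zero_nat,
          Eventually.of_forall fun n => by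
            have : (0 : ℝ) < 1 / ((n : ℝ) + 1) := by positivity
            exact this.ne'⟩
      exact h1.comp h2

/-! ### Measurability in time of the operators -/

instance secondCountable_L2 : SecondCountableTopology L2 :=
  have : Fact ((2 : ℝ≥0∞) ≠ ⊤) := ⟨by simp⟩
  inferInstanceAs (SecondCountableTopology (Lp ℝ 2 (volume : Measure ℝ)))

theorem stronglyMeasurable_mulL2 {K : ℝ} {g : ℝ → ℝ → ℝ}
    (hg : Measurable (fun p : ℝ × ℝ => g p.1 p.2)) (hK : ∀ t, IsMul K (g t)) {x : ℝ → L2}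
    (hx : StronglyMeasurable x) : StronglyMeasurable (fun t => mulL2 (g t) (x t)) := by
  have h1 : ∀ y : L2, StronglyMeasurable (fun t => mulL2 (g t) y) := by
    intro y
    refine stronglyMeasurable_of_inner fun e => ?_
    simp only [inner_mulL2_eq_integral (hK _)]
    have : StronglyMeasurable (fun p : ℝ × ℝ => g p.1 p.2 * y p.2 * e p.2) :=
      (hg.stronglyMeasurable.mul ((Lp.stronglyMeasurable y).comp_measurable measurable_snd)).mul
        ((Lp.stronglyMeasurable e).comp_measurable measurable_snd)
    exact (this.integral_prod_right (ν := volume)).measurable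
  -- Self-adjointness moves the multiplier onto the constant vector `e`, the case already settled by
  -- Fubini.
  refine stronglyMeasurable_of_inner fun e => ?_
  simp only [inner_mulL2_left (hK _)]
  exact (hx.inner (h1 e)).measurable

theorem stronglyMeasurable_leib {K : ℝ} {r : ℕ} {g : ℝ → ℝ → ℝ} (hg : TimeCoeff K r g)
    {w : ℝ → ℕ → L2} {j : ℕ} (hj : j ≤ r) (hw : ∀ i ≤ j, StronglyMeasurable fun t => w t i) :
    StronglyMeasurable (fun t => leib (g t) (w t) j) := by
  unfold leib
  refine Finset.stronglyMeasurable_fun_sum _ fun p hp => ?_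
  have hp' := Finset.HasAntidiagonal.mem_antidiagonal.1 hp
  exact (stronglyMeasurable_mulL2 (hg.measurable_iteratedDeriv (by omega))
    (fun t => (hg.2 t).isMul (by omega)) (hw p.2 (by omega))).const_smul (j.choose p.1)

section

variable {ν : Measure ℝ} {μ₀ μ₂ : ℝ≥0}

theorem continuous_diffQ (r : ℝ) : Continuous (diffQ r) := (diffQL r).continuous

theorem stronglyMeasurable_schemeOp (hν : LevyMoments ν μ₀ μ₂) {n : ℕ} (hn : 1 ≤ n) {K : ℝ}
    {r : ℕ} {a b c : ℝ → ℝ → ℝ} (ha : TimeCoeff K r a) (hb : TimeCoeff K r b)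
    (hc : TimeCoeff K r c) {w : ℝ → ℕ → L2} {j : ℕ} (hj : j ≤ r)
    (hw : ∀ i ≤ j, StronglyMeasurable fun t => w t i) :
    StronglyMeasurable (fun t => schemeOp ν (1 / (n : ℝ)) (a t) (b t) (c t) (w t) j) := by
  obtain ⟨C, -, hC⟩ := transOp_opJh hν hn
  have hl : ∀ h, Continuous (lap h) := fun h => (continuous_diffQ _).comp (continuous_diffQ _)
  have hs : ∀ h, Continuous (symDiffQ h) := fun h =>
    ((continuous_diffQ h).add (continuous_diffQ (-h))).const_smul (2 : ℝ)⁻¹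
  exact (((stronglyMeasurable_leib ha hj fun i hi =>
      (hl _).comp_stronglyMeasurable (hw i hi)).add
    (stronglyMeasurable_leib hb hj fun i hi => (hs _).comp_stronglyMeasurable (hw i hi))).add
    (stronglyMeasurable_leib hc hj hw)).add (hC.continuous.comp_stronglyMeasurable (hw j le_rfl))

theorem integrable_schemeOp (hν : LevyMoments ν μ₀ μ₂) {n : ℕ} (hn : 1 ≤ n) {K : ℝ}
    {r : ℕ} {a b c : ℝ → ℝ → ℝ} (ha : TimeCoeff K r a) (hb : TimeCoeff K r b)
    (hc : TimeCoeff K r c) {w : ℝ → ℕ → L2} {j : ℕ} (hj : j ≤ r)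
    (hw : ∀ i ≤ j, Continuous fun t => w t i) (s t : ℝ) :
    IntervalIntegrable (fun t => schemeOp ν (1 / (n : ℝ)) (a t) (b t) (c t) (w t) j)
      volume s t := by
  obtain ⟨C, hC0, hC⟩ := schemeOp_bound hν hn K r
  have h1 : Continuous fun t => C * ∑ i ∈ Finset.range (j + 1), ‖w t i‖ :=
    continuous_const.mul (continuous_finsetSum _ fun i hi =>
      (hw i (by simpa [Nat.lt_succ_iff] using hi)).norm)
  refine (h1.intervalIntegrable s t).mono_fun
    (stronglyMeasurable_schemeOp hν hn ha hb hc hj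
      fun i hi => (hw i hi).stronglyMeasurable).aestronglyMeasurable (ae_of_all _ fun t => ?_)
  refine (hC _ _ _ (ha.2 t) (hb.2 t) (hc.2 t) (w t) j hj
    (∑ i ∈ Finset.range (j + 1), ‖w t i‖) fun i hi => ?_).trans (le_abs_self _)
  exact Finset.single_le_sum (f := fun i => ‖w t i‖) (fun i _ => norm_nonneg _)
    (Finset.mem_range.2 (by omega))

/-! ### The energy bound -/

/-- The exponential rate of the energy bound. -/
def energyRate (r : ℕ) (K : ℝ) : ℝ := (r + 1) * (20 * 2 ^ r * K) + 1

/-- The energy identities of all components are summed before Grönwall is applied, because the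
stability bound for order `j` involves all lower orders. It is used with `l = m` for the uniform
bound, `l = 0` for uniqueness, and `l = m - 3` for comparing meshes. -/
theorem energy_bound (hν : LevyMoments ν μ₀ μ₂) {n : ℕ} (hn : 1 ≤ n) {K T : ℝ} (hT : 0 ≤ T)
    {r l : ℕ} (hr : 3 ≤ r) (hl : l ≤ r) {a b c : ℝ → ℝ → ℝ} (ha : TimeCoeff K r a)
    (hb : TimeCoeff K r b) (hc : TimeCoeff K r c) (ha0 : ∀ t x, 0 ≤ a t x)
    {v F : ℝ → ℕ → L2} {ψ : ℕ → L2} (hv : ∀ t, ∀ j < l, HasD (v t j) (v t (j + 1)))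
    (hG : ∀ j ≤ l, IntervalIntegrable (fun s =>
      schemeOp ν (1 / (n : ℝ)) (a s) (b s) (c s) (v s) j + F s j) volume 0 T)
    (heq : ∀ j ≤ l, ∀ t ∈ Icc 0 T, v t j = ψ j + ∫ s in (0 : ℝ)..t,
      (schemeOp ν (1 / (n : ℝ)) (a s) (b s) (c s) (v s) j + F s j))
    (hF : ∀ j ≤ l, IntervalIntegrable (fun s => ‖F s j‖ ^ 2) volume 0 T) :
    ∀ t ∈ Icc 0 T, ∑ j ∈ Finset.range (l + 1), ‖v t j‖ ^ 2 ≤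
      ((∑ j ∈ Finset.range (l + 1), ‖ψ j‖ ^ 2) +
        ∫ s in (0 : ℝ)..T, ∑ j ∈ Finset.range (l + 1), ‖F s j‖ ^ 2) *
        Real.exp (energyRate r K * t) := by
  have hK := (ha.2 0).isMul_zero.nonneg
  have hmem : ∀ j ∈ Finset.range (l + 1), j ≤ l := fun j hj => by
    simpa [Nat.lt_succ_iff] using hj
  set R := Finset.range (l + 1)
  set G : ℝ → ℕ → L2 := fun s j =>
    schemeOp ν (1 / (n : ℝ)) (a s) (b s) (c s) (v s) j + F s j
  have hE := fun j (hj : j ≤ l) => norm_sq_primitive hT (hG j hj) (heq j hj)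
  have hyc : ContinuousOn (fun t => ∑ j ∈ R, ‖v t j‖ ^ 2) (Icc 0 T) :=
    continuousOn_finsetSum _ fun j hj => ((hE j (hmem j hj)).1.norm.pow 2)
  have hFs : IntervalIntegrable (fun s => ∑ j ∈ R, ‖F s j‖ ^ 2) volume 0 T := by
    have := IntervalIntegrable.sum R (f := fun j s => ‖F s j‖ ^ 2) fun j hj => hF j (hmem j hj)
    simpa [Finset.sum_fn] using this
  have hrate : 0 ≤ energyRate r K := by unfold energyRate; positivity
  refine le_exp_of_le_integral hrate hyc fun t ht => ?_
  have hsub : uIcc 0 t ⊆ uIcc 0 T :=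
    uIcc_subset_uIcc left_mem_uIcc (by rwa [uIcc_of_le hT])
  have hyi : IntervalIntegrable (fun t => ∑ j ∈ R, ‖v t j‖ ^ 2) volume 0 t :=
    (hyc.mono (by rw [uIcc_of_le ht.1]; exact Icc_subset_Icc_right ht.2)).intervalIntegrable
  have hsum : IntervalIntegrable (fun s => ∑ j ∈ R, 2 * inner ℝ (G s j) (v s j)) volume 0 t := by
    have := IntervalIntegrable.sum R (f := fun j s => 2 * inner ℝ (G s j) (v s j))
      fun j hj => ((hE j (hmem j hj)).2.1.mono_set hsub).const_mul 2
    simpa [Finset.sum_fn] using this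
  have e1 : ∑ j ∈ R, ‖v t j‖ ^ 2 = (∑ j ∈ R, ‖ψ j‖ ^ 2) +
      ∫ s in (0 : ℝ)..t, ∑ j ∈ R, 2 * inner ℝ (G s j) (v s j) := by
    rw [intervalIntegral.integral_finsetSum fun j hj =>
      ((hE j (hmem j hj)).2.1.mono_set hsub).const_mul 2, ← Finset.sum_add_distrib]
    refine Finset.sum_congr rfl fun j hj => ?_
    rw [(hE j (hmem j hj)).2.2 t ht, intervalIntegral.integral_const_mul]
  have hpt : ∀ s ∈ Icc 0 t, ∑ j ∈ R, 2 * inner ℝ (G s j) (v s j) ≤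
      energyRate r K * (∑ j ∈ R, ‖v s j‖ ^ 2) + ∑ j ∈ R, ‖F s j‖ ^ 2 := by
    intro s _
    set y := ∑ j ∈ R, ‖v s j‖ ^ 2 with hy
    have hy0 : 0 ≤ y := Finset.sum_nonneg fun j _ => sq_nonneg _
    -- Twice the stability constant `10` gives `20`; the term `‖v s j‖ ^ 2` comes from Young's
    -- inequality for the free term and is the `+ 1` in `energyRate`.
    have h1 : ∀ j ∈ R, 2 * inner ℝ (G s j) (v s j) ≤
        20 * 2 ^ r * K * y + ‖v s j‖ ^ 2 + ‖F s j‖ ^ 2 := by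
      intro j hj
      have hj' := hmem j hj
      have h2 := inner_schemeOp_le hν hn hr (ha.2 s) (hb.2 s) (hc.2 s) (ha0 s) (w := v s)
        (hj'.trans hl) fun i hi => hv s i (by omega)
      have h3 : ∑ i ∈ Finset.range (j + 1), ‖v s i‖ ^ 2 ≤ y :=
        Finset.sum_le_sum_of_subset_of_nonneg (Finset.range_mono (by omega))
          fun i _ _ => sq_nonneg _
      have h4 := mul_le_mul_of_nonneg_left h3 (by positivity : 0 ≤ 10 * 2 ^ r * K)
      have h5 := real_inner_le_norm (F s j) (v s j)
      have h6 := two_mul_le_add_sq ‖F s j‖ ‖v s j‖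
      simp only [G, inner_add_left]
      linarith
    refine (Finset.sum_le_sum h1).trans ?_
    rw [Finset.sum_add_distrib, Finset.sum_add_distrib, Finset.sum_const, Finset.card_range,
      nsmul_eq_mul, ← hy]
    have h7 : ((l + 1 : ℕ) : ℝ) * (20 * 2 ^ r * K * y) ≤ (r + 1) * (20 * 2 ^ r * K * y) := by
      have : ((l + 1 : ℕ) : ℝ) ≤ r + 1 := by exact_mod_cast Nat.succ_le_succ hl
      gcongr
    unfold energyRate
    linarith
  have hmono := intervalIntegral.integral_mono_on ht.1 hsum
    ((hyi.const_mul (energyRate r K)).add (hFs.mono_set hsub)) hpt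
  rw [intervalIntegral.integral_add (hyi.const_mul _) (hFs.mono_set hsub),
    intervalIntegral.integral_const_mul] at hmono
  have hFt : ∫ s in (0 : ℝ)..t, ∑ j ∈ R, ‖F s j‖ ^ 2 ≤
      ∫ s in (0 : ℝ)..T, ∑ j ∈ R, ‖F s j‖ ^ 2 := by
    refine intervalIntegral.integral_mono_interval le_rfl ht.1 ht.2
      (ae_of_all _ fun s => Finset.sum_nonneg fun j _ => sq_nonneg _) hFs
  rw [e1]
  linarith

/-! ### Sobolev spaces -/

/-- The `j`-th derivative of `w ∈ H^m`, and `0` for `j > m`. -/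
def comp {m : ℕ} (w : SobolevH m) (j : ℕ) : L2 := if h : j < m + 1 then w.1 ⟨j, h⟩ else 0

theorem comp_zero {m : ℕ} (w : SobolevH m) : comp w 0 = toL2 w := by
  rw [comp, dif_pos (Nat.succ_pos m)]; rfl

/-- `comp` as a continuous linear map. -/
def compL (m j : ℕ) : SobolevH m →L[ℝ] L2 :=
  if h : j < m + 1 then (PiLp.proj 2 (fun _ : Fin (m + 1) => L2) (⟨j, h⟩ : Fin (m + 1))).comp
    (SobolevH m).subtypeL else 0

theorem compL_apply {m : ℕ} (j : ℕ) (w : SobolevH m) : compL m j w = comp w j := by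
  unfold compL comp
  split_ifs <;> rfl

theorem norm_sq_eq_sum_comp {m : ℕ} (w : SobolevH m) :
    ‖w‖ ^ 2 = ∑ j ∈ Finset.range (m + 1), ‖comp w j‖ ^ 2 := by
  have h := PiLp.norm_sq_eq_of_L2 (fun _ : Fin (m + 1) => L2) w.1
  rw [Finset.sum_range]
  refine h.trans (Finset.sum_congr rfl fun j _ => ?_)
  rw [comp, dif_pos j.2]

theorem inner_eq_sum_comp {m : ℕ} (w z : SobolevH m) :
    inner ℝ w z = ∑ j ∈ Finset.range (m + 1), inner ℝ (comp w j) (comp z j) := by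
  have h := PiLp.inner_apply (𝕜 := ℝ) w.1 z.1
  rw [Finset.sum_range]
  refine h.trans (Finset.sum_congr rfl fun j _ => ?_)
  rw [comp, comp, dif_pos j.2, dif_pos j.2]

theorem norm_comp_le {m : ℕ} (w : SobolevH m) (j : ℕ) : ‖comp w j‖ ≤ ‖w‖ := by
  by_cases h : j < m + 1
  · refine (sq_le_sq₀ (norm_nonneg _) (norm_nonneg _)).1 ?_
    rw [norm_sq_eq_sum_comp w]
    exact Finset.single_le_sum (f := fun j => ‖comp w j‖ ^ 2) (fun i _ => sq_nonneg _)
      (Finset.mem_range.2 h)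
  · rw [comp, dif_neg h, norm_zero]
    exact norm_nonneg _

theorem hasD_comp {m : ℕ} (w : SobolevH m) {j : ℕ} (hj : j < m) :
    HasD (comp w j) (comp w (j + 1)) := by
  have h1 := w.2 ⟨j, by omega⟩
  have h2 := w.2 ⟨j + 1, by omega⟩
  rw [comp, comp, dif_pos (by omega), dif_pos (by omega)]
  exact IsWeakDeriv.hasD_of_succ h1 h2

/-- The element of `H^m` with derivatives `x 0, …, x m`. -/
def mkSobolev (m : ℕ) (x : ℕ → L2) (hx : ∀ j < m, HasD (x j) (x (j + 1))) : SobolevH m :=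
  ⟨WithLp.toLp 2 fun j : Fin (m + 1) => x j, by
    have h : ∀ j, j ≤ m → IsWeakDeriv j (x 0) (x j) := by
      intro j
      induction j with
      | zero => exact fun _ => isWeakDeriv_zero _
      | succ j ih => exact fun hj => (ih (by omega)).succ (hx j (by omega))
    exact fun j => h j (Nat.lt_succ_iff.1 j.2)⟩

theorem comp_mkSobolev {m : ℕ} {x : ℕ → L2} (hx : ∀ j < m, HasD (x j) (x (j + 1))) {j : ℕ}
    (hj : j ≤ m) : comp (mkSobolev m x hx) j = x j := by
  rw [comp, dif_pos (by omega)]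
  rfl

theorem isClosed_sobolevH (m : ℕ) :
    IsClosed (SobolevH m : Set (PiLp 2 (fun _ : Fin (m + 1) => L2))) := by
  have e : (SobolevH m : Set (PiLp 2 (fun _ : Fin (m + 1) => L2))) =
      ⋂ j : Fin (m + 1), {w | IsWeakDeriv j (w 0) (w j)} := by
    ext w
    rw [mem_iInter]
    exact Iff.rfl
  rw [e]
  refine isClosed_iInter fun j => ?_
  have hc : ∀ i : Fin (m + 1), Continuous fun w : PiLp 2 (fun _ : Fin (m + 1) => L2) => w i :=
    fun i => PiLp.continuous_apply 2 (fun _ : Fin (m + 1) => L2) i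
  exact IsClosed.preimage ((hc 0).prodMk (hc j)) (isClosed_isWeakDeriv j)

instance completeSpace_sobolevH (m : ℕ) : CompleteSpace (SobolevH m) :=
  (isClosed_sobolevH m).completeSpace_coe

instance secondCountable_sobolevH (m : ℕ) : SecondCountableTopology (SobolevH m) :=
  have : SecondCountableTopology (PiLp 2 (fun _ : Fin (m + 1) => L2)) :=
    (PiLp.homeomorph 2 (fun _ : Fin (m + 1) => L2)).secondCountableTopology
  inferInstanceAs (SecondCountableTopology
    (SobolevH m : Set (PiLp 2 (fun _ : Fin (m + 1) => L2))))

/-! ### Solvability of the scheme in Sobolev spaces -/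

theorem exists_scheme_solution (hν : LevyMoments ν μ₀ μ₂) {n : ℕ} (hn : 1 ≤ n) {K T : ℝ}
    (hT : 0 ≤ T) {m : ℕ} {a b c : ℝ → ℝ → ℝ} (ha : TimeCoeff K m a)
    (hb : TimeCoeff K m b) (hc : TimeCoeff K m c) (ψ : SobolevH m) {f : ℝ → SobolevH m}
    (hf : IntervalIntegrable f volume 0 T) :
    ∃ v : ℝ → SobolevH m, Continuous v ∧ ∀ j ≤ m, ∀ t ∈ Icc 0 T,
      comp (v t) j = comp ψ j + ∫ s in (0 : ℝ)..t,
        (schemeOp ν (1 / (n : ℝ)) (a s) (b s) (c s) (comp (v s)) j + comp (f s) j) := by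
  obtain ⟨C, hC0, hC⟩ := schemeOp_bound hν hn K m
  have hchain : ∀ t (w : SobolevH m), ∀ j < m,
      HasD (schemeOp ν (1 / (n : ℝ)) (a t) (b t) (c t) (comp w) j)
        (schemeOp ν (1 / (n : ℝ)) (a t) (b t) (c t) (comp w) (j + 1)) := fun t w j hj =>
    hasD_schemeOp hν hn (ha.2 t) (hb.2 t) (hc.2 t) hj fun i hi => hasD_comp w (by omega)
  set A : ℝ → SobolevH m → SobolevH m := fun t w => mkSobolev m _ (hchain t w) with hA
  have hcomp : ∀ t w j, j ≤ m → comp (A t w) j =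
      schemeOp ν (1 / (n : ℝ)) (a t) (b t) (c t) (comp w) j := fun t w j hj =>
    comp_mkSobolev (hchain t w) hj
  have hcs : ∀ (x y : SobolevH m) j, comp (x - y) j = comp x j - comp y j := fun x y j => by
    simp only [← compL_apply, map_sub]
  have hLip : ∀ t x y, ‖A t x - A t y‖ ≤ ((m + 1) * C) * ‖x - y‖ := by
    intro t x y
    refine (sq_le_sq₀ (norm_nonneg _) (by positivity)).1 ?_
    rw [norm_sq_eq_sum_comp]
    have h1 : ∀ j ∈ Finset.range (m + 1), ‖comp (A t x - A t y) j‖ ^ 2 ≤ (C * ‖x - y‖) ^ 2 := by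
      intro j hj
      have hj' : j ≤ m := by simpa [Nat.lt_succ_iff] using hj
      refine pow_le_pow_left₀ (norm_nonneg _) ?_ 2
      rw [hcs, hcomp _ _ _ hj', hcomp _ _ _ hj',
        ← schemeOp_sub hν hn (ha.2 t) (hb.2 t) (hc.2 t) _ _ hj']
      refine hC _ _ _ (ha.2 t) (hb.2 t) (hc.2 t) _ j hj' _ fun i _ => ?_
      rw [← hcs]
      exact norm_comp_le _ _
    refine (Finset.sum_le_card_nsmul _ _ _ h1).trans ?_
    rw [Finset.card_range, nsmul_eq_mul]
    push_cast
    have h2 : (1 : ℝ) ≤ m + 1 := by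
      have : (0 : ℝ) ≤ m := Nat.cast_nonneg m
      linarith
    have h3 : 0 ≤ (C * ‖x - y‖) ^ 2 := sq_nonneg _
    calc _ ≤ ((m : ℝ) + 1) * (((m : ℝ) + 1) * (C * ‖x - y‖) ^ 2) := by
          gcongr
          exact le_mul_of_one_le_left h3 h2
      _ = _ := by ring
  have hA0 : ∀ t, A t 0 = 0 := by
    intro t
    have h1 : ‖A t 0‖ ^ 2 ≤ 0 := by
      rw [norm_sq_eq_sum_comp]
      refine (Finset.sum_eq_zero fun j hj => ?_).le
      have hj' : j ≤ m := by simpa [Nat.lt_succ_iff] using hj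
      rw [hcomp _ _ _ hj']
      have := hC _ _ _ (ha.2 t) (hb.2 t) (hc.2 t) (comp (0 : SobolevH m)) j hj' 0 fun i _ => by
        simp [← compL_apply]
      rw [mul_zero] at this
      rw [norm_le_zero_iff.1 this]
      simp
    exact norm_eq_zero.1 (pow_eq_zero_iff two_ne_zero |>.1 (le_antisymm h1 (sq_nonneg _)))
  have hcc : ∀ v : ℝ → SobolevH m, Continuous v → ∀ i, Continuous fun t => comp (v t) i :=
    fun v hv i => by
      simp only [← compL_apply]
      exact (compL m i).continuous.comp hv
  have hmeas : ∀ v : ℝ → SobolevH m, Continuous v →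
      AEStronglyMeasurable (fun t => A t (v t)) volume := by
    intro v hv
    -- `H^m` is separable, so measurability may be checked on inner products, hence component by
    -- component in `L₂`.
    refine (stronglyMeasurable_of_inner fun w => ?_).aestronglyMeasurable
    simp only [inner_eq_sum_comp]
    refine Finset.measurable_fun_sum _ fun j hj => ?_
    have hj' : j ≤ m := by simpa [Nat.lt_succ_iff] using hj
    simp only [hcomp _ _ _ hj']
    exact ((stronglyMeasurable_schemeOp hν hn ha hb hc hj' fun i _ =>
      (hcc v hv i).stronglyMeasurable).inner stronglyMeasurable_const).measurable
  obtain ⟨v, hv, heq⟩ := exists_solution_of_lipschitz hT (by positivity) hLip hA0 hmeas hf ψ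
  refine ⟨v, hv, fun j hj t ht => ?_⟩
  have hsub : uIcc 0 t ⊆ uIcc 0 T :=
    uIcc_subset_uIcc left_mem_uIcc (by rwa [uIcc_of_le hT])
  have hAi : IntervalIntegrable (fun s => A s (v s)) volume 0 t := by
    refine ((continuous_const.mul hv.norm : Continuous fun s =>
      ((m + 1) * C) * ‖v s‖).intervalIntegrable 0 t).mono_fun (hmeas v hv).restrict
      (ae_of_all _ fun s => ?_)
    have := hLip s (v s) 0
    rw [hA0, sub_zero, sub_zero] at this
    exact this.trans (le_abs_self _)
  have h1 := congrArg (compL m j) (heq t ht)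
  rw [map_add, ← (compL m j).intervalIntegral_comp_comm (hAi.add (hf.mono_set hsub))] at h1
  simpa only [map_add, compL_apply, hcomp _ _ _ hj] using h1

end

/-! ### Steklov averages -/

/-- The Steklov average `ε⁻¹ ∫_0^ε u(· + s) ds`. -/
def steklov (ε : ℝ) (u : L2) : L2 := ε⁻¹ • ∫ s in (0 : ℝ)..ε, shift s u

theorem transOp_steklov {ε : ℝ} (hε : 0 < ε) : TransOp 1 (steklov ε) := by
  have h := (TransOp.integral (ρ := (volume : Measure ℝ).restrict (Ioc 0 ε)) (C := fun _ => 1)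
    (B := fun s u => shift s u) (fun s => TransOp.shift s) (integrable_const _)
    (fun u => (continuous_shift u).aestronglyMeasurable)).smul ε⁻¹
  have e : steklov ε = fun u => ε⁻¹ • ∫ s in Ioc (0 : ℝ) ε, shift s u := by
    funext u
    rw [steklov, intervalIntegral.integral_of_le hε.le]
  rw [e]
  refine h.mono (le_of_eq ?_)
  rw [integral_const, abs_of_pos (inv_pos.2 hε)]
  simp [hε.le, hε.ne']

theorem TransOp.comm_diffQ {C : ℝ} {B : L2 → L2} (h : TransOp C B) (r : ℝ) (u : L2) :
    B (diffQ r u) = diffQ r (B u) := by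
  rw [diffQ, diffQ, h.map_smul, h.map_sub, h.comm]

theorem tendsto_steklov (u : L2) : Tendsto (fun ε => steklov ε u) (𝓝[≠] 0) (𝓝 u) := by
  have h1 := ((continuous_shift u).integral_hasStrictDerivAt 0 0).hasDerivAt
  have h2 := hasDerivAt_iff_tendsto_slope_zero.1 h1
  simpa [steklov] using h2

theorem testLp_deriv_steklovTest {φ : ℝ → ℝ} (hφ : IsTest φ) (ε : ℝ) :
    testLp (hφ.steklovTest ε).deriv = testLp hφ - shift (-ε) (testLp hφ) := by
  apply Lp.ext
  rw [← testLp_comp_add]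
  filter_upwards [coeFn_testLp (hφ.steklovTest ε).deriv, coeFn_testLp hφ,
    coeFn_testLp (hφ.comp_add (-ε)), Lp.coeFn_sub (testLp hφ) (testLp (hφ.comp_add (-ε)))]
    with x h1 h2 h3 h4
  rw [h1, h4, Pi.sub_apply, h2, h3, deriv_steklovTest ε hφ.1.continuous, sub_eq_add_neg]
  rfl

theorem inner_steklov_testLp {φ : ℝ → ℝ} (hφ : IsTest φ) (ε : ℝ) (u : L2) :
    inner ℝ (steklov ε u) (testLp hφ) = ε⁻¹ * inner ℝ u (testLp (hφ.steklovTest ε)) := by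
  rw [steklov, inner_smul_left, inner_steklovTest hφ]
  simp only [conj_trivial]
  congr 1
  rw [real_inner_comm]
  refine ((innerSL ℝ (testLp hφ)).intervalIntegral_comp_comm
    ((continuous_shift u).intervalIntegrable _ _)).symm.trans ?_
  simp only [innerSL_apply_apply, real_inner_comm]

/-! ### The energy identity for weak solutions -/

theorem intervalIntegrable_of_bound {X : Type*} [NormedAddCommGroup X] {f : ℝ → X} {C : ℝ}
    (hf : StronglyMeasurable f) (hC : ∀ s, ‖f s‖ ≤ C) (s t : ℝ) :
    IntervalIntegrable f volume s t :=
  (intervalIntegrable_const (c := C)).mono_fun hf.aestronglyMeasurable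
    (ae_of_all _ fun s => (hC s).trans (le_abs_self C))

/-- The term tested against `φ'` lies in no better space than `H^{-1}`, so `w` is not an `L₂`
primitive. Its Steklov average is: averaging turns the derivative into a bounded difference
quotient. The classical identity for the average converges by dominated convergence, with bounds
uniform in `ε` because `w` has the strong derivative `w'`. -/
theorem weak_energy_identity {T M : ℝ} (hT : 0 ≤ T) {w w' k₀ k₁ : ℝ → L2}
    (hw : StronglyMeasurable w) (hk₀ : StronglyMeasurable k₀)
    (hk₁ : StronglyMeasurable k₁) (bw : ∀ s, ‖w s‖ ≤ M) (bw' : ∀ s, ‖w' s‖ ≤ M)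
    (bk₀ : ∀ s, ‖k₀ s‖ ≤ M) (bk₁ : ∀ s, ‖k₁ s‖ ≤ M) (hD : ∀ s, HasD (w s) (w' s))
    (heq : ∀ φ (hφ : IsTest φ), ∀ t ∈ Icc 0 T, inner ℝ (w t) (testLp hφ) =
      ∫ s in (0 : ℝ)..t, (inner ℝ (k₀ s) (testLp hφ) + inner ℝ (k₁ s) (testLp hφ.deriv))) :
    ∀ t ∈ Icc 0 T,
      ‖w t‖ ^ 2 = 2 * ∫ s in (0 : ℝ)..t, (inner ℝ (k₀ s) (w s) + inner ℝ (k₁ s) (w' s)) := by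
  have hM : 0 ≤ M := (norm_nonneg _).trans (bw 0)
  have main : ∀ ε : ℝ, 0 < ε → ∀ t ∈ Icc 0 T, ‖steklov ε (w t)‖ ^ 2 = 2 * ∫ s in (0 : ℝ)..t,
      (inner ℝ (steklov ε (k₀ s)) (steklov ε (w s)) +
        inner ℝ (k₁ s) (steklov ε (diffQ (-ε) (w s)))) := by
    intro ε hε t ht
    have hS := transOp_steklov hε
    have hdc : Continuous (diffQ ε) := continuous_diffQ ε
    have hSm : StronglyMeasurable fun s => steklov ε (k₀ s) :=
      hS.continuous.comp_stronglyMeasurable hk₀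
    have hDm : StronglyMeasurable fun s => diffQ ε (k₁ s) := hdc.comp_stronglyMeasurable hk₁
    have hSi : ∀ t, IntervalIntegrable (fun s => steklov ε (k₀ s)) volume 0 t := fun t =>
      intervalIntegrable_of_bound (C := 1 * M) hSm (fun s => (hS.norm_le _).trans (by
        have := bk₀ s
        gcongr)) 0 t
    have hDi : ∀ t, IntervalIntegrable (fun s => diffQ ε (k₁ s)) volume 0 t := fun t =>
      intervalIntegrable_of_bound (C := |ε⁻¹| * 2 * M) hDm
        (fun s => ((transOp_diffQ ε).norm_le _).trans (by
          have := bk₁ s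
          gcongr)) 0 t
    have hprim : ∀ t ∈ Icc 0 T, steklov ε (w t) =
        0 + ∫ s in (0 : ℝ)..t, (steklov ε (k₀ s) - diffQ ε (k₁ s)) := by
      intro t ht
      refine eq_of_forall_test fun φ hφ => ?_
      have e1 := ((innerSL ℝ (testLp hφ)).intervalIntegral_comp_comm
        ((hSi t).sub (hDi t))).symm
      simp only [innerSL_apply_apply] at e1
      rw [zero_add, inner_steklov_testLp, heq _ (hφ.steklovTest ε) t ht,
        ← intervalIntegral.integral_const_mul, real_inner_comm, e1]
      refine intervalIntegral.integral_congr fun s _ => ?_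
      change ε⁻¹ * (inner ℝ (k₀ s) (testLp (hφ.steklovTest ε)) +
        inner ℝ (k₁ s) (testLp (hφ.steklovTest ε).deriv)) =
          inner ℝ (testLp hφ) (steklov ε (k₀ s) - diffQ ε (k₁ s))
      rw [testLp_deriv_steklovTest hφ, real_inner_comm (steklov ε (k₀ s) - diffQ ε (k₁ s)),
        inner_sub_left, inner_steklov_testLp hφ, diffQ, inner_smul_left, inner_sub_left,
        inner_sub_right, inner_shift_right, neg_neg]
      simp only [conj_trivial]
      ring
    have h := (norm_sq_primitive hT ((hSi T).sub (hDi T)) hprim).2.2 t ht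
    rw [norm_zero, zero_pow two_ne_zero, zero_add] at h
    rw [h]
    congr 1
    refine intervalIntegral.integral_congr fun s _ => ?_
    rw [inner_sub_left, inner_diffQ_left, hS.comm_diffQ]
    ring
  intro t ht
  have hε0 : Tendsto (fun n : ℕ => 1 / ((n : ℝ) + 1)) atTop (𝓝[≠] 0) :=
    tendsto_nhdsWithin_iff.2 ⟨tendsto_one_div_add_atTop_nhds_zero_nat,
      Eventually.of_forall fun n => by
        have : (0 : ℝ) < 1 / ((n : ℝ) + 1) := by positivity
        exact this.ne'⟩
  have hε1 : Tendsto (fun n : ℕ => -(1 / ((n : ℝ) + 1))) atTop (𝓝[≠] 0) := by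
    have h1 : Tendsto (fun n : ℕ => -(1 / ((n : ℝ) + 1))) atTop (𝓝 0) := by
      simpa using (tendsto_one_div_add_atTop_nhds_zero_nat (𝕜 := ℝ)).neg
    exact tendsto_nhdsWithin_iff.2 ⟨h1, Eventually.of_forall fun n => by
        have : (0 : ℝ) < 1 / ((n : ℝ) + 1) := by positivity
        exact (neg_neg_of_pos this).ne⟩
  have hpos : ∀ n : ℕ, (0 : ℝ) < 1 / ((n : ℝ) + 1) := fun n => by positivity
  have l1 : Tendsto (fun n : ℕ => ‖steklov (1 / ((n : ℝ) + 1)) (w t)‖ ^ 2) atTop (𝓝 (‖w t‖ ^ 2)) :=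
    (((tendsto_steklov (w t)).comp hε0).norm).pow 2
  have l2 : Tendsto (fun n : ℕ => ∫ s in (0 : ℝ)..t,
      (inner ℝ (steklov (1 / ((n : ℝ) + 1)) (k₀ s)) (steklov (1 / ((n : ℝ) + 1)) (w s)) +
        inner ℝ (k₁ s) (steklov (1 / ((n : ℝ) + 1)) (diffQ (-(1 / ((n : ℝ) + 1))) (w s)))))
      atTop (𝓝 (∫ s in (0 : ℝ)..t, (inner ℝ (k₀ s) (w s) + inner ℝ (k₁ s) (w' s)))) := by
    refine intervalIntegral.tendsto_integral_filter_of_dominated_convergence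
      (fun _ => M * M + M * M) (Eventually.of_forall fun n => ?_)
      (Eventually.of_forall fun n => ae_of_all _ fun s _ => ?_) intervalIntegrable_const
      (ae_of_all _ fun s _ => ?_)
    · have hc := (transOp_steklov (hpos n)).continuous
      exact (((hc.comp_stronglyMeasurable hk₀).inner (hc.comp_stronglyMeasurable hw)).add
        (hk₁.inner (hc.comp_stronglyMeasurable
          ((continuous_diffQ _).comp_stronglyMeasurable hw)))).aestronglyMeasurable
    · have hn : ∀ x, ‖steklov (1 / ((n : ℝ) + 1)) x‖ ≤ ‖x‖ := fun x => by
        simpa using (transOp_steklov (hpos n)).norm_le x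
      refine (norm_add_le _ _).trans (add_le_add ?_ ?_)
      · exact (norm_inner_le_norm _ _).trans (mul_le_mul ((hn _).trans (bk₀ s))
          ((hn _).trans (bw s)) (norm_nonneg _) hM)
      · exact (norm_inner_le_norm _ _).trans (mul_le_mul (bk₁ s)
          ((hn _).trans (((hD s).norm_diffQ_le _).trans (bw' s))) (norm_nonneg _) hM)
    · refine Tendsto.add (((tendsto_steklov _).comp hε0).inner ((tendsto_steklov _).comp hε0))
        (tendsto_const_nhds.inner ?_)
      have d1 : Tendsto (fun n : ℕ => steklov (1 / ((n : ℝ) + 1)) (w' s)) atTop (𝓝 (w' s)) :=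
        (tendsto_steklov _).comp hε0
      have d2 : Tendsto (fun n : ℕ => ‖diffQ (-(1 / ((n : ℝ) + 1))) (w s) - w' s‖)
          atTop (𝓝 0) :=
        tendsto_iff_norm_sub_tendsto_zero.1 ((hD s).tendsto.comp hε1)
      -- The averaging operator and its argument vary together; contractivity of the averages
      -- separates the two limits.
      have d3 : Tendsto (fun n : ℕ => steklov (1 / ((n : ℝ) + 1))
          (diffQ (-(1 / ((n : ℝ) + 1))) (w s)) - steklov (1 / ((n : ℝ) + 1)) (w' s))
          atTop (𝓝 0) := by
        refine squeeze_zero_norm (fun n => ?_) d2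
        rw [← (transOp_steklov (hpos n)).map_sub]
        simpa using (transOp_steklov (hpos n)).norm_le _
      simpa using d3.add d1
  exact tendsto_nhds_unique (l1.congr fun n => main _ (hpos n) t ht) (l2.const_mul 2)

/-! ### Schemes with different meshes -/

theorem comp_sub {m : ℕ} (x y : SobolevH m) (j : ℕ) : comp (x - y) j = comp x j - comp y j := by
  simp only [← compL_apply, map_sub]

theorem continuous_comp {m : ℕ} (j : ℕ) : Continuous fun w : SobolevH m => comp w j := by
  have h := (compL m j).continuous
  rwa [show ⇑(compL m j) = fun w => comp w j from funext (compL_apply j)] at h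

theorem intervalIntegrable_comp {m : ℕ} {f : ℝ → SobolevH m} {s t : ℝ}
    (hf : IntervalIntegrable f volume s t) (j : ℕ) :
    IntervalIntegrable (fun r => comp (f r) j) volume s t :=
  hf.mono_fun ((continuous_comp j).comp_aestronglyMeasurable hf.aestronglyMeasurable_restrict_uIoc)
    (ae_of_all _ fun _ => norm_comp_le _ _)

theorem intervalIntegrable_of_norm_sq {X : Type*} [NormedAddCommGroup X] {f : ℝ → X} {s t : ℝ}
    (hf : StronglyMeasurable f) (h : IntervalIntegrable (fun r => ‖f r‖ ^ 2) volume s t) :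
    IntervalIntegrable f volume s t := by
  refine ((intervalIntegrable_const (c := (1 : ℝ))).add h).mono_fun hf.aestronglyMeasurable
    (ae_of_all _ fun r => ?_)
  simp only
  rw [Real.norm_of_nonneg (by positivity)]
  nlinarith [sq_nonneg (‖f r‖ - 1)]

/-- `v` solves the `H^m`-valued semi-discrete equation with mesh `h`. -/
def IsSchemeSolution (T : ℝ) (ν : Measure ℝ) (h : ℝ) (a b c : ℝ → ℝ → ℝ) {m : ℕ}
    (ψ : SobolevH m) (f : ℝ → SobolevH m) (v : ℝ → SobolevH m) : Prop :=
  Continuous v ∧ ∀ j ≤ m, ∀ t ∈ Icc 0 T, comp (v t) j = comp ψ j + ∫ s in (0 : ℝ)..t,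
    (schemeOp ν h (a s) (b s) (c s) (comp (v s)) j + comp (f s) j)

section

variable {ν : Measure ℝ} {μ₀ μ₂ : ℝ≥0}

theorem exists_bounded_scheme_solution (hν : LevyMoments ν μ₀ μ₂) {n : ℕ} (hn : 1 ≤ n) {K T : ℝ}
    (hT : 0 ≤ T) {m : ℕ} (hm : 3 ≤ m) {a b c : ℝ → ℝ → ℝ} (ha : TimeCoeff K m a)
    (hb : TimeCoeff K m b) (hc : TimeCoeff K m c) (ha0 : ∀ t x, 0 ≤ a t x) (ψ : SobolevH m)
    {f : ℝ → SobolevH m} (hfm : StronglyMeasurable f)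
    (hf : IntervalIntegrable (fun s => ‖f s‖ ^ 2) volume 0 T) :
    ∃ v, IsSchemeSolution T ν (1 / (n : ℝ)) a b c ψ f v ∧
      ∀ t, ‖v t‖ ^ 2 ≤ dataNormSq T ψ f * Real.exp (energyRate m K * T) := by
  have hK := (ha.2 0).isMul_zero.nonneg
  have hfi := intervalIntegrable_of_norm_sq hfm hf
  obtain ⟨v, hv, heq⟩ := exists_scheme_solution hν hn hT ha hb hc ψ hfi
  have hcf : ∀ j, StronglyMeasurable fun s => comp (f s) j := fun j =>
    (continuous_comp j).comp_stronglyMeasurable hfm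
  have hcf2 : ∀ j, IntervalIntegrable (fun s => ‖comp (f s) j‖ ^ 2) volume 0 T := fun j =>
    hf.mono_fun ((hcf j).norm.pow 2).aestronglyMeasurable (ae_of_all _ fun s => by
      simp only [norm_pow, norm_norm]
      have := norm_comp_le (f s) j
      gcongr)
  have hE := energy_bound hν hn hT hm le_rfl ha hb hc ha0 (v := fun t => comp (v t))
    (F := fun s => comp (f s)) (ψ := comp ψ) (fun t j hj => hasD_comp (v t) hj)
    (fun j hj => (integrable_schemeOp hν hn ha hb hc hj
      (fun i _ => (continuous_comp i).comp hv) 0 T).add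
        (intervalIntegrable_of_norm_sq (hcf j) (hcf2 j))) heq fun j _ => hcf2 j
  simp only [← norm_sq_eq_sum_comp] at hE
  -- Freezing the solution outside `[0, T]` makes the bound valid for all real times.
  refine ⟨fun t => v (clamp T t), ⟨hv.comp (continuous_clamp T), fun j hj t ht => ?_⟩, fun t => ?_⟩
  · simp only
    rw [clamp_eq ht, heq j hj t ht]
    congr 1
    refine intervalIntegral.integral_congr fun s hs => ?_
    rw [uIcc_of_le ht.1] at hs
    simp only [clamp_eq (⟨hs.1, hs.2.trans ht.2⟩ : s ∈ Icc 0 T)]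
  · have hmem := clamp_mem hT t
    refine (hE _ hmem).trans (mul_le_mul_of_nonneg_left (Real.exp_le_exp.2
      (mul_le_mul_of_nonneg_left hmem.2 ?_)) ?_)
    · unfold energyRate; positivity
    · exact add_nonneg (sq_nonneg _)
        (intervalIntegral.integral_nonneg hT fun s _ => sq_nonneg _)

/-- Uniqueness in `L₂`: the difference solves the scheme with zero data, and the energy bound with
`l = 0` asks for no derivatives. Only index `0` enters, so the constant family `fun _ => uh s` is
admissible. -/
theorem IsSchemeSolution.eq_comp_zero (hν : LevyMoments ν μ₀ μ₂) {n : ℕ} (hn : 1 ≤ n) {K T : ℝ}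
    (hT : 0 ≤ T) {m : ℕ} (hm : 3 ≤ m) {a b c : ℝ → ℝ → ℝ} (ha : TimeCoeff K m a)
    (hb : TimeCoeff K m b) (hc : TimeCoeff K m c) (ha0 : ∀ t x, 0 ≤ a t x) {ψ : SobolevH m}
    {f : ℝ → SobolevH m} (hf : IntervalIntegrable f volume 0 T) {v : ℝ → SobolevH m}
    (hv : IsSchemeSolution T ν (1 / (n : ℝ)) a b c ψ f v) {uh : ℝ → L2} (huh : Continuous uh)
    (heq : ∀ t ∈ Icc 0 T, uh t = toL2 ψ + ∫ s in (0 : ℝ)..t,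
      (opLh (1 / (n : ℝ)) (a s) (b s) (c s) (uh s) + opJh ν (1 / (n : ℝ)) (uh s) + toL2 (f s))) :
    ∀ t ∈ Icc 0 T, uh t = comp (v t) 0 := by
  have hcv : ∀ i, Continuous fun t => comp (v t) i := fun i => (continuous_comp i).comp hv.1
  have hcf := intervalIntegrable_comp hf 0
  have hS1 : ∀ t, IntervalIntegrable (fun s => schemeOp ν (1 / (n : ℝ)) (a s) (b s) (c s)
      (fun _ => uh s) 0) volume 0 t :=
    integrable_schemeOp hν hn ha hb hc (Nat.zero_le m) (fun i _ => huh) 0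
  have hS2 : ∀ t, IntervalIntegrable (fun s => schemeOp ν (1 / (n : ℝ)) (a s) (b s) (c s)
      (comp (v s)) 0) volume 0 t :=
    integrable_schemeOp hν hn ha hb hc (Nat.zero_le m) (fun i _ => hcv i) 0
  have hsub : ∀ s, schemeOp ν (1 / (n : ℝ)) (a s) (b s) (c s)
      (fun i => uh s - comp (v s) i) 0 + 0 =
      (schemeOp ν (1 / (n : ℝ)) (a s) (b s) (c s) (fun _ => uh s) 0 + comp (f s) 0) -
        (schemeOp ν (1 / (n : ℝ)) (a s) (b s) (c s) (comp (v s)) 0 + comp (f s) 0) := fun s => by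
    rw [schemeOp_sub hν hn (ha.2 s) (hb.2 s) (hc.2 s) (fun _ => uh s) (comp (v s))
      (Nat.zero_le m)]
    abel
  have hE := energy_bound hν hn hT hm (Nat.zero_le m) ha hb hc ha0
    (v := fun t i => uh t - comp (v t) i) (F := fun _ _ => 0) (ψ := fun _ => 0)
    (fun t j hj => absurd hj (Nat.not_lt_zero j)) (fun j hj => by
      obtain rfl := Nat.le_zero.1 hj
      simp only [hsub]
      exact ((hS1 T).add hcf).sub ((hS2 T).add hcf)) (fun j hj t ht => by
      obtain rfl := Nat.le_zero.1 hj
      have hft := hcf.mono_set (uIcc_subset_uIcc (b₁ := t) left_mem_uIcc (by rwa [uIcc_of_le hT]))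
      simp only [hsub]
      rw [intervalIntegral.integral_sub ((hS1 t).add hft) ((hS2 t).add hft), heq t ht,
        hv.2 0 (Nat.zero_le m) t ht]
      simp only [schemeOp_zero, comp_zero]
      abel) (fun j _ => by simp)
  intro t ht
  have h := hE t ht
  simp only [zero_add, Finset.range_one, Finset.sum_singleton, norm_zero, ne_eq,
    OfNat.ofNat_ne_zero, not_false_eq_true, zero_pow, intervalIntegral.integral_zero,
    zero_mul] at h
  have h0 : ‖uh t - comp (v t) 0‖ = 0 := by
    have := sq_nonneg ‖uh t - comp (v t) 0‖
    exact pow_eq_zero_iff two_ne_zero |>.1 (le_antisymm h this)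
  exact sub_eq_zero.1 (norm_eq_zero.1 h0)

theorem norm_schemeOp_sub_schemeOp_le (hν : LevyMoments ν μ₀ μ₂) {n k : ℕ} (hn : 1 ≤ n)
    (hk : 1 ≤ k) {K : ℝ} {r : ℕ} {a b c : ℝ → ℝ} (ha : BddDeriv K r a) (hb : BddDeriv K r b)
    {w : ℕ → L2} {j : ℕ} (hj : j + 3 ≤ r) (hw : ∀ i < r, HasD (w i) (w (i + 1))) {M : ℝ}
    (hM : ∀ i ≤ r, ‖w i‖ ≤ M) :
    ‖schemeOp ν (1 / (n : ℝ)) a b c w j - schemeOp ν (1 / (k : ℝ)) a b c w j‖ ≤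
      consistencyConst r K μ₀ μ₂ * M * (1 / (n : ℝ) + 1 / (k : ℝ)) := by
  have h1 := norm_schemeOp_sub_limitOp_le hν hn ha hb (c := c) hj hw hM
  have h2 := norm_schemeOp_sub_limitOp_le hν hk ha hb (c := c) hj hw hM
  rw [norm_sub_rev] at h2
  refine (norm_sub_le_norm_sub_add_norm_sub _ (limitOp ν a b c w j) _).trans ?_
  linarith

/-- The difference solves the scheme with mesh `1 / k`, the free term being the difference of the
two scheme operators applied to `v`. Consistency bounds it for orders up to `m - 3`, and a bound on
`v` alone is enough. -/
theorem IsSchemeSolution.sum_norm_sub_sq_le (hν : LevyMoments ν μ₀ μ₂) {n k : ℕ} (hn : 1 ≤ n)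
    (hk : 1 ≤ k) {K T : ℝ} (hT : 0 ≤ T) {m : ℕ} (hm : 3 ≤ m) {a b c : ℝ → ℝ → ℝ}
    (ha : TimeCoeff K m a) (hb : TimeCoeff K m b) (hc : TimeCoeff K m c)
    (ha0 : ∀ t x, 0 ≤ a t x) {ψ : SobolevH m} {f : ℝ → SobolevH m}
    (hf : IntervalIntegrable f volume 0 T) {v v' : ℝ → SobolevH m}
    (hv : IsSchemeSolution T ν (1 / (n : ℝ)) a b c ψ f v)
    (hv' : IsSchemeSolution T ν (1 / (k : ℝ)) a b c ψ f v') {M : ℝ} (hM : ∀ t, ‖v t‖ ≤ M) :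
    ∀ t ∈ Icc 0 T, ∑ j ∈ Finset.range (m - 3 + 1), ‖comp (v t) j - comp (v' t) j‖ ^ 2 ≤
      T * (m + 1) * (consistencyConst m K μ₀ μ₂ * M * (1 / (n : ℝ) + 1 / (k : ℝ))) ^ 2 *
        Real.exp (energyRate m K * T) := by
  have hK := (ha.2 0).isMul_zero.nonneg
  have hcv : ∀ i, Continuous fun t => comp (v t) i := fun i => (continuous_comp i).comp hv.1
  have hcv' : ∀ i, Continuous fun t => comp (v' t) i := fun i => (continuous_comp i).comp hv'.1
  have hcf := intervalIntegrable_comp hf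
  set A : ℝ → ℕ → L2 := fun s => schemeOp ν (1 / (n : ℝ)) (a s) (b s) (c s) (comp (v s)) with hA
  set B : ℝ → ℕ → L2 := fun s => schemeOp ν (1 / (k : ℝ)) (a s) (b s) (c s) (comp (v s)) with hB
  set A' : ℝ → ℕ → L2 := fun s => schemeOp ν (1 / (k : ℝ)) (a s) (b s) (c s) (comp (v' s))
    with hA'
  have iA : ∀ j ≤ m, ∀ t, IntervalIntegrable (fun s => A s j) volume 0 t := fun j hj =>
    integrable_schemeOp hν hn ha hb hc hj (fun i _ => hcv i) 0
  have iA' : ∀ j ≤ m, ∀ t, IntervalIntegrable (fun s => A' s j) volume 0 t := fun j hj =>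
    integrable_schemeOp hν hk ha hb hc hj (fun i _ => hcv' i) 0
  have sA : ∀ j ≤ m, StronglyMeasurable fun s => A s j := fun j hj =>
    stronglyMeasurable_schemeOp hν hn ha hb hc hj fun i _ => (hcv i).stronglyMeasurable
  have sB : ∀ j ≤ m, StronglyMeasurable fun s => B s j := fun j hj =>
    stronglyMeasurable_schemeOp hν hk ha hb hc hj fun i _ => (hcv i).stronglyMeasurable
  set C : ℝ := consistencyConst m K μ₀ μ₂ * M * (1 / (n : ℝ) + 1 / (k : ℝ)) with hC
  have hF : ∀ s, ∀ j ≤ m - 3, ‖A s j - B s j‖ ≤ C := fun s j hj =>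
    norm_schemeOp_sub_schemeOp_le hν hn hk (ha.2 s) (hb.2 s) (w := comp (v s)) (by omega)
      (fun i hi => hasD_comp (v s) hi) fun i _ => (norm_comp_le _ _).trans (hM s)
  have hF2 : ∀ s, ∀ j ≤ m - 3, ‖‖A s j - B s j‖ ^ 2‖ ≤ C ^ 2 := fun s j hj => by
    rw [Real.norm_of_nonneg (by positivity)]
    exact pow_le_pow_left₀ (norm_nonneg _) (hF s j hj) 2
  have hsub : ∀ s, ∀ j ≤ m, schemeOp ν (1 / (k : ℝ)) (a s) (b s) (c s)
      (fun i => comp (v s) i - comp (v' s) i) j + (A s j - B s j) =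
      (A s j + comp (f s) j) - (A' s j + comp (f s) j) := fun s j hj => by
    rw [schemeOp_sub hν hk (ha.2 s) (hb.2 s) (hc.2 s) (comp (v s)) (comp (v' s)) hj]
    simp only [hA', hB]
    abel
  have hE := energy_bound hν hk hT hm (Nat.sub_le m 3) ha hb hc ha0
    (v := fun t i => comp (v t) i - comp (v' t) i) (F := fun s j => A s j - B s j)
    (ψ := fun _ => 0)
    (fun t j hj => (hasD_comp (v t) (by omega)).sub (hasD_comp (v' t) (by omega)))
    (fun j hj => by
      have hj' : j ≤ m := by omega
      simp only [hsub _ j hj']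
      exact ((iA j hj' T).add (hcf j)).sub ((iA' j hj' T).add (hcf j)))
    (fun j hj t ht => by
      have hj' : j ≤ m := by omega
      have hft := (hcf j).mono_set
        (uIcc_subset_uIcc (b₁ := t) left_mem_uIcc (by rwa [uIcc_of_le hT]))
      simp only [hsub _ j hj']
      rw [intervalIntegral.integral_sub ((iA j hj' t).add hft) ((iA' j hj' t).add hft),
        hv.2 j hj' t ht, hv'.2 j hj' t ht]
      abel)
    (fun j hj => intervalIntegrable_of_bound
      (((sA j (by omega)).sub (sB j (by omega))).norm.pow 2) (fun s => hF2 s j hj) 0 T)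
  intro t ht
  refine (hE t ht).trans ?_
  have h1 : ∫ s in (0 : ℝ)..T, ∑ j ∈ Finset.range (m - 3 + 1), ‖A s j - B s j‖ ^ 2 ≤
      T * (m + 1) * C ^ 2 := by
    refine (Real.le_norm_self _).trans ((intervalIntegral.norm_integral_le_of_norm_le_const
      (C := (m + 1) * C ^ 2) fun s _ => ?_).trans (le_of_eq ?_))
    · refine (norm_sum_le_of_le _ fun j hj => hF2 s j ?_).trans ?_
      · simpa [Nat.lt_succ_iff] using hj
      · rw [Finset.sum_const, Finset.card_range, nsmul_eq_mul]
        have : ((m - 3 + 1 : ℕ) : ℝ) ≤ m + 1 := by exact_mod_cast (by omega : m - 3 + 1 ≤ m + 1)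
        gcongr
    · rw [sub_zero, abs_of_nonneg hT]; ring
  have h2 : (0 : ℝ) ≤ energyRate m K := by unfold energyRate; positivity
  simp only [norm_zero, ne_eq, OfNat.ofNat_ne_zero, not_false_eq_true, zero_pow,
    Finset.sum_const_zero, zero_add]
  have := ht.2
  gcongr

end

section

variable {ν : Measure ℝ} {μ₀ μ₂ : ℝ≥0}

/-! ### The weak form of the equation -/

theorem weakZero_sub (hν : LevyMoments ν μ₀ μ₂) {K : ℝ} {a b c : ℝ → ℝ} (ha : BddDeriv K 1 a)
    (hb : IsMul K b) (hc : IsMul K c) (u u' v v' : L2) :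
    weakZero ν a b c (u - u') (v - v') = weakZero ν a b c u v - weakZero ν a b c u' v' := by
  simp only [weakZero, mulL2_sub hb, mulL2_sub hc, mulL2_sub (ha.isMul le_rfl),
    (transOp_largeJump hν measurable_id).map_sub]
  abel

theorem weakOne_sub (hν : LevyMoments ν μ₀ μ₂) {K : ℝ} {a : ℝ → ℝ} (ha : IsMul K a) (v v' : L2) :
    weakOne ν a (v - v') = weakOne ν a v - weakOne ν a v' := by
  simp only [weakOne, mulL2_sub ha, (transOp_smallJump hν).map_sub]
  abel

theorem norm_weakZero_le (hν : LevyMoments ν μ₀ μ₂) {K : ℝ} {a b c : ℝ → ℝ} (ha : BddDeriv K 1 a)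
    (hb : IsMul K b) (hc : IsMul K c) {u v : L2} {M : ℝ} (hu : ‖u‖ ≤ M) (hv : ‖v‖ ≤ M) :
    ‖weakZero ν a b c u v‖ ≤ (3 * K + 2 * μ₀) * M := by
  have hK := hb.nonneg
  have h1 := (norm_mulL2_le hb v).trans (mul_le_mul_of_nonneg_left hv hK)
  have h2 := (norm_mulL2_le (ha.isMul le_rfl) v).trans (mul_le_mul_of_nonneg_left hv hK)
  have h3 := (norm_mulL2_le hc u).trans (mul_le_mul_of_nonneg_left hu hK)
  have h4 := ((transOp_largeJump hν measurable_id).norm_le u).trans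
    (mul_le_mul_of_nonneg_left hu (by positivity))
  refine (norm_add₃_le).trans ?_
  have h5 := norm_sub_le (mulL2 b v) (mulL2 (iteratedDeriv 1 a) v)
  linarith

theorem norm_weakOne_le (hν : LevyMoments ν μ₀ μ₂) {K : ℝ} {a : ℝ → ℝ} (ha : IsMul K a) {v : L2}
    {M : ℝ} (hv : ‖v‖ ≤ M) : ‖weakOne ν a v‖ ≤ (K + μ₂) * M := by
  have h1 := (norm_mulL2_le ha v).trans (mul_le_mul_of_nonneg_left hv ha.nonneg)
  have h2 := ((transOp_smallJump hν).norm_le v).trans (mul_le_mul_of_nonneg_left hv μ₂.2)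
  rw [weakOne, norm_neg]
  refine (norm_add_le _ _).trans ?_
  linarith

theorem stronglyMeasurable_weakZero (hν : LevyMoments ν μ₀ μ₂) {K : ℝ} {r : ℕ} (hr : 1 ≤ r)
    {a b c : ℝ → ℝ → ℝ} (ha : TimeCoeff K r a) (hb : TimeCoeff K r b) (hc : TimeCoeff K r c)
    {u v : ℝ → L2} (hu : StronglyMeasurable u) (hv : StronglyMeasurable v) :
    StronglyMeasurable fun s => weakZero ν (a s) (b s) (c s) (u s) (v s) :=
  (((stronglyMeasurable_mulL2 hb.1 (fun t => (hb.2 t).isMul_zero) hv).sub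
    (stronglyMeasurable_mulL2 (ha.measurable_iteratedDeriv hr) (fun t => (ha.2 t).isMul hr) hv)).add
    (stronglyMeasurable_mulL2 hc.1 (fun t => (hc.2 t).isMul_zero) hu)).add
    ((transOp_largeJump hν measurable_id).continuous.comp_stronglyMeasurable hu)

theorem stronglyMeasurable_weakOne (hν : LevyMoments ν μ₀ μ₂) {K : ℝ} {r : ℕ}
    {a : ℝ → ℝ → ℝ} (ha : TimeCoeff K r a) {v : ℝ → L2} (hv : StronglyMeasurable v) :
    StronglyMeasurable fun s => weakOne ν (a s) (v s) :=
  ((stronglyMeasurable_mulL2 ha.1 (fun t => (ha.2 t).isMul_zero) hv).add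
    ((transOp_smallJump hν).continuous.comp_stronglyMeasurable hv)).neg

theorem intervalIntegrable_inner_const {k : ℝ → L2} {s t : ℝ}
    (hk : IntervalIntegrable k volume s t) (e : L2) :
    IntervalIntegrable (fun r => inner ℝ (k r) e) volume s t := by
  have h := ContinuousLinearMap.integrable_comp (innerSL ℝ e) (intervalIntegrable_iff.1 hk)
  rw [intervalIntegrable_iff]
  simpa only [innerSL_apply_apply, real_inner_comm, IntegrableOn] using h

theorem integral_inner_const {k : ℝ → L2} {s t : ℝ}
    (hk : IntervalIntegrable k volume s t) (e : L2) :
    inner ℝ (∫ r in s..t, k r) e = ∫ r in s..t, inner ℝ (k r) e := by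
  have h := (innerSL ℝ e).intervalIntegral_comp_comm hk
  simp only [innerSL_apply_apply] at h
  rw [real_inner_comm, ← h]
  simp only [real_inner_comm]

/-- The weak form of `du = ((L + J) u + f) dt`, `u_0 = ψ`, for `u` with derivative `u'`. -/
def IsWeakSolution (T : ℝ) (ν : Measure ℝ) (a b c : ℝ → ℝ → ℝ) (ψ : L2) (f u u' : ℝ → L2) :
    Prop :=
  ∀ φ (hφ : IsTest φ), ∀ t ∈ Icc 0 T, inner ℝ (u t) (testLp hφ) = inner ℝ ψ (testLp hφ) +
    ∫ s in (0 : ℝ)..t, (inner ℝ (weakZero ν (a s) (b s) (c s) (u s) (u' s)) (testLp hφ) +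
      inner ℝ (weakOne ν (a s) (u' s)) (testLp hφ.deriv) + inner ℝ (f s) (testLp hφ))

/-- Scheme solutions converge in `L₂` to any bounded weak solution with one spatial derivative. The
difference `w` solves the weak equation with free term `-g`, where `g` is the consistency error of
the scheme solution. -/
theorem IsSchemeSolution.norm_sub_sq_le (hν : LevyMoments ν μ₀ μ₂) {n : ℕ} (hn : 1 ≤ n)
    {K T : ℝ} (hT : 0 ≤ T) {m : ℕ} (hm : 3 ≤ m) {a b c : ℝ → ℝ → ℝ} (ha : TimeCoeff K m a)
    (hb : TimeCoeff K m b) (hc : TimeCoeff K m c) (ha0 : ∀ t x, 0 ≤ a t x) {ψ : SobolevH m}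
    {f : ℝ → SobolevH m} (hf : IntervalIntegrable f volume 0 T) {v : ℝ → SobolevH m}
    (hv : IsSchemeSolution T ν (1 / (n : ℝ)) a b c ψ f v) {M : ℝ} (hM : ∀ t, ‖v t‖ ≤ M)
    {u u' : ℝ → L2} (hu : StronglyMeasurable u) (hu' : StronglyMeasurable u')
    (hD : ∀ t, HasD (u t) (u' t)) {M' : ℝ} (hM' : ∀ t, ‖u t‖ ≤ M') (hM'' : ∀ t, ‖u' t‖ ≤ M')
    (heq : IsWeakSolution T ν a b c (toL2 ψ) (fun s => toL2 (f s)) u u') :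
    ∀ t ∈ Icc 0 T, ‖u t - comp (v t) 0‖ ^ 2 ≤
      T * (consistencyConst m K μ₀ μ₂ * M * (1 / (n : ℝ))) ^ 2 * Real.exp ((4 * K + 1) * T) := by
  have hK := (ha.2 0).isMul_zero.nonneg
  have hcv : ∀ i, Continuous fun t => comp (v t) i := fun i => (continuous_comp i).comp hv.1
  have hcf := intervalIntegrable_comp hf 0
  have ha1 : ∀ s, BddDeriv K 1 (a s) := fun s => (ha.2 s).mono (by omega)
  have hb0 : ∀ s, IsMul K (b s) := fun s => (hb.2 s).isMul_zero
  have hc0 : ∀ s, IsMul K (c s) := fun s => (hc.2 s).isMul_zero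
  have hM0 : 0 ≤ M := (norm_nonneg _).trans (hM 0)
  have hM'0 : 0 ≤ M' := (norm_nonneg _).trans (hM' 0)
  set S : ℝ → L2 := fun s => schemeOp ν (1 / (n : ℝ)) (a s) (b s) (c s) (comp (v s)) 0 with hS
  set w : ℝ → L2 := fun t => u t - comp (v t) 0 with hw
  set w' : ℝ → L2 := fun t => u' t - comp (v t) 1 with hw'
  set g : ℝ → L2 := fun s => S s - limitOp ν (a s) (b s) (c s) (comp (v s)) 0 with hg
  have sS : StronglyMeasurable S := stronglyMeasurable_schemeOp hν hn ha hb hc (Nat.zero_le m)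
    fun i _ => (hcv i).stronglyMeasurable
  have iS : ∀ t, IntervalIntegrable S volume 0 t :=
    integrable_schemeOp hν hn ha hb hc (Nat.zero_le m) (fun i _ => hcv i) 0
  have sL : StronglyMeasurable fun s => limitOp ν (a s) (b s) (c s) (comp (v s)) 0 :=
    (((stronglyMeasurable_leib ha (Nat.zero_le m) fun i _ => (hcv (i + 2)).stronglyMeasurable).add
      (stronglyMeasurable_leib hb (Nat.zero_le m)
        fun i _ => (hcv (i + 1)).stronglyMeasurable)).add
      (stronglyMeasurable_leib hc (Nat.zero_le m) fun i _ => (hcv i).stronglyMeasurable)).add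
      (((transOp_smallJump hν).continuous.comp (hcv 2)).add
        ((transOp_largeJump hν measurable_id).continuous.comp (hcv 0))).stronglyMeasurable
  have sg : StronglyMeasurable g := sS.sub sL
  set G : ℝ := consistencyConst m K μ₀ μ₂ * M * (1 / (n : ℝ)) with hG
  have bg : ∀ s, ‖g s‖ ≤ G := fun s =>
    norm_schemeOp_sub_limitOp_le hν hn (ha.2 s) (hb.2 s) (w := comp (v s)) (by omega)
      (fun i hi => hasD_comp (v s) hi) fun i _ => (norm_comp_le _ _).trans (hM s)
  have hG0 : 0 ≤ G := (norm_nonneg _).trans (bg 0)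
  have sw : StronglyMeasurable w := hu.sub (hcv 0).stronglyMeasurable
  have sw' : StronglyMeasurable w' := hu'.sub (hcv 1).stronglyMeasurable
  have bw : ∀ s, ‖w s‖ ≤ M' + M := fun s => (norm_sub_le _ _).trans
    (add_le_add (hM' s) ((norm_comp_le _ _).trans (hM s)))
  have bw' : ∀ s, ‖w' s‖ ≤ M' + M := fun s => (norm_sub_le _ _).trans
    (add_le_add (hM'' s) ((norm_comp_le _ _).trans (hM s)))
  have hDw : ∀ s, HasD (w s) (w' s) := fun s => (hD s).sub (hasD_comp (v s) (by omega))
  set k₀ : ℝ → L2 := fun s => weakZero ν (a s) (b s) (c s) (w s) (w' s) - g s with hk₀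
  set k₁ : ℝ → L2 := fun s => weakOne ν (a s) (w' s) with hk₁
  have sk₀ : StronglyMeasurable k₀ :=
    (stronglyMeasurable_weakZero hν (by omega) ha hb hc sw sw').sub sg
  have sk₁ : StronglyMeasurable k₁ := stronglyMeasurable_weakOne hν ha sw'
  have bk₀ : ∀ s, ‖k₀ s‖ ≤ (3 * K + 2 * μ₀) * (M' + M) + G := fun s => (norm_sub_le _ _).trans
    (add_le_add (norm_weakZero_le hν (ha1 s) (hb0 s) (hc0 s) (bw s) (bw' s)) (bg s))
  have bk₁ : ∀ s, ‖k₁ s‖ ≤ (K + μ₂) * (M' + M) := fun s =>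
    norm_weakOne_le hν (ha.2 s).isMul_zero (bw' s)
  set M₁ : ℝ := (M' + M) + ((3 * K + 2 * μ₀) * (M' + M) + G) + (K + μ₂) * (M' + M) with hM₁
  have p1 : 0 ≤ (3 * K + 2 * μ₀) * (M' + M) := by positivity
  have p2 : 0 ≤ (K + μ₂) * (M' + M) := by positivity
  have hweak : ∀ φ (hφ : IsTest φ), ∀ t ∈ Icc 0 T, inner ℝ (w t) (testLp hφ) =
      ∫ s in (0 : ℝ)..t, (inner ℝ (k₀ s) (testLp hφ) + inner ℝ (k₁ s) (testLp hφ.deriv)) := by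
    intro φ hφ t ht
    have hft := hcf.mono_set (uIcc_subset_uIcc (b₁ := t) left_mem_uIcc (by rwa [uIcc_of_le hT]))
    have ev := congrArg (fun x => inner ℝ x (testLp hφ)) (hv.2 0 (Nat.zero_le m) t ht)
    simp only [inner_add_left] at ev
    rw [integral_inner_const ((iS t).add hft)] at ev
    have i1 : IntervalIntegrable (fun s =>
        inner ℝ (weakZero ν (a s) (b s) (c s) (u s) (u' s)) (testLp hφ) +
          inner ℝ (weakOne ν (a s) (u' s)) (testLp hφ.deriv) + inner ℝ (toL2 (f s)) (testLp hφ))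
        volume 0 t := by
      simp only [← comp_zero]
      refine ((intervalIntegrable_inner_const (intervalIntegrable_of_bound
        (stronglyMeasurable_weakZero hν (by omega) ha hb hc hu hu')
        (fun s => norm_weakZero_le hν (ha1 s) (hb0 s) (hc0 s) (hM' s) (hM'' s)) 0 t) _).add
        (intervalIntegrable_inner_const (intervalIntegrable_of_bound
          (stronglyMeasurable_weakOne hν ha hu')
          (fun s => norm_weakOne_le hν (ha.2 s).isMul_zero (hM'' s)) 0 t) _)).add
        (intervalIntegrable_inner_const hft _)
    simp only [hw, inner_sub_left]
    rw [heq φ hφ t ht, ev, comp_zero, add_sub_add_left_eq_sub, ← intervalIntegral.integral_sub i1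
      (intervalIntegrable_inner_const ((iS t).add hft) _)]
    refine intervalIntegral.integral_congr fun s _ => ?_
    have e1 := inner_limitOp_zero hν (b := b s) (c := c s) (ha1 s) (w := comp (v s))
      (hasD_comp (v s) (by omega)) (hasD_testLp hφ)
    have e2 := weakZero_sub hν (ha1 s) (hb0 s) (hc0 s) (u s) (comp (v s) 0) (u' s) (comp (v s) 1)
    have e3 := weakOne_sub hν (ha.2 s).isMul_zero (u' s) (comp (v s) 1)
    rw [comp_zero] at e2
    simp only [hk₀, hk₁, hw, hw', hg, hS, e2, e3, inner_sub_left, inner_add_left, comp_zero]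
      at e1 ⊢
    linarith
  have hid := weak_energy_identity hT sw sk₀ sk₁ (M := M₁)
    (fun s => (bw s).trans (by linarith)) (fun s => (bw' s).trans (by linarith))
    (fun s => (bk₀ s).trans (by linarith)) (fun s => (bk₁ s).trans (by linarith)) hDw hweak
  have iE : ∀ t, IntervalIntegrable (fun s => inner ℝ (k₀ s) (w s) + inner ℝ (k₁ s) (w' s))
      volume 0 t := by
    refine intervalIntegrable_of_bound ((sk₀.inner sw).add (sk₁.inner sw'))
      (C := M₁ * M₁ + M₁ * M₁) (fun s => (norm_add_le _ _).trans (add_le_add ?_ ?_)) 0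
    · exact (norm_inner_le_norm _ _).trans (mul_le_mul ((bk₀ s).trans (by linarith))
        ((bw s).trans (by linarith)) (norm_nonneg _) (by linarith))
    · exact (norm_inner_le_norm _ _).trans (mul_le_mul ((bk₁ s).trans (by linarith))
        ((bw' s).trans (by linarith)) (norm_nonneg _) (by linarith))
  have iy : ∀ t, IntervalIntegrable (fun s => ‖w s‖ ^ 2) volume 0 t :=
    intervalIntegrable_of_bound (f := fun s => ‖w s‖ ^ 2) (sw.norm.pow 2) (C := (M' + M) ^ 2)
      (fun s => by
      simp only [norm_pow, norm_norm]
      exact pow_le_pow_left₀ (norm_nonneg _) (bw s) 2) 0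
  -- Only measurability of `u` in time is given; continuity of this norm is read off from the energy
  -- identity.
  have hyc : ContinuousOn (fun t => ‖w t‖ ^ 2) (Icc 0 T) := by
    have h1 := intervalIntegral.continuousOn_primitive_interval' (a := 0) (iE T) left_mem_uIcc
    rw [uIcc_of_le hT] at h1
    exact (h1.const_smul (2 : ℝ)).congr fun t ht => hid t ht
  -- Twice the `2 K` of `inner_weak_le`, plus one from Young's inequality for the consistency error.
  have hgr := le_exp_of_le_integral (N := 4 * K + 1) (α := T * G ^ 2) (by positivity) hyc
    fun t ht => by
      have h1 := intervalIntegral.integral_mono_on ht.1 ((iE t).const_mul 2)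
        (((iy t).const_mul (4 * K + 1)).add (intervalIntegrable_const (c := G ^ 2)))
        fun s _ => by
          have e1 := inner_weak_le hν ((ha.2 s).mono (by omega)) ((hb.2 s).mono (by omega))
            ((hc.2 s).mono (Nat.zero_le m)) (ha0 s) (hDw s)
          have e2 := real_inner_le_norm (-g s) (w s)
          have e3 := mul_le_mul_of_nonneg_right (bg s) (norm_nonneg (w s))
          have e4 := two_mul_le_add_sq G ‖w s‖
          rw [norm_neg, inner_neg_left] at e2
          simp only [hk₀, hk₁, inner_sub_left]
          linarith
      rw [intervalIntegral.integral_add ((iy t).const_mul _) intervalIntegrable_const,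
        intervalIntegral.integral_const_mul, intervalIntegral.integral_const_mul,
        ← hid t ht, intervalIntegral.integral_const, smul_eq_mul, sub_zero] at h1
      have h2 := mul_le_mul_of_nonneg_right ht.2 (sq_nonneg G)
      linarith
  intro t ht
  refine (hgr t ht).trans ?_
  have := ht.2
  gcongr

end

/-- The embedding of `H^m` into `H^l` for `l ≤ m`. -/
def restrictSobolev {m l : ℕ} (h : l ≤ m) (w : SobolevH m) : SobolevH l :=
  mkSobolev l (comp w) fun _ hj => hasD_comp w (hj.trans_le h)

theorem norm_restrictSobolev_sub_sq {m l : ℕ} (h : l ≤ m) (w z : SobolevH m) :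
    ‖restrictSobolev h w - restrictSobolev h z‖ ^ 2 =
      ∑ j ∈ Finset.range (l + 1), ‖comp w j - comp z j‖ ^ 2 := by
  rw [norm_sq_eq_sum_comp]
  refine Finset.sum_congr rfl fun j hj => ?_
  have hj' : j ≤ l := by simpa [Nat.lt_succ_iff] using hj
  rw [comp_sub, restrictSobolev, restrictSobolev, comp_mkSobolev _ hj', comp_mkSobolev _ hj']

/-- The constant in the error estimate. -/
def errorConst (m : ℕ) (T K : ℝ) (μ₀ μ₂ : ℝ≥0) : ℝ :=
  T * (m + 1) * consistencyConst m K μ₀ μ₂ ^ 2 * Real.exp (energyRate m K * T) *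
    Real.exp (energyRate m K * T)

section

variable {ν : Measure ℝ} {μ₀ μ₂ : ℝ≥0}

/-! ### The rate of convergence -/

/-- The solutions with meshes `1 / (k + 1)` are Cauchy in `H^{m-3}`. Their limit `Y` has bottom
component `u t` by `L₂` convergence, so `Y - z` is the required element, and its norm is controlled
by letting `k → ∞` in the two-mesh estimate. -/
theorem IsSchemeSolution.exists_error (hν : LevyMoments ν μ₀ μ₂) {n : ℕ} (hn : 1 ≤ n)
    {K T : ℝ} (hT : 0 ≤ T) {m : ℕ} (hm : 3 ≤ m) {a b c : ℝ → ℝ → ℝ} (ha : TimeCoeff K m a)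
    (hb : TimeCoeff K m b) (hc : TimeCoeff K m c) (ha0 : ∀ t x, 0 ≤ a t x) {ψ : SobolevH m}
    {f : ℝ → SobolevH m} (hfm : StronglyMeasurable f)
    (hf : IntervalIntegrable (fun s => ‖f s‖ ^ 2) volume 0 T) {v : ℝ → SobolevH m}
    (hv : IsSchemeSolution T ν (1 / (n : ℝ)) a b c ψ f v)
    (hvb : ∀ t, ‖v t‖ ^ 2 ≤ dataNormSq T ψ f * Real.exp (energyRate m K * T))
    {u u' : ℝ → L2} (hu : StronglyMeasurable u) (hu' : StronglyMeasurable u')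
    (hD : ∀ t, HasD (u t) (u' t)) {M' : ℝ} (hM' : ∀ t, ‖u t‖ ≤ M') (hM'' : ∀ t, ‖u' t‖ ≤ M')
    (heq : IsWeakSolution T ν a b c (toL2 ψ) (fun s => toL2 (f s)) u u') {t : ℝ}
    (ht : t ∈ Icc 0 T) :
    ∃ e : SobolevH (m - 3), toL2 e = u t - comp (v t) 0 ∧
      ‖e‖ ^ 2 ≤ errorConst m T K μ₀ μ₂ * dataNormSq T ψ f * (1 / (n : ℝ)) := by
  have hfi := intervalIntegrable_of_norm_sq hfm hf
  have h1 : ∀ k : ℕ, 1 ≤ k + 1 := fun k => by omega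
  choose x hx hxb using fun k : ℕ => exists_bounded_scheme_solution hν (h1 k) hT hm ha hb hc ha0 ψ
    hfm hf
  set X : ℝ := Real.exp (energyRate m K * T) with hX
  set B : ℝ := dataNormSq T ψ f * X with hB
  have hB0 : 0 ≤ B := (sq_nonneg _).trans (hvb 0)
  have bx : ∀ k t, ‖x k t‖ ≤ √B := fun k t => Real.le_sqrt_of_sq_le (hxb k t)
  have bv : ∀ t, ‖v t‖ ≤ √B := fun t => Real.le_sqrt_of_sq_le (hvb t)
  set C := consistencyConst m K μ₀ μ₂ with hC
  have hl : m - 3 ≤ m := Nat.sub_le m 3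
  have hε : Tendsto (fun k : ℕ => 1 / ((k + 1 : ℕ) : ℝ)) atTop (𝓝 0) := by
    simpa using tendsto_one_div_add_atTop_nhds_zero_nat (𝕜 := ℝ)
  set y : ℕ → SobolevH (m - 3) := fun k => restrictSobolev hl (x k t) with hy
  set z : SobolevH (m - 3) := restrictSobolev hl (v t) with hz
  have hcauchy : CauchySeq y := by
    set S : ℝ := √(T * (m + 1) * (C * √B) ^ 2 * X) with hS
    refine cauchySeq_of_le_tendsto_0 (fun k : ℕ => S * (2 * (1 / ((k + 1 : ℕ) : ℝ)))) ?_ ?_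
    · intro k l N hk hl'
      have e1 := (hx k).sum_norm_sub_sq_le hν (h1 k) (h1 l) hT hm ha hb hc ha0 hfi (hx l) (bx k)
        t ht
      rw [← norm_restrictSobolev_sub_sq hl] at e1
      have hpos : ∀ k : ℕ, 0 < 1 / ((k + 1 : ℕ) : ℝ) := fun k => pos_mesh (h1 k)
      have hle : ∀ k : ℕ, N ≤ k → 1 / ((k + 1 : ℕ) : ℝ) ≤ 1 / ((N + 1 : ℕ) : ℝ) := fun k hk => by
        have : ((N + 1 : ℕ) : ℝ) ≤ ((k + 1 : ℕ) : ℝ) := by exact_mod_cast Nat.succ_le_succ hk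
        exact one_div_le_one_div_of_le (by positivity) this
      rw [dist_eq_norm]
      refine (sq_le_sq₀ (norm_nonneg _) (by have := hpos N; positivity)).1 (e1.trans ?_)
      rw [mul_pow S, hS, Real.sq_sqrt (by positivity)]
      have h2 : (1 / ((k + 1 : ℕ) : ℝ) + 1 / ((l + 1 : ℕ) : ℝ)) ^ 2 ≤
          (2 * (1 / ((N + 1 : ℕ) : ℝ))) ^ 2 :=
        pow_le_pow_left₀ (add_pos (hpos k) (hpos l)).le
          (by linarith [hle k hk, hle l hl']) 2
      calc _ = T * (m + 1) * (C * √B) ^ 2 * X *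
            (1 / ((k + 1 : ℕ) : ℝ) + 1 / ((l + 1 : ℕ) : ℝ)) ^ 2 := by rw [mul_pow]; ring
        _ ≤ _ := mul_le_mul_of_nonneg_left h2 (by positivity)
    · simpa using (hε.const_mul 2).const_mul S
  obtain ⟨Y, hY⟩ := cauchySeq_tendsto_of_complete hcauchy
  refine ⟨Y - z, ?_, ?_⟩
  · have h2 : Tendsto (fun k => comp (x k t) 0) atTop (𝓝 (comp Y 0)) := by
      refine (((continuous_comp 0).tendsto Y).comp hY).congr fun k => ?_
      simp only [Function.comp_apply, hy, restrictSobolev, comp_mkSobolev _ (Nat.zero_le _)]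
    have h3 : Tendsto (fun k => comp (x k t) 0) atTop (𝓝 (u t)) := by
      rw [tendsto_iff_norm_sub_tendsto_zero]
      have h4 : Tendsto (fun k : ℕ => √(T * (C * √B * (1 / ((k + 1 : ℕ) : ℝ))) ^ 2 *
          Real.exp ((4 * K + 1) * T))) atTop (𝓝 0) := by
        have := ((((hε.const_mul (C * √B)).pow 2).const_mul T).mul_const
          (Real.exp ((4 * K + 1) * T))).sqrt
        simpa using this
      refine squeeze_zero (fun k => norm_nonneg _) (fun k => ?_) h4
      rw [norm_sub_rev]
      exact Real.le_sqrt_of_sq_le ((hx k).norm_sub_sq_le hν (h1 k) hT hm ha hb hc ha0 hfi (bx k)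
        hu hu' hD hM' hM'' heq t ht)
    rw [← comp_zero, comp_sub, tendsto_nhds_unique h2 h3, hz, restrictSobolev,
      comp_mkSobolev _ (Nat.zero_le _)]
  · have h2 : Tendsto (fun k => ‖z - y k‖ ^ 2) atTop (𝓝 (‖z - Y‖ ^ 2)) :=
      ((tendsto_const_nhds.sub hY).norm).pow 2
    have h3 : Tendsto (fun k : ℕ => T * (m + 1) *
        (C * √B * (1 / (n : ℝ) + 1 / ((k + 1 : ℕ) : ℝ))) ^ 2 * X) atTop
        (𝓝 (T * (m + 1) * (C * √B * (1 / (n : ℝ) + 0)) ^ 2 * X)) :=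
      ((((tendsto_const_nhds.add hε).const_mul _).pow 2).const_mul _).mul_const _
    have h4 := le_of_tendsto_of_tendsto' h2 h3 fun k => by
      rw [norm_restrictSobolev_sub_sq]
      exact hv.sum_norm_sub_sq_le hν hn (h1 k) hT hm ha hb hc ha0 hfi (hx k) bv t ht
    rw [norm_sub_rev]
    refine h4.trans ?_
    -- The squared error found so far is quadratic in the mesh; the stated linear bound follows
    -- because the mesh is at most one.
    have h5 : (1 / (n : ℝ)) ^ 2 ≤ 1 / (n : ℝ) := by
      have h6 : 1 / (n : ℝ) ≤ 1 := by
        rw [div_le_one (by exact_mod_cast hn)]; exact_mod_cast hn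
      have h7 := pos_mesh hn
      nlinarith
    have h8 : 0 ≤ T * (m + 1) * C ^ 2 * X * B := by positivity
    calc _ = T * (m + 1) * C ^ 2 * X * √B ^ 2 * (1 / (n : ℝ)) ^ 2 := by rw [add_zero]; ring
      _ = T * (m + 1) * C ^ 2 * X * B * (1 / (n : ℝ)) ^ 2 := by rw [Real.sq_sqrt hB0]
      _ ≤ T * (m + 1) * C ^ 2 * X * B * (1 / (n : ℝ)) := mul_le_mul_of_nonneg_left h5 h8
      _ = _ := by rw [errorConst, hB]; ring

/-! ### Solutions on the time interval -/

/-- The equation sees only times in `[0, T]`, so the data may be frozen outside. Bounds and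
measurability then hold for all real times. -/
theorem IsSolution.comp_clamp {T : ℝ} {a b c : ℝ → ℝ → ℝ} {m : ℕ} {ψ : SobolevH m}
    {f : ℝ → SobolevH m} {u : ℝ → SobolevH 1} (h : IsSolution T ν a b c ψ f u) :
    IsSolution T ν (fun t => a (clamp T t)) (fun t => b (clamp T t)) (fun t => c (clamp T t)) ψ
      (fun t => f (clamp T t)) (fun t => u (clamp T t)) := by
  refine ⟨fun v => (h.1 v).congr fun t ht => by simp only [clamp_eq ht], fun φ hφ t ht => ?_⟩
  have key : ∀ F : ℝ → ℝ, ∫ s in (0 : ℝ)..t, F (clamp T s) = ∫ s in (0 : ℝ)..t, F s := fun F =>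
    intervalIntegral.integral_congr fun s hs => by
      rw [uIcc_of_le ht.1] at hs
      simp only [clamp_eq (⟨hs.1, hs.2.trans ht.2⟩ : s ∈ Icc 0 T)]
  have h1 := h.2 φ hφ t ht
  rw [← key, ← key (fun s => ∫ z in {z : ℝ | |z| ≤ 1}, _ ∂ν),
    ← key (fun s => ∫ z in {z : ℝ | 1 < |z|}, _ ∂ν), ← key (fun s => ∫ x, toL2 (f s) x * φ x)] at h1
  simp only [clamp_eq ht]
  exact h1

/-- Weak continuity on a compact interval gives pointwise bounded functionals; uniform boundedness
does the rest. -/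
theorem IsSolution.exists_bound {T : ℝ} (hT : 0 ≤ T) {a b c : ℝ → ℝ → ℝ} {m : ℕ}
    {ψ : SobolevH m} {f : ℝ → SobolevH m} {u : ℝ → SobolevH 1}
    (h : IsSolution T ν a b c ψ f u) : ∃ M, ∀ t, ‖u (clamp T t)‖ ≤ M := by
  obtain ⟨M, hM⟩ := banach_steinhaus (g := fun t : ℝ => innerSL ℝ (u (clamp T t))) fun v => by
    obtain ⟨C, hC⟩ := isCompact_Icc.exists_bound_of_continuousOn (h.1 v)
    exact ⟨C, fun t => hC _ (clamp_mem hT t)⟩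
  exact ⟨M, fun t => by simpa only [innerSL_apply_norm] using hM t⟩

theorem IsSolution.stronglyMeasurable {T : ℝ} (hT : 0 ≤ T) {a b c : ℝ → ℝ → ℝ} {m : ℕ}
    {ψ : SobolevH m} {f : ℝ → SobolevH m} {u : ℝ → SobolevH 1}
    (h : IsSolution T ν a b c ψ f u) : StronglyMeasurable fun t => u (clamp T t) :=
  stronglyMeasurable_of_inner fun v => (continuous_comp_clamp hT (h.1 v)).measurable

theorem inner_smallJump_testLp (hν : LevyMoments ν μ₀ μ₂) {φ : ℝ → ℝ} (hφ : IsTest φ) (v : L2) :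
    inner ℝ (smallJump ν v) (testLp hφ) = ∫ z in {z : ℝ | |z| ≤ 1}, (∫ θ in (0 : ℝ)..1,
      (1 - θ) * z ^ 2 * (∫ x, v (x + θ * z) * φ x)) ∂ν := by
  have e : ∀ y, ∫ x, v (x + y) * φ x = inner ℝ (shift y v) (testLp hφ) := fun y => by
    rw [inner_testLp]
    refine integral_congr_ae ?_
    filter_upwards [coeFn_shift y v] with x hx
    rw [hx]
  simp only [e]
  exact inner_smallJump hν v _

theorem inner_largeJump_testLp (hν : LevyMoments ν μ₀ μ₂) {φ : ℝ → ℝ} (hφ : IsTest φ) (u : L2) :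
    inner ℝ (largeJump ν id u) (testLp hφ) =
      ∫ z in {z : ℝ | 1 < |z|}, (∫ x, (u (x + z) - u x) * φ x) ∂ν := by
  have e : ∀ z, ∫ x, (u (x + z) - u x) * φ x = inner ℝ (testLp hφ) (shift z u - u) := fun z => by
    rw [real_inner_comm, inner_testLp]
    refine integral_congr_ae ?_
    filter_upwards [coeFn_shift z u, Lp.coeFn_sub (shift z u) u] with x h1 h2
    rw [h2, Pi.sub_apply, h1]
  simp only [e]
  rw [real_inner_comm]
  exact ((innerSL ℝ (testLp hφ)).integral_comp_comm
    (integrable_largeJump hν measurable_id u)).symm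

theorem inner_weakForm (hν : LevyMoments ν μ₀ μ₂) {K : ℝ} {a b c : ℝ → ℝ} (ha : BddDeriv K 1 a)
    (hb : IsMul K b) (hc : IsMul K c) {φ : ℝ → ℝ} (hφ : IsTest φ) (u v : L2) :
    inner ℝ (weakZero ν a b c u v) (testLp hφ) + inner ℝ (weakOne ν a v) (testLp hφ.deriv) =
      ((∫ x, v x * (-(φ x * deriv a x) - a x * deriv φ x + b x * φ x)) +
        ∫ x, c x * u x * φ x)
      - (∫ z in {z : ℝ | |z| ≤ 1}, (∫ θ in (0 : ℝ)..1,
          (1 - θ) * z ^ 2 * (∫ x, v (x + θ * z) * deriv φ x)) ∂ν)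
      + ∫ z in {z : ℝ | 1 < |z|}, (∫ x, (u (x + z) - u x) * φ x) ∂ν := by
  have ha0 := ha.isMul_zero
  have ha1 : IsMul K (iteratedDeriv 1 a) := ha.isMul le_rfl
  have e1 : ∫ x, v x * (-(φ x * deriv a x) - a x * deriv φ x + b x * φ x) =
      inner ℝ v (-(mulL2 (iteratedDeriv 1 a) (testLp hφ)) - mulL2 a (testLp hφ.deriv) +
        mulL2 b (testLp hφ)) := by
    rw [inner_eq_integral]
    refine integral_congr_ae ?_
    filter_upwards [coeFn_testLp hφ, coeFn_testLp hφ.deriv, coeFn_mulL2 ha1 (testLp hφ),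
      coeFn_mulL2 ha0 (testLp hφ.deriv), coeFn_mulL2 hb (testLp hφ),
      Lp.coeFn_add (-(mulL2 (iteratedDeriv 1 a) (testLp hφ)) - mulL2 a (testLp hφ.deriv))
        (mulL2 b (testLp hφ)),
      Lp.coeFn_sub (-(mulL2 (iteratedDeriv 1 a) (testLp hφ))) (mulL2 a (testLp hφ.deriv)),
      Lp.coeFn_neg (mulL2 (iteratedDeriv 1 a) (testLp hφ))] with x h1 h2 h3 h4 h5 h6 h7 h8
    rw [h6, Pi.add_apply, h7, Pi.sub_apply, h8, Pi.neg_apply, h3, h4, h5, h1, h2,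
      iteratedDeriv_one]
    ring
  have e2 : ∫ x, c x * u x * φ x = inner ℝ (mulL2 c u) (testLp hφ) := by
    rw [inner_testLp]
    refine integral_congr_ae ?_
    filter_upwards [coeFn_mulL2 hc u] with x hx
    rw [hx]
  rw [e1, e2, ← inner_smallJump_testLp hν hφ.deriv, ← inner_largeJump_testLp hν hφ, weakZero, weakOne]
  simp only [inner_add_left, inner_sub_left, inner_neg_left, inner_add_right, inner_sub_right,
    inner_neg_right, inner_mulL2_left ha0, inner_mulL2_left ha1, inner_mulL2_left hb]
  ring

theorem IsSolution.isWeakSolution (hν : LevyMoments ν μ₀ μ₂) {K T : ℝ} (hT : 0 ≤ T) {r : ℕ}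
    (hr : 1 ≤ r) {a b c : ℝ → ℝ → ℝ} (ha : TimeCoeff K r a) (hb : TimeCoeff K r b)
    (hc : TimeCoeff K r c) {m : ℕ} {ψ : SobolevH m} {f : ℝ → SobolevH m}
    (hf : IntervalIntegrable f volume 0 T) {u : ℝ → SobolevH 1} (hu : StronglyMeasurable u)
    {M : ℝ} (hM : ∀ t, ‖u t‖ ≤ M) (h : IsSolution T ν a b c ψ f u) :
    IsWeakSolution T ν a b c (toL2 ψ) (fun s => toL2 (f s)) (fun s => comp (u s) 0)
      (fun s => comp (u s) 1) := by
  intro φ hφ t ht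
  have hcu : ∀ j, StronglyMeasurable fun s => comp (u s) j := fun j =>
    (continuous_comp j).comp_stronglyMeasurable hu
  have bu : ∀ j s, ‖comp (u s) j‖ ≤ M := fun j s => (norm_comp_le _ _).trans (hM s)
  have ha1 : ∀ s, BddDeriv K 1 (a s) := fun s => (ha.2 s).mono hr
  have hb0 : ∀ s, IsMul K (b s) := fun s => (hb.2 s).isMul_zero
  have hc0 : ∀ s, IsMul K (c s) := fun s => (hc.2 s).isMul_zero
  have iF : IntervalIntegrable (fun s => inner ℝ (toL2 (f s)) (testLp hφ)) volume 0 t := by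
    simp only [← comp_zero]
    exact intervalIntegrable_inner_const ((intervalIntegrable_comp hf 0).mono_set
      (uIcc_subset_uIcc left_mem_uIcc (by rwa [uIcc_of_le hT]))) _
  have iW : IntervalIntegrable (fun s =>
      inner ℝ (weakZero ν (a s) (b s) (c s) (comp (u s) 0) (comp (u s) 1)) (testLp hφ) +
        inner ℝ (weakOne ν (a s) (comp (u s) 1)) (testLp hφ.deriv)) volume 0 t :=
    (intervalIntegrable_inner_const (intervalIntegrable_of_bound
      (stronglyMeasurable_weakZero hν hr ha hb hc (hcu 0) (hcu 1))
      (fun s => norm_weakZero_le hν (ha1 s) (hb0 s) (hc0 s) (bu 0 s) (bu 1 s)) 0 t) _).add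
    (intervalIntegrable_inner_const (intervalIntegrable_of_bound
      (stronglyMeasurable_weakOne hν ha (hcu 1))
      (fun s => norm_weakOne_le hν (ha.2 s).isMul_zero (bu 1 s)) 0 t) _)
  have iC : IntervalIntegrable (fun s =>
      inner ℝ (smallJump ν (comp (u s) 1)) (testLp hφ.deriv)) volume 0 t :=
    intervalIntegrable_inner_const (intervalIntegrable_of_bound (C := μ₂ * M)
      ((transOp_smallJump hν).continuous.comp_stronglyMeasurable (hcu 1))
      (fun s => ((transOp_smallJump hν).norm_le _).trans
        (mul_le_mul_of_nonneg_left (bu 1 s) μ₂.2)) 0 t) _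
  have iD : IntervalIntegrable (fun s =>
      inner ℝ (largeJump ν id (comp (u s) 0)) (testLp hφ)) volume 0 t :=
    intervalIntegrable_inner_const (intervalIntegrable_of_bound (C := 2 * μ₀ * M)
      ((transOp_largeJump hν measurable_id).continuous.comp_stronglyMeasurable (hcu 0))
      (fun s => ((transOp_largeJump hν measurable_id).norm_le _).trans
        (mul_le_mul_of_nonneg_left (bu 0 s) (by positivity))) 0 t) _
  have eW : ∀ s, inner ℝ (weakZero ν (a s) (b s) (c s) (comp (u s) 0) (comp (u s) 1)) (testLp hφ) +
      inner ℝ (weakOne ν (a s) (comp (u s) 1)) (testLp hφ.deriv) =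
      ((∫ x, comp (u s) 1 x * (-(φ x * deriv (a s) x) - a s x * deriv φ x + b s x * φ x)) +
        ∫ x, c s x * comp (u s) 0 x * φ x) -
      inner ℝ (smallJump ν (comp (u s) 1)) (testLp hφ.deriv) +
      inner ℝ (largeJump ν id (comp (u s) 0)) (testLp hφ) := fun s => by
    rw [inner_weakForm hν (ha1 s) (hb0 s) (hc0 s) hφ, inner_smallJump_testLp hν hφ.deriv,
      inner_largeJump_testLp hν hφ]
  -- Merging the separate time integrals needs integrability of each; that of the local part is
  -- recovered from the whole weak form minus its jump terms.
  have iA : IntervalIntegrable (fun s =>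
      (∫ x, comp (u s) 1 x * (-(φ x * deriv (a s) x) - a s x * deriv φ x + b s x * φ x)) +
        ∫ x, c s x * comp (u s) 0 x * φ x) volume 0 t := by
    refine ((iW.add iC).sub iD).congr fun s _ => ?_
    simp only [eW]
    ring
  have h1 := h.2 φ hφ t ht
  have e1 : ∀ w : SobolevH 1, dx w = comp w 1 := fun w => rfl
  simp only [e1, ← comp_zero (m := 1), ← inner_testLp hφ, ← inner_smallJump_testLp hν hφ.deriv,
    ← inner_largeJump_testLp hν hφ] at h1
  rw [h1, intervalIntegral.integral_add iW iF]
  simp only [eW]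
  rw [intervalIntegral.integral_add (iA.sub iC) iD, intervalIntegral.integral_sub iA iC]
  ring

end

/-! ### Extension of the data to all times -/

theorem measurable_clamp_subtype {T : ℝ} (hT : 0 ≤ T) :
    Measurable fun t : ℝ => (⟨clamp T t, clamp_mem hT t⟩ : Icc (0 : ℝ) T) :=
  (continuous_clamp T).measurable.subtype_mk

theorem RegularCoeff.timeCoeff {T K : ℝ} (hT : 0 ≤ T) {r : ℕ} {g : ℝ → ℝ → ℝ}
    (hg : RegularCoeff T K r g) : TimeCoeff K r fun t => g (clamp T t) :=
  ⟨hg.1.comp (((measurable_clamp_subtype hT).comp measurable_fst).prodMk measurable_snd),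
    fun t => hg.2 _ (clamp_mem hT t)⟩

theorem FreeTerm.stronglyMeasurable {T : ℝ} (hT : 0 ≤ T) {m : ℕ} {f : ℝ → SobolevH m}
    (hf : FreeTerm T f) : StronglyMeasurable fun t => f (clamp T t) :=
  (hf.1.comp (measurable_clamp_subtype hT)).stronglyMeasurable

theorem integral_comp_clamp {X : Type*} [NormedAddCommGroup X] [NormedSpace ℝ X] {T t : ℝ}
    (ht : t ∈ Icc 0 T) (F : ℝ → X) :
    ∫ s in (0 : ℝ)..t, F (clamp T s) = ∫ s in (0 : ℝ)..t, F s :=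
  intervalIntegral.integral_congr fun s hs => by
    rw [uIcc_of_le ht.1] at hs
    simp only [clamp_eq (⟨hs.1, hs.2.trans ht.2⟩ : s ∈ Icc 0 T)]

theorem dataNormSq_comp_clamp {T : ℝ} (hT : 0 ≤ T) {m : ℕ} (ψ : SobolevH m)
    (f : ℝ → SobolevH m) : dataNormSq T ψ (fun t => f (clamp T t)) = dataNormSq T ψ f := by
  rw [dataNormSq, dataNormSq, integral_comp_clamp (right_mem_Icc.2 hT) fun t => ‖f t‖ ^ 2]

theorem FreeTerm.intervalIntegrable {T : ℝ} (hT : 0 ≤ T) {m : ℕ} {f : ℝ → SobolevH m}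
    (hf : FreeTerm T f) :
    IntervalIntegrable (fun t => ‖f (clamp T t)‖ ^ 2) volume 0 T := by
  rw [intervalIntegrable_iff_integrableOn_Icc_of_le hT]
  exact hf.2.congr_fun (fun t ht => by simp only [clamp_eq ht]) measurableSet_Icc

section

variable {ν : Measure ℝ} {μ₀ μ₂ : ℝ≥0}

/-- After freezing all data outside `[0, T]`, `u^h` is replaced by the bottom component of the
bounded `H^m`-valued scheme solution, to which the rate of convergence applies. -/
theorem IsSemidiscreteSolution.exists_error (hν : LevyMoments ν μ₀ μ₂) {K T : ℝ} (hT : 0 ≤ T)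
    {m : ℕ} (hm3 : 3 ≤ m) {a b c : ℝ → ℝ → ℝ} (ha : RegularCoeff T K m a)
    (hb : RegularCoeff T K m b) (hc : RegularCoeff T K m c)
    (ha0 : ∀ t ∈ Icc (0 : ℝ) T, ∀ x, 0 ≤ a t x) {ψ : SobolevH m} {f : ℝ → SobolevH m}
    (hf : FreeTerm T f) {u : ℝ → SobolevH 1} (hu : IsSolution T ν a b c ψ f u) {n : ℕ}
    (hn : 1 ≤ n) {uh : ℝ → L2} (huh : IsSemidiscreteSolution T ν a b c ψ f (1 / (n : ℝ)) uh)
    {t : ℝ} (ht : t ∈ Icc (0 : ℝ) T) :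
    ∃ e : SobolevH (m - 3), toL2 e = toL2 (u t) - uh t ∧
      ‖e‖ ^ 2 ≤ errorConst m T K μ₀ μ₂ * dataNormSq T ψ f * (1 / (n : ℝ)) := by
  have hA := ha.timeCoeff hT
  have hB := hb.timeCoeff hT
  have hC := hc.timeCoeff hT
  have hA0 : ∀ t x, 0 ≤ a (clamp T t) x := fun t => ha0 _ (clamp_mem hT t)
  have hfm := hf.stronglyMeasurable hT
  have hf2 := hf.intervalIntegrable hT
  have hfi := intervalIntegrable_of_norm_sq hfm hf2
  obtain ⟨v, hv, hvb⟩ := exists_bounded_scheme_solution hν hn hT hm3 hA hB hC hA0 ψ hfm hf2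
  have huv : uh t = comp (v t) 0 := by
    have h := hv.eq_comp_zero hν hn hT hm3 hA hB hC hA0 hfi (continuous_comp_clamp hT huh.1)
      (fun s hs => by
        rw [clamp_eq hs, huh.2 s hs]
        exact congrArg _ (integral_comp_clamp hs fun s => opLh (1 / (n : ℝ)) (a s) (b s) (c s)
          (uh s) + opJh ν (1 / (n : ℝ)) (uh s) + toL2 (f s)).symm) t ht
    rwa [clamp_eq ht] at h
  obtain ⟨M, hM⟩ := hu.exists_bound hT
  have hum := hu.stronglyMeasurable hT
  have hw := hu.comp_clamp.isWeakSolution hν hT (by omega) hA hB hC hfi hum hM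
  obtain ⟨e, he, hle⟩ := hv.exists_error hν hn hT hm3 hA hB hC hA0 hfm hf2 hvb
    ((continuous_comp 0).comp_stronglyMeasurable hum)
    ((continuous_comp 1).comp_stronglyMeasurable hum)
    (fun s => hasD_comp (u (clamp T s)) Nat.zero_lt_one)
    (fun s => (norm_comp_le _ _).trans (hM s)) (fun s => (norm_comp_le _ _).trans (hM s)) hw ht
  refine ⟨e, ?_, ?_⟩
  · rw [he, huv, clamp_eq ht, comp_zero]
  · rwa [dataNormSq_comp_clamp hT] at hle

end

end

end LevyPIDE

/-! ### The theorem, with the explicit constant `errorConst` -/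

theorem mainTheorem4 (m : ℕ) (hm : 4 ≤ m) (T : ℝ) (hT : 0 ≤ T) (K : ℝ) (μ₀ μ₂ : ℝ≥0) :
    ∃ N : ℝ,
      ∀ (ν : Measure ℝ), LevyPIDE.IsLevyMeasure ν →
        ν {z : ℝ | 1 < |z|} = μ₀ →
        ∫⁻ z in {z : ℝ | |z| ≤ 1}, ENNReal.ofReal (z ^ 2) ∂ν = μ₂ →
      ∀ (a b c : ℝ → ℝ → ℝ),
        LevyPIDE.RegularCoeff T K (max m 2) a →
        LevyPIDE.RegularCoeff T K m b →
        LevyPIDE.RegularCoeff T K m c →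
        (∀ t ∈ Icc (0 : ℝ) T, ∀ x, 0 ≤ a t x) →
      ∀ (ψ : LevyPIDE.SobolevH m) (f : ℝ → LevyPIDE.SobolevH m),
        LevyPIDE.FreeTerm T f →
      ∀ (u : ℝ → LevyPIDE.SobolevH 1), LevyPIDE.IsSolution T ν a b c ψ f u →
      ∀ (n : ℕ), 1 ≤ n →
      ∀ (uh : ℝ → LevyPIDE.L2),
        LevyPIDE.IsSemidiscreteSolution T ν a b c ψ f (1 / (n : ℝ)) uh →
      ∀ t ∈ Icc (0 : ℝ) T,
        ∃ e : LevyPIDE.SobolevH (m - 3),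
          LevyPIDE.toL2 e = LevyPIDE.toL2 (u t) - uh t ∧
          ‖e‖ ^ 2 ≤ N * LevyPIDE.dataNormSq T ψ f * (1 / (n : ℝ)) := by
  refine ⟨LevyPIDE.errorConst m T K μ₀ μ₂, fun ν hν hlarge hsmall a b c ha hb hc ha0 ψ f hf u hu n
    hn uh huh t ht => ?_⟩
  rw [max_eq_left (by omega)] at ha
  exact huh.exists_error ⟨hν.1, hlarge, hsmall⟩ hT (by omega) ha hb hc ha0 hf hu hn ht
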